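/- Let $\mathfrak g=V_1\oplus\dots\oplus V_s$ be a stratified real Lie algebra of step $s$ (that is, $[V_1,V_j]=V_{j+1}$ for $1\le j<s$, $[V_1,V_s]=0$, $V_s\neq 0$), with $\dim\mathfrak g=n$ and $m=\dim V_1$, and let $\mathbb G$ be the corresponding Carnot group, i.e. the connected and simply connected Lie group with Lie algebra $\mathfrak g$. Through the exponential map we identify $\mathbb G$ with $\mathfrak g$ endowed with the Baker–Campbell–Hausdorff product; the dilation $\delta_\lambda$ ($\lambda>0$) is multiplication by $\lambda^i$ on $V_i$. Fix on $\mathbb G$ a continuous homogeneous norm $\|\cdot\|$ and a continuous left-invariant homogeneous distance $d$, with open balls $B(\cdot,r)$. Let $\mathbb W,\mathbb L$ be complementary subgroups of $\mathbb G$: both are closed under the dilations, $\mathbb G=\mathbb W\cdot\mathbb L$ and $\mathbb W\cap\mathbb L=\{e\}$. Let $\pi_{\mathbb W},\pi_{\mathbb L}$ be the projections given by $g=\pi_{\mathbb W}(g)\cdot\pi_{\mathbb L}(g)$. Assume that $\mathbb L$ is horizontal and $k$-dimensional. Fix an adapted basis $(X_1,\dots,X_n)$ of $\mathfrak g$ such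 that $\mathbb L=\exp(\mathrm{span}\{X_1,\dots,X_k\})$ with $k\le m$ and $\mathbb W=\exp(\mathrm{span}\{X_{k+1},\dots,X_n\})$. Adapted means that for every $j=1,\dots,s$ the elements $X_i$ with $\dim(V_1\oplus\dots\oplus V_{j-1})<i\le\dim(V_1\oplus\dots\oplus V_j)$ form a basis of $V_j$ and are iterated commutators of order $j-1$ of $X_1,\dots,X_m$; for these $i$ one sets $\deg i=j$. Let $\widetilde U\subseteq\mathbb W$ be relatively open and let $\widetilde\phi\colon\widetilde U\to\mathbb L$ be uniformly intrinsically differentiable (UID). This means that for every $a_0\in\widetilde U$ there is a map $\ell\colon\mathbb W\to\mathbb L$ whose graph $\{w\cdot \ell(w):w\in\mathbb W\}$ is a homogeneous subgroup and such that, with $p_a=\widetilde\phi(a)^{-1}\cdot a^{-1}$, $$\lim_{r\to0}\ \sup\left\{\frac{\|\ell(b)^{-1}\cdot\widetilde\phi_{p_a}(b)\|}{\|b\|}:\ a\in\widetilde U\cap B(a_0,r),\ b\in\widetilde U_{p_a}\cap B(e,r),\ b\ne e\right\}=0,$$ where, for $q\in\mathbb G$, $\widetilde U_q=\{a\in\mathbb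 W:\pi_{\mathbb W}(q^{-1}\cdot a)\in\widetilde U\}$ and $\widetilde\phi_q(a)=\pi_{\mathbb L}(q^{-1}\cdot a)^{-1}\cdot\widetilde\phi(\pi_{\mathbb W}(q^{-1}\cdot a))$. Let $\phi\colon U\subseteq\mathbb R^{n-k}\to\mathbb R^k$ be $\widetilde\phi$ read in the exponential coordinates of $(X_1,\dots,X_n)$ on $\mathbb W$ and $\mathbb L$, and for $j>k$ let $D^\phi_{X_j}$ be the projected vector field on $U$ which in the same coordinates is $w\mapsto \frac{\mathrm d}{\mathrm dt}\big|_{t=0}\,\pi_{\mathbb W}\big(w\cdot\widetilde\phi(w)\cdot\exp(tX_j)\big)$. Then the following hold. 1. For every $V\subseteq U$ whose closure is compact and contained in $U$, $$\lim_{\varrho\to0}\ \sup\left\{\frac{|\phi(\gamma(t))-\phi(\gamma(s'))|}{|t-s'|^{1/\deg j}}:\ j=m+1,\dots,n,\ \gamma\colon I\to V,\ \gamma'=D^\phi_{X_j}\circ\gamma,\ t,s'\in I,\ 0<|t-s'|\le\varrho\right\}=0,$$ where $I$ ranges over all intervals of $\mathbb R$ (and the supremum over the empty set is $0$). 2. If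 $s\ge2$, then $\phi\in h^{1/s}_{\rm loc}(U;\mathbb R^k)$: $\phi$ is continuous on $U$, and for every open $U'$ whose closure is compact and contained in $U$, $$\lim_{r\to0}\ \sup\left\{\frac{|\phi(b)-\phi(a)|}{|b-a|^{1/s}}:\ a,b\in U',\ 0<|b-a|<r\right\}=0.$$ -/

import Mathlib

open Set

noncomputable section

/-! ### Stratified Lie algebras and the Baker-Campbell-Hausdorff product -/

/-- A stratification of step `s` of a real Lie algebra `𝔤`:
`𝔤 = V₁ ⊕ ⋯ ⊕ V_s`, `[V₁, V_j] = V_{j+1}` for `1 ≤ j < s`, `[V₁, V_s] = 0` and `V_s ≠ 0`.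
The layers are indexed by `ℕ`, with `V_j = 0` for `j = 0` and for `j > s`. -/
structure Stratification (𝔤 : Type*) [LieRing 𝔤] [LieAlgebra ℝ 𝔤] (s : ℕ) where
  layer : ℕ → Submodule ℝ 𝔤
  layer_zero : layer 0 = ⊥
  layer_gt : ∀ j, s < j → layer j = ⊥
  layer_step : layer s ≠ ⊥
  isInternal : DirectSum.IsInternal layer
  bracket : ∀ j, 1 ≤ j →
    Submodule.span ℝ {z : 𝔤 | ∃ x ∈ layer 1, ∃ y ∈ layer j, ⁅x, y⁆ = z} = layer (j + 1)

/-- The right-nested bracket `[w₁, [w₂, [⋯ [w_{N-1}, w_N] ⋯ ]]]` of a word. -/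
def nestedBracket {𝔤 : Type*} [LieRing 𝔤] : List 𝔤 → 𝔤
  | [] => 0
  | [x] => x
  | x :: y :: l => ⁅x, nestedBracket (y :: l)⁆

/-- The word `x^{r₁} y^{t₁} ⋯ x^{rₙ} y^{tₙ}`, where `p i = (rᵢ, tᵢ)`. -/
def dynkinWord {𝔤 : Type*} (x y : 𝔤) {s n : ℕ} (p : Fin n → Fin (s + 1) × Fin (s + 1)) :
    List 𝔤 :=
  (List.ofFn p).flatMap fun a =>
    List.replicate (a.1 : ℕ) x ++ List.replicate (a.2 : ℕ) y

/-- The Baker-Campbell-Hausdorff product on a Lie algebra that is nilpotent of step at most `s`,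
given by Dynkin's formula
`∑ₙ (-1)^{n-1}/n ∑_{rᵢ+tᵢ>0} [x^{r₁} y^{t₁} ⋯ x^{rₙ} y^{tₙ}] / (∑ᵢ (rᵢ+tᵢ) ∏ᵢ rᵢ! tᵢ!)`.
All the terms with `n > s`, `rᵢ > s` or `tᵢ > s` vanish, so that the sum is finite. -/
def bch {𝔤 : Type*} [LieRing 𝔤] [LieAlgebra ℝ 𝔤] (s : ℕ) (x y : 𝔤) : 𝔤 :=
  ∑ n ∈ Finset.Icc 1 s,
    ∑ p ∈ (Finset.univ : Finset (Fin n → Fin (s + 1) × Fin (s + 1))).filter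
        (fun p => ∀ i, 0 < ((p i).1 : ℕ) + ((p i).2 : ℕ)),
      (((-1 : ℝ) ^ (n - 1) / (n : ℝ)) *
        ((∑ i, (((p i).1 : ℕ) + ((p i).2 : ℕ)) : ℕ) : ℝ)⁻¹ *
        ((∏ i, (Nat.factorial ((p i).1 : ℕ) * Nat.factorial ((p i).2 : ℕ)) : ℕ) : ℝ)⁻¹) •
        nestedBracket (dynkinWord x y p)

namespace Stratification

section

variable {𝔤 : Type*} [LieRing 𝔤] [LieAlgebra ℝ 𝔤] {s : ℕ} (S : Stratification 𝔤 s)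

/-! ### The Carnot group

The connected and simply connected Lie group with Lie algebra `𝔤` is `𝔤` itself with the
Baker-Campbell-Hausdorff product. In this model the exponential map is the identity, the identity
element is `0`, the inverse of `x` is `-x` and `t ↦ t • X` is the one-parameter subgroup
generated by `X`. -/

/-- The group law `x · y` of the Carnot group. -/
def mul (_S : Stratification 𝔤 s) (x y : 𝔤) : 𝔤 := bch s x y

/-- The linear projection of `𝔤` onto the layer `V_j`. -/
def proj (j : ℕ) : 𝔤 →ₗ[ℝ] 𝔤 :=
  (S.layer j).subtype ∘ₗ DirectSum.component ℝ ℕ (fun i => S.layer i) j ∘ₗ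
    (LinearEquiv.ofBijective (DirectSum.coeLinearMap S.layer) S.isInternal).symm.toLinearMap

/-- The dilation `δ_lam`, equal to `lam ^ j` times the identity on `V_j`. -/
def dil (lam : ℝ) (x : 𝔤) : 𝔤 := ∑ j ∈ Finset.range (s + 1), lam ^ j • S.proj j x

/-- Homogeneous norms. -/
structure IsHomNorm [TopologicalSpace 𝔤] (N : 𝔤 → ℝ) : Prop where
  continuous : Continuous N
  nonneg : ∀ g, 0 ≤ N g
  eq_zero_iff : ∀ g, N g = 0 ↔ g = 0
  dil : ∀ lam : ℝ, 0 < lam → ∀ g, N (S.dil lam g) = lam * N g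
  inv : ∀ g, N (-g) = N g

/-- Left-invariant homogeneous distances. -/
structure IsHomDist [TopologicalSpace 𝔤] (d : 𝔤 → 𝔤 → ℝ) : Prop where
  continuous : Continuous fun p : 𝔤 × 𝔤 => d p.1 p.2
  eq_zero_iff : ∀ g h, d g h = 0 ↔ g = h
  symm : ∀ g h, d g h = d h g
  triangle : ∀ g h k, d g k ≤ d g h + d h k
  left_inv : ∀ p g h, d (S.mul p g) (S.mul p h) = d g h
  dil : ∀ lam : ℝ, 0 < lam → ∀ g h, d (S.dil lam g) (S.dil lam h) = lam * d g h

/-- Homogeneous subgroups. -/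
structure IsHomSubgroup (H : Set 𝔤) : Prop where
  one_mem : (0 : 𝔤) ∈ H
  mul_mem : ∀ g ∈ H, ∀ h ∈ H, S.mul g h ∈ H
  inv_mem : ∀ g ∈ H, -g ∈ H
  dil_mem : ∀ lam : ℝ, 0 < lam → ∀ g ∈ H, S.dil lam g ∈ H

/-- Complementary subgroups: homogeneous subgroups with `G = W · L` and `W ∩ L = {e}`. -/
structure IsComplementary (W L : Set 𝔤) : Prop where
  left : S.IsHomSubgroup W
  right : S.IsHomSubgroup L
  exists_mul : ∀ g, ∃ w ∈ W, ∃ l ∈ L, g = S.mul w l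
  inter : W ∩ L = {0}

open Classical in
/-- The projection `g ↦ g_W` determined by `g = g_W · g_L`. -/
def projW (W L : Set 𝔤) (g : 𝔤) : 𝔤 :=
  if h : ∃ w ∈ W, ∃ l ∈ L, g = S.mul w l then h.choose else 0

/-- The projection `g ↦ g_L = g_W⁻¹ · g` determined by `g = g_W · g_L`. -/
def projL (W L : Set 𝔤) (g : 𝔤) : 𝔤 := S.mul (-(S.projW W L g)) g

/-! ### Intrinsic graphs and uniform intrinsic differentiability

A function `φ : U ⊆ W → L` is given as a total function on `𝔤`, only whose values on `U` are
used. -/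

/-- The domain `U_q = {a ∈ W : π_W(q⁻¹ · a) ∈ U}` of the intrinsic translation. -/
def transDom (W L U : Set 𝔤) (q : 𝔤) : Set 𝔤 := {a ∈ W | S.projW W L (S.mul (-q) a) ∈ U}

/-- The intrinsic translation `φ_q(a) = (π_L(q⁻¹ · a))⁻¹ · φ(π_W(q⁻¹ · a))`. -/
def trans (W L : Set 𝔤) (φ : 𝔤 → 𝔤) (q a : 𝔤) : 𝔤 :=
  S.mul (-(S.projL W L (S.mul (-q) a))) (φ (S.projW W L (S.mul (-q) a)))

/-- `ℓ : W → L` is intrinsically linear if `graph ℓ = {w · ℓ(w) : w ∈ W}` is a homogeneous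
subgroup. -/
def IsIntrinsicallyLinear (W L : Set 𝔤) (ℓ : 𝔤 → 𝔤) : Prop :=
  MapsTo ℓ W L ∧ S.IsHomSubgroup ((fun w => S.mul w (ℓ w)) '' W)

/-- Uniform intrinsic differentiability of `φ : U ⊆ W → L` at `a₀`: there is an intrinsically
linear map `ℓ` (the intrinsic differential of `φ` at `a₀`) such that, with
`p_a = φ(a)⁻¹ · a⁻¹`, the supremum of `‖ℓ(b)⁻¹ · φ_{p_a}(b)‖ / ‖b‖` over all
`a ∈ U ∩ B(a₀, r)` and all `b ∈ U_{p_a} ∩ B(e, r)`, `b ≠ e`, tends to `0` as `r → 0`. -/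
def UIDAt (N : 𝔤 → ℝ) (d : 𝔤 → 𝔤 → ℝ) (W L U : Set 𝔤) (φ : 𝔤 → 𝔤) (a₀ : 𝔤) : Prop :=
  ∃ ℓ : 𝔤 → 𝔤, S.IsIntrinsicallyLinear W L ℓ ∧
    ∀ ε : ℝ, 0 < ε → ∃ r : ℝ, 0 < r ∧
      ∀ a ∈ U, d a₀ a < r →
        ∀ b ∈ S.transDom W L U (S.mul (-(φ a)) (-a)), d 0 b < r → b ≠ 0 →
          N (S.mul (-(ℓ b)) (S.trans W L φ (S.mul (-(φ a)) (-a)) b)) / N b ≤ ε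

/-- Uniform intrinsic differentiability on `U`. -/
def UID (N : 𝔤 → ℝ) (d : 𝔤 → 𝔤 → ℝ) (W L U : Set 𝔤) (φ : 𝔤 → 𝔤) : Prop :=
  ∀ a₀ ∈ U, S.UIDAt N d W L U φ a₀

/-! ### Adapted bases and exponential coordinates -/

/-- `n_j = dim V₁ + ⋯ + dim V_j`; in particular `n₁` is the rank `m` of the group. -/
def cumDim (j : ℕ) : ℕ := ∑ i ∈ Finset.Icc 1 j, Module.finrank ℝ (S.layer i)

/-- The rank `m = dim V₁`. -/
def rank : ℕ := Module.finrank ℝ (S.layer 1)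

/-- The holonomic degree of the index `i`, counted from `0`: the unique `j` with
`n_{j-1} ≤ i < n_j`. -/
def deg (i : ℕ) : ℕ := sInf {j : ℕ | i < S.cumDim j}

end

end Stratification

/-- `IsIterComm A p x`: `x` is an iterated commutator of order `p` of elements of `A`, i.e. it is
obtained from elements of `A` by taking `p` brackets. -/
inductive IsIterComm {𝔤 : Type*} [LieRing 𝔤] (A : Set 𝔤) : ℕ → 𝔤 → Prop
  | base {x : 𝔤} : x ∈ A → IsIterComm A 0 x
  | bracket {p q : ℕ} {x y : 𝔤} :
      IsIterComm A p x → IsIterComm A q y → IsIterComm A (p + q + 1) ⁅x, y⁆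

namespace Stratification

section

variable {𝔤 : Type*} [LieRing 𝔤] [LieAlgebra ℝ 𝔤] {s : ℕ} (S : Stratification 𝔤 s)

/-- The basis `X₀, …, X_{n-1}` is adapted: the elements of degree `j` are a basis of `V_j` and are
iterated commutators of order `j - 1` of the first `m` elements. -/
structure IsAdapted {n : ℕ} (X : Module.Basis (Fin n) ℝ 𝔤) : Prop where
  iterComm : ∀ i : Fin n, IsIterComm (X '' {i' | (i' : ℕ) < S.rank}) (S.deg i - 1) (X i)
  span_eq : ∀ j, 1 ≤ j → j ≤ s → Submodule.span ℝ (X '' {i | S.deg i = j}) = S.layer j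

end

end Stratification

section

variable {𝔤 : Type*} [LieRing 𝔤] [LieAlgebra ℝ 𝔤] {k l : ℕ}
  (X : Module.Basis (Fin (k + l)) ℝ 𝔤)

/-- Exponential coordinates on `W = exp(span{X_{k+1}, …, X_n})`, `n = k + l`: the map
`(x_{k+1}, …, x_n) ↦ exp(x_{k+1} X_{k+1} + ⋯ + x_n X_n)`. -/
def expW (x : EuclideanSpace ℝ (Fin l)) : 𝔤 := ∑ j, x j • X (Fin.natAdd k j)

/-- The last `l` exponential coordinates of a point; on `W` this is the inverse of `expW`. -/
def logW (g : 𝔤) : EuclideanSpace ℝ (Fin l) :=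
  WithLp.toLp 2 fun j => X.repr g (Fin.natAdd k j)

/-- The first `k` exponential coordinates of a point, which identify
`L = exp(span{X₁, …, X_k})` with `ℝᵏ`. -/
def logL (g : 𝔤) : EuclideanSpace ℝ (Fin k) :=
  WithLp.toLp 2 fun i => X.repr g (Fin.castAdd l i)

/-- The coordinate representation `ℝ^{n-k} ⊇ U → ℝᵏ` of a function from a subset of `W` to `L`. -/
def coordFun (φ : 𝔤 → 𝔤) (x : EuclideanSpace ℝ (Fin l)) : EuclideanSpace ℝ (Fin k) :=
  logL X (φ (expW X x))

/-- The projected vector field `D^φ_Y`, `Y ∈ Lie(W)`, in exponential coordinates. At `w ∈ U` it is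
the image `d/dt|_{t=0} π_W(w · φ(w) · exp(tY))`, under the differential of `π_W`, of the
left-invariant vector field `Y` at the point `w · φ(w)` of the graph. -/
def projField {s : ℕ} (S : Stratification 𝔤 s) (W L : Set 𝔤) (φ : 𝔤 → 𝔤) (Y : 𝔤)
    (x : EuclideanSpace ℝ (Fin l)) : EuclideanSpace ℝ (Fin l) :=
  deriv (fun t : ℝ =>
    logW X (S.projW W L (S.mul (S.mul (expW X x) (φ (expW X x))) (t • Y)))) 0

end

/-! ### Little Hölder functions -/

/-- `α`-little Hölder continuous functions on `U`, `0 < α < 1`. -/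
def IsLittleHolder {E F : Type*} [MetricSpace E] [MetricSpace F] (α : ℝ) (f : E → F)
    (U : Set E) : Prop :=
  ContinuousOn f U ∧ ∀ ε : ℝ, 0 < ε → ∃ r : ℝ, 0 < r ∧
    ∀ b ∈ U, ∀ b' ∈ U, 0 < dist b' b → dist b' b < r →
      dist (f b') (f b) / dist b' b ^ α ≤ ε

/-- Locally `α`-little Hölder continuous functions on `U`, `0 < α < 1`. -/
def IsLocLittleHolder {E F : Type*} [MetricSpace E] [MetricSpace F] (α : ℝ) (f : E → F)
    (U : Set E) : Prop :=
  ContinuousOn f U ∧ ∀ U' : Set E, IsOpen U' → IsCompact (closure U') → closure U' ⊆ U →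
    IsLittleHolder α f U'

end

/-! Fix a point `x` of the domain with `v = φ(x)`, and describe a nearby point `x'` by the
coordinates `y` of `v⁻¹ · x⁻¹ · x' · v` (`transCoord`). In these coordinates the intrinsic
translation of `φ` is `φ(x') - φ(x)`. An intrinsically linear map depends only on the first layer
and is linear there (`exists_bound_of_conj_mul`), so uniform intrinsic differentiability becomes
`|φ(x') - φ(x)| ≤ C |y|_hor + ε N(y)`, uniformly for `x` in a compact set
(`UID.exists_bound_of_isCompact`).

For the first claim, let `γ` be an integral curve of `D^φ_Y` with `Y` of degree `n ≥ 2`. Seen from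
`γ(0)`, it becomes a curve `β` with `β(0) = 0` and `β' = G(β, ψ)`, where `ψ = φ∘γ - φ(γ(0))` and `G`
is continuous and homogeneous of degree `n` under the dilations. Directions of degree at least two
do not move the first layer, so `|β|_hor = 0` and only `|ψ| ≤ ε' N(β)` remains. If `M` is the
maximum of `|ψ|` on `[0, T]`, rescaling by `lam`, of size `T^{1/n} + M`, gives `N(β) ≲ T^{1/n} + M`.
Hence `M ≲ ε' (T^{1/n} + M)`, and the term in `M` is absorbed (`exists_holder_bound`). Only this a
priori estimate is needed, no existence or uniqueness for the differential equation.

For the second claim, on compact sets `|y| ≲ |x' - x|` and `N(y) ≲ |y|^{1/s}`. The term in `ε` is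
then small compared with `|x' - x|^{1/s}`, and the Lipschitz horizontal term is of lower order
because `s ≥ 2`.

All of this uses that Dynkin's finite sum is a group law. The algebra `𝔤` acts faithfully by
nilpotent operators on `𝔤 × ℝ`, through the adjoint action of its extension by the degree
derivation. The Baker-Campbell-Hausdorff formula for nilpotent associative algebras
(`IsNilFiltration.exp_bchRat`) then turns the product into multiplication of exponentials
(`exists_faithful_exp`). -/

noncomputable section

/-! ### Evaluation of power series at nilpotent elements -/

namespace NilpotentEval

open PowerSeries Finset

variable {A : Type*} [Ring A] [Algebra ℚ A]

/-- The value of a power series at a nilpotent element. -/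
def nev (f : ℚ⟦X⟧) (a : A) : A :=
  ∑ i ∈ range (nilpotencyClass a), coeff i f • a ^ i

theorem nev_eq_sum (f : ℚ⟦X⟧) {a : A} {k : ℕ} (h : a ^ k = 0) :
    nev f a = ∑ i ∈ range k, coeff i f • a ^ i := by
  have h₀ : nilpotencyClass a ≤ k := csInf_le' h
  refine sum_subset (range_mono h₀) fun i _ hi => ?_
  rw [Finset.mem_range, not_lt] at hi
  rw [pow_eq_zero_of_le hi (pow_nilpotencyClass ⟨k, h⟩), smul_zero]

theorem aeval_trunc (P : Polynomial ℚ) {a : A} {k : ℕ} (h : a ^ k = 0) :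
    Polynomial.aeval a (trunc k (P : ℚ⟦X⟧)) = Polynomial.aeval a P := by
  rw [Polynomial.aeval_eq_sum_range' (n := k + P.natDegree + 1)
      ((Polynomial.natDegree_le_of_degree_le (degree_trunc_lt _ k).le).trans_lt (by omega)),
    Polynomial.aeval_eq_sum_range' (n := k + P.natDegree + 1) (by omega)]
  refine sum_congr rfl fun i _ => ?_
  rw [coeff_trunc]
  split_ifs with hi
  · simp
  · rw [pow_eq_zero_of_le (not_lt.1 hi) h, smul_zero, smul_zero]

theorem nev_eq_aeval (f : ℚ⟦X⟧) {a : A} {k : ℕ} (h : a ^ k = 0) :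
    nev f a = Polynomial.aeval a (trunc k f) := by
  rw [nev_eq_sum f h, Polynomial.aeval_eq_sum_range' (n := k + 1)
    ((Polynomial.natDegree_le_of_degree_le (degree_trunc_lt _ k).le).trans_lt (by omega)),
    sum_range_succ, h, smul_zero, add_zero]
  refine sum_congr rfl fun i hi => ?_
  rw [coeff_trunc, if_pos (Finset.mem_range.1 hi)]

/-- Evaluation of power series at a nilpotent element, as an algebra homomorphism. -/
def nevHom {a : A} (ha : IsNilpotent a) : ℚ⟦X⟧ →ₐ[ℚ] A :=
  AlgHom.ofLinearMap
    { toFun := fun f => nev f a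
      map_add' := fun f g => by simp [nev, add_smul, sum_add_distrib]
      map_smul' := fun c f => by simp [nev, mul_smul, smul_sum] }
    (by
      obtain ⟨k, hk⟩ := ha
      have hk' : a ^ (k + 1) = 0 := pow_eq_zero_of_le k.le_succ hk
      simp [nev_eq_aeval _ hk'])
    (fun f g => by
      obtain ⟨k, hk⟩ := ha
      simp only [LinearMap.coe_mk, AddHom.coe_mk, nev_eq_aeval _ hk]
      rw [← map_mul, ← trunc_trunc_mul_trunc, ← Polynomial.coe_mul, aeval_trunc _ hk])

theorem nevHom_apply {a : A} (ha : IsNilpotent a) (f : ℚ⟦X⟧) : nevHom ha f = nev f a := rfl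

theorem nevHom_X {a : A} (ha : IsNilpotent a) : nevHom ha X = a := by
  rw [nevHom_apply]
  obtain ⟨k, hk⟩ := ha
  rw [nev_eq_aeval _ (pow_eq_zero_of_le (by omega : k ≤ k + 2) hk), trunc_X]
  simp

/-- Evaluation sends `X ^ k` to `a ^ k = 0`. Identities between truncated series, valid modulo a
power of `X`, therefore become exact, and compositions such as `exp ∘ log` can be handled by finite
sums. -/
theorem nevHom_eq_of_dvd {a : A} (ha : IsNilpotent a) {k : ℕ} (hk : a ^ k = 0) {f g : ℚ⟦X⟧}
    (h : (X : ℚ⟦X⟧) ^ k ∣ f - g) : nevHom ha f = nevHom ha g := by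
  obtain ⟨q, hq⟩ := h
  rw [← sub_eq_zero, ← map_sub, hq, map_mul, map_pow, nevHom_X, hk, zero_mul]

theorem nev_exp (a : A) : nev (exp ℚ) a = IsNilpotent.exp a := by
  simp [nev, IsNilpotent.exp]

theorem nev_map {B F : Type*} [Ring B] [Algebra ℚ B] [FunLike F A B] [RingHomClass F A B]
    (g : F) (f : ℚ⟦X⟧) {a : A} (ha : IsNilpotent a) : g (nev f a) = nev f (g a) := by
  obtain ⟨k, hk⟩ := ha
  have hk' : g a ^ k = 0 := by rw [← map_pow, hk, map_zero]
  simp [nev_eq_sum _ hk, nev_eq_sum _ hk', map_rat_smul]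

/-! ### Power series identities for `exp` and `log` -/

/-- The coefficients of the series of `log (1 + x)`. -/
def logCoeff (n : ℕ) : ℚ := (-1) ^ (n - 1) / n

/-- With `K + 1` terms, the truncation `F` of `exp (log (1 + X))` satisfies `(1 + X) F' = F - log ^
K / K!`, and `1 + X` satisfies the same equation without the error. As `X ^ K` divides the error,
the difference obeys a recursion that annihilates its coefficients below `K + 1`. -/
theorem X_pow_dvd_exp_log (K : ℕ) :
    (X : ℚ⟦X⟧) ^ K ∣ ∑ k ∈ range K, (k.factorial : ℚ)⁻¹ • log ℚ ^ k - (1 + X) := by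
  rcases K with _ | K
  · simp
  set F : ℚ⟦X⟧ := ∑ k ∈ range (K + 1), (k.factorial : ℚ)⁻¹ • log ℚ ^ k with hF
  have hlog : (1 + X) * d⁄dX ℚ (log ℚ) = 1 := by
    rw [deriv_log]
    ext n
    rcases n with _ | n
    · simp [add_mul]
    · simp [add_mul, coeff_succ_X_mul, pow_succ, coeff_one]
  have hd : (1 + X) * d⁄dX ℚ F = F - (K.factorial : ℚ)⁻¹ • log ℚ ^ K := by
    have hF' : F = ∑ k ∈ range K, (k.factorial : ℚ)⁻¹ • log ℚ ^ k
        + (K.factorial : ℚ)⁻¹ • log ℚ ^ K := by rw [hF, sum_range_succ]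
    rw [hF', add_sub_cancel_right, ← hF', hF, sum_range_succ', map_add, map_sum, mul_add, mul_sum]
    simp only [pow_zero, Derivation.map_smul, Derivation.map_one_eq_zero, smul_zero, mul_zero,
      add_zero]
    refine sum_congr rfl fun k _ => ?_
    rw [Derivation.leibniz_pow, Nat.add_sub_cancel, mul_smul_comm, smul_eq_mul, mul_smul_comm,
      mul_left_comm, hlog, mul_one, ← Nat.cast_smul_eq_nsmul ℚ, smul_smul, Nat.factorial_succ]
    congr 1
    push_cast
    field_simp
  set D : ℚ⟦X⟧ := F - (1 + X) with hD
  have hdD : d⁄dX ℚ D + X * d⁄dX ℚ D = D - (K.factorial : ℚ)⁻¹ • log ℚ ^ K := by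
    have : d⁄dX ℚ D = d⁄dX ℚ F - 1 := by simp [hD]
    rw [this]
    linear_combination hd
  have hD0 : constantCoeff D = 0 := by simp [hD, hF, sum_range_succ']
  clear_value D
  rw [X_pow_dvd_iff]
  intro m
  induction m with
  | zero => simpa using hD0
  | succ n ih =>
    intro hn
    have h0 : coeff n (log ℚ ^ K) = 0 :=
      X_pow_dvd_iff.1 (pow_dvd_pow_of_dvd (X_dvd_iff.2 constantCoeff_log) K) n (by omega)
    have h1 : coeff n (X * d⁄dX ℚ D) = 0 := by
      rcases n with _ | n
      · simp
      · rw [coeff_succ_X_mul, coeff_derivative, ih (by omega), zero_mul]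
    have h2 := congrArg (coeff n) hdD
    rw [map_add, h1, map_sub, ih (by omega), coeff_smul, h0, coeff_derivative] at h2
    have h3 : (n + 1 : ℚ) ≠ 0 := by positivity
    simpa [h3] using h2

/-- Differentiating the truncated logarithm produces a geometric sum in `1 - exp`. It telescopes to
the error `-(1 - exp) ^ K`, which is divisible by `X ^ K`. -/
theorem X_pow_dvd_log_exp (K : ℕ) :
    (X : ℚ⟦X⟧) ^ K ∣ ∑ k ∈ range K, logCoeff k • (exp ℚ - 1) ^ k - X := by
  rcases K with _ | K
  · simp
  set D : ℚ⟦X⟧ := ∑ k ∈ range (K + 1), logCoeff k • (exp ℚ - 1) ^ k - X with hD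
  have hd : d⁄dX ℚ D = -(1 - exp ℚ) ^ K := by
    have h1 : d⁄dX ℚ D = (∑ k ∈ range K, (1 - exp ℚ) ^ k) * (1 - (1 - exp ℚ)) - 1 := by
      rw [hD, sum_range_succ', map_sub, map_add, map_sum, sum_mul]
      simp only [logCoeff, pow_zero, Derivation.map_smul, Derivation.map_one_eq_zero, smul_zero,
        add_zero, derivative_X]
      congr 1
      refine sum_congr rfl fun k _ => ?_
      rw [Derivation.leibniz_pow, Nat.add_sub_cancel, map_sub, derivative_exp,
        Derivation.map_one_eq_zero, ← Nat.cast_smul_eq_nsmul ℚ, smul_smul,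
        div_mul_cancel₀ _ (by positivity), ← neg_sub (exp ℚ) 1, neg_pow (exp ℚ - 1) k, smul_eq_mul,
        smul_eq_C_mul, map_pow, map_neg, map_one]
      ring
    rw [h1, geom_sum_mul_neg]
    ring
  rw [X_pow_dvd_iff]
  rintro (_ | m) hm
  -- The term `k = 0` disappears because `logCoeff 0` is a division by zero, equal to `0`.
  · simp [hD, sum_range_succ', logCoeff]
  · have h0 : (X : ℚ⟦X⟧) ^ K ∣ (1 - exp ℚ) ^ K := pow_dvd_pow_of_dvd (X_dvd_iff.2 (by simp)) K
    have h2 := congrArg (coeff m) hd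
    rw [map_neg, X_pow_dvd_iff.1 h0 m (by omega), coeff_derivative] at h2
    have h3 : (m + 1 : ℚ) ≠ 0 := by positivity
    simpa [h3] using h2

end NilpotentEval

section

attribute [local instance 100] LieRing.ofAssociativeRing

namespace NilpotentEval

open PowerSeries Finset

variable {A : Type*} [Ring A] [Algebra ℚ A]

theorem exp_nev_log {u : A} (hu : IsNilpotent u) :
    IsNilpotent.exp (nev (log ℚ) u) = 1 + u := by
  obtain ⟨K, hK⟩ := hu
  have hu : IsNilpotent u := ⟨K, hK⟩
  rw [← nevHom_apply hu]
  have hz : nevHom hu (log ℚ) ^ K = 0 := by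
    rw [← map_pow, ← map_zero (nevHom hu)]
    refine nevHom_eq_of_dvd hu hK ?_
    rw [sub_zero]
    exact pow_dvd_pow_of_dvd (X_dvd_iff.2 constantCoeff_log) K
  rw [IsNilpotent.exp_eq_sum hz]
  have h := nevHom_eq_of_dvd hu hK (X_pow_dvd_exp_log K)
  simpa [nevHom_X] using h

theorem isNilpotent_nev_log {u : A} (hu : IsNilpotent u) : IsNilpotent (nev (log ℚ) u) := by
  obtain ⟨K, hK⟩ := hu
  have hu : IsNilpotent u := ⟨K, hK⟩
  refine ⟨K, ?_⟩
  rw [← nevHom_apply hu, ← map_pow, ← map_zero (nevHom hu)]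
  refine nevHom_eq_of_dvd hu hK ?_
  rw [sub_zero]
  exact pow_dvd_pow_of_dvd (X_dvd_iff.2 constantCoeff_log) K

theorem exp_eq_nevHom {a : A} (ha : IsNilpotent a) : IsNilpotent.exp a = nevHom ha (exp ℚ) := by
  rw [nevHom_apply, nev_exp]

/-- The exponential map is injective on nilpotent elements. -/
theorem exp_injective {a b : A} (ha : IsNilpotent a) (hb : IsNilpotent b)
    (h : IsNilpotent.exp a = IsNilpotent.exp b) : a = b := by
  obtain ⟨k, hk⟩ := ha
  obtain ⟨m, hm⟩ := hb
  have ha : IsNilpotent a := ⟨k, hk⟩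
  have hb : IsNilpotent b := ⟨m, hm⟩
  have key : ∀ {c : A} (hc : IsNilpotent c), c ^ (k + m) = 0 →
      ∑ n ∈ range (k + m), logCoeff n • (IsNilpotent.exp c - 1) ^ n = c := by
    intro c hc hcm
    have := nevHom_eq_of_dvd hc hcm (X_pow_dvd_log_exp (k + m))
    simpa [nevHom_X, exp_eq_nevHom hc] using this
  rw [← key ha (pow_eq_zero_of_le (by omega) hk), ← key hb (pow_eq_zero_of_le (by omega) hm), h]

/-- The series `log (1 + x) / x`. -/
def logDiv : ℚ⟦X⟧ := mk fun n => logCoeff (n + 1)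

/-- The series `(exp x - 1) / x`. -/
def expDiv : ℚ⟦X⟧ := mk fun n => ((n + 1).factorial : ℚ)⁻¹

theorem X_mul_expDiv : X * expDiv = exp ℚ - 1 := by
  ext n
  rcases n with _ | n
  · simp
  · simp [coeff_succ_X_mul, expDiv, coeff_one]

/-- This is `log (exp x) = x` divided by `x`: the factor `X` is cancelled in the power series ring,
where it is not a zero divisor. It inverts the operator in the derivative of the exponential. -/
theorem logDiv_mul_expDiv {a : A} (ha : IsNilpotent a) :
    nev logDiv (IsNilpotent.exp a - 1) * nev expDiv a = 1 := by
  obtain ⟨k, hk⟩ := ha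
  have ha : IsNilpotent a := ⟨k, hk⟩
  obtain ⟨m, hm⟩ := IsNilpotent.isNilpotent_exp_sub_one ha
  have hm' : (IsNilpotent.exp a - 1) ^ (k + m) = 0 := pow_eq_zero_of_le (by omega) hm
  have hk' : a ^ (k + m) = 0 := pow_eq_zero_of_le (by omega) hk
  have h : (X : ℚ⟦X⟧) ^ (k + m) ∣
      (∑ n ∈ range (k + m), logCoeff (n + 1) • (exp ℚ - 1) ^ n) * expDiv - 1 := by
    have h1 := X_pow_dvd_log_exp (k + m + 1)
    have h2 : ∑ n ∈ range (k + m + 1), logCoeff n • (exp ℚ - 1) ^ n - X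
        = X * ((∑ n ∈ range (k + m), logCoeff (n + 1) • (exp ℚ - 1) ^ n) * expDiv - 1) := by
      rw [mul_sub, mul_left_comm, X_mul_expDiv, sum_range_succ', sum_mul, mul_one]
      simp only [logCoeff, Nat.cast_zero, div_zero, zero_smul, add_zero, smul_mul_assoc, pow_succ]
    rw [h2, pow_succ'] at h1
    exact (mul_dvd_mul_iff_left X_ne_zero).1 h1
  have := nevHom_eq_of_dvd ha hk' h
  rw [nev_eq_sum _ hm', ← nevHom_apply ha]
  simpa [logDiv, exp_eq_nevHom ha] using this

/-! ### The adjoint action and the derivative of the exponential -/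

open LinearMap in
theorem exp_mulLeft {a : A} (ha : IsNilpotent a) :
    IsNilpotent.exp (mulLeft ℚ a) = mulLeft ℚ (IsNilpotent.exp a) :=
  (IsNilpotent.map_exp ha (Algebra.lmul ℚ A)).symm

open LinearMap in
theorem exp_mulRight {a : A} (ha : IsNilpotent a) :
    IsNilpotent.exp (mulRight ℚ a) = mulRight ℚ (IsNilpotent.exp a) := by
  obtain ⟨k, hk⟩ := ha
  have hk' : mulRight ℚ a ^ k = 0 := by rw [pow_mulRight, hk, mulRight_zero_eq_zero]
  rw [IsNilpotent.exp_eq_sum hk, IsNilpotent.exp_eq_sum hk']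
  ext b
  simp [pow_mulRight, mul_sum]

theorem isNilpotent_ad {a : A} (ha : IsNilpotent a) : IsNilpotent (LieAlgebra.ad ℚ A a) :=
  LieAlgebra.ad_nilpotent_of_nilpotent (R := ℚ) ha

theorem exp_ad {a : A} (ha : IsNilpotent a) (b : A) :
    IsNilpotent.exp (LieAlgebra.ad ℚ A a) b = IsNilpotent.exp a * b * IsNilpotent.exp (-a) := by
  have hl : IsNilpotent (LinearMap.mulLeft ℚ a) := by simpa using ha
  have hr : IsNilpotent (LinearMap.mulRight ℚ (-a)) := by simpa using ha
  have h : (LieAlgebra.ad ℚ A a : Module.End ℚ A)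
      = LinearMap.mulLeft ℚ a + LinearMap.mulRight ℚ (-a) := by
    ext b
    simp [LieRing.of_associative_ring_bracket, sub_eq_add_neg]
  rw [h, IsNilpotent.exp_add_of_commute (LinearMap.commute_mulLeft_right a (-a)) hl hr,
    exp_mulLeft ha, exp_mulRight ha.neg]
  simp [mul_assoc]

/-- The derivative of the exponential: `∂(exp Z) = ((e^{ad Z} - 1) / ad Z)(∂ Z) exp Z`. -/
theorem derivation_exp (D : A →ₗ[ℚ] A) (hD : ∀ a b, D (a * b) = D a * b + a * D b) {Z : A}
    (hZ : IsNilpotent Z) :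
    D (IsNilpotent.exp Z) = nev expDiv (LieAlgebra.ad ℚ A Z) (D Z) * IsNilpotent.exp Z := by
  have hL : IsNilpotent (LinearMap.mulLeft ℚ Z) := by simpa using hZ
  obtain ⟨k, hk⟩ := isNilpotent_ad hL
  obtain ⟨m, hm⟩ := isNilpotent_ad hZ
  have hk' : LieAlgebra.ad ℚ (Module.End ℚ A) (LinearMap.mulLeft ℚ Z) ^ (k + m + 1) = 0 :=
    pow_eq_zero_of_le (by omega) hk
  have hm' : LieAlgebra.ad ℚ A Z ^ (k + m) = 0 := pow_eq_zero_of_le (by omega) hm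
  -- In `End A` the Leibniz rule reads `[L_Z, D] = -L_{D Z}`, and further brackets with `L_Z` act
  -- inside the index.
  have hpow : ∀ i : ℕ, (LieAlgebra.ad ℚ (Module.End ℚ A) (LinearMap.mulLeft ℚ Z) ^ (i + 1)) D
      = -LinearMap.mulLeft ℚ ((LieAlgebra.ad ℚ A Z ^ i) (D Z)) := by
    intro i
    induction i with
    | zero =>
      ext b
      simp [LieRing.of_associative_ring_bracket, hD]
    | succ i ih =>
      rw [pow_succ', Module.End.mul_apply, ih, pow_succ' _ i, Module.End.mul_apply]
      ext b
      simp [LieRing.of_associative_ring_bracket, sub_mul, mul_assoc, neg_add_eq_sub]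
  have h1 := exp_ad hL D
  have h0 : D 1 = 0 := by simpa using hD 1 1
  rw [IsNilpotent.exp_eq_sum hk', sum_range_succ'] at h1
  -- The conjugate of `D` by `exp (L_Z)` sends `exp Z` to `exp Z * D 1 = 0`. Expanding the same
  -- conjugate as `exp (ad L_Z) D` gives the formula.
  have h2 := LinearMap.congr_fun h1 (IsNilpotent.exp Z)
  have h3 : IsNilpotent.exp (-LinearMap.mulLeft ℚ Z)
      = LinearMap.mulLeft ℚ (IsNilpotent.exp (-Z)) := by
    rw [← exp_mulLeft hZ.neg]
    congr 1
    ext b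
    simp
  rw [h3] at h2
  simp [hpow, LinearMap.sum_apply, IsNilpotent.exp_neg_mul_exp_self hZ, h0] at h2
  rw [nev_eq_sum _ hm', LinearMap.sum_apply, sum_mul]
  simp [expDiv]
  rw [neg_add_eq_zero] at h2
  exact h2.symm

end NilpotentEval

/-! ### Dynkin's series -/

section Dynkin

open Finset NilpotentEval

theorem nestedBracket_cons {L : Type*} [LieRing L] (x : L) {l : List L} (hl : l ≠ []) :
    nestedBracket (x :: l) = ⁅x, nestedBracket l⁆ := by
  cases l with
  | nil => exact absurd rfl hl
  | cons y l => rfl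

variable {L : Type*} [LieRing L] [LieAlgebra ℚ L]

theorem nestedBracket_replicate_append (x : L) (r : ℕ) {l : List L} (hl : l ≠ []) :
    nestedBracket (List.replicate r x ++ l) = (LieAlgebra.ad ℚ L x ^ r) (nestedBracket l) := by
  induction r with
  | zero => simp
  | succ r ih =>
    rw [List.replicate_succ, List.cons_append, nestedBracket_cons _ (by simp [hl]), ih, pow_succ']
    rfl

theorem nestedBracket_replicate (x : L) (r : ℕ) :
    nestedBracket (List.replicate r x) = if r = 1 then x else 0 := by
  rcases r with _ | _ | r
  · rfl
  · rfl
  · have h := nestedBracket_replicate_append x (r + 1) (l := [x]) (by simp)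
    rw [← List.replicate_succ', pow_succ, Module.End.mul_apply] at h
    rw [h]
    simp [nestedBracket]

/-- Each letter contributes one copy of the bracket. This factor cancels the reciprocal of the word
length in Dynkin's series. -/
theorem derivation_nestedBracket (D : L →ₗ[ℚ] L) (hD : ∀ a b, D ⁅a, b⁆ = ⁅D a, b⁆ + ⁅a, D b⁆)
    (l : List L) (hl : ∀ z ∈ l, D z = z) :
    D (nestedBracket l) = (l.length : ℚ) • nestedBracket l := by
  induction l with
  | nil => simp [nestedBracket]
  | cons x l ih =>
    rcases eq_or_ne l [] with rfl | hne
    · simp [nestedBracket, hl]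
    · rw [nestedBracket_cons _ hne, hD, hl x (by simp),
        ih fun z hz => hl z (List.mem_cons_of_mem _ hz)]
      simp [add_smul, add_comm]

theorem length_dynkinWord {V : Type*} (x y : V) {s n : ℕ} (p : Fin n → Fin (s + 1) × Fin (s + 1)) :
    (dynkinWord x y p).length = ∑ i, (((p i).1 : ℕ) + ((p i).2 : ℕ)) := by
  simp [dynkinWord, List.length_flatMap, Function.comp_def, List.sum_ofFn]

theorem dynkinWord_cons {V : Type*} (x y : V) {s n : ℕ} (a : Fin (s + 1) × Fin (s + 1))
    (p : Fin n → Fin (s + 1) × Fin (s + 1)) :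
    dynkinWord x y (Fin.cons a p : Fin (n + 1) → Fin (s + 1) × Fin (s + 1)) =
      List.replicate (a.1 : ℕ) x ++ (List.replicate (a.2 : ℕ) y ++ dynkinWord x y p) := by
  simp [dynkinWord, List.ofFn_succ]

theorem mem_dynkinWord {V : Type*} {x y z : V} {s n : ℕ}
    {p : Fin n → Fin (s + 1) × Fin (s + 1)} (hz : z ∈ dynkinWord x y p) : z = x ∨ z = y := by
  simp only [dynkinWord, List.mem_flatMap, List.mem_append, List.mem_replicate] at hz
  obtain ⟨a, -, h | h⟩ := hz
  · exact Or.inl h.2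
  · exact Or.inr h.2

theorem map_nestedBracket {L L' : Type*} [LieRing L] [LieRing L'] (g : L → L') (h0 : g 0 = 0)
    (hg : ∀ a b, g ⁅a, b⁆ = ⁅g a, g b⁆) (l : List L) :
    g (nestedBracket l) = nestedBracket (l.map g) := by
  induction l with
  | nil => simpa [nestedBracket] using h0
  | cons x l ih =>
    rcases eq_or_ne l [] with rfl | hne
    · rfl
    · rw [nestedBracket_cons _ hne, hg, ih, List.map_cons, nestedBracket_cons _ (by simpa)]

theorem map_dynkinWord {V V' : Type*} (g : V → V') (x y : V) {s n : ℕ}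
    (p : Fin n → Fin (s + 1) × Fin (s + 1)) :
    (dynkinWord x y p).map g = dynkinWord (g x) (g y) p := by
  simp [dynkinWord, List.map_flatMap]

/-- The operator `∑_{r + t > 0} (ad x)^r (ad y)^t / (r! t!)`. -/
def dynkinOp (s : ℕ) (x y : L) : Module.End ℚ L :=
  ∑ a ∈ (univ : Finset (Fin (s + 1) × Fin (s + 1))).filter (fun a => 0 < (a.1 : ℕ) + (a.2 : ℕ)),
    ((((a.1 : ℕ).factorial * (a.2 : ℕ).factorial : ℕ) : ℚ)⁻¹) •
      (LieAlgebra.ad ℚ L x ^ (a.1 : ℕ) * LieAlgebra.ad ℚ L y ^ (a.2 : ℕ))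

/-- The sum of the terms of Dynkin's series with `n` blocks, without the factors `1 / (r + t)`
and `(-1)^(n-1) / n`. -/
def dynkinSum (s n : ℕ) (x y : L) : L :=
  ∑ p ∈ (univ : Finset (Fin n → Fin (s + 1) × Fin (s + 1))).filter
        (fun p => ∀ i, 0 < ((p i).1 : ℕ) + ((p i).2 : ℕ)),
    ((∏ i, (Nat.factorial ((p i).1 : ℕ) * Nat.factorial ((p i).2 : ℕ)) : ℕ) : ℚ)⁻¹ •
      nestedBracket (dynkinWord x y p)

/-- The first block `x^r y^t` of a right-nested bracket acts as `(ad x)^r (ad y)^t` on the bracket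
of the remaining blocks, so summing over that block applies one fixed operator. -/
theorem dynkinSum_succ (s n : ℕ) (x y : L) :
    dynkinSum s (n + 2) x y = dynkinOp s x y (dynkinSum s (n + 1) x y) := by
  rw [dynkinSum, sum_filter, ← (Fin.consEquiv fun _ => Fin (s + 1) × Fin (s + 1)).sum_comp,
    Fintype.sum_prod_type, dynkinOp, LinearMap.sum_apply, sum_filter]
  refine sum_congr rfl fun a _ => ?_
  split_ifs with ha
  · rw [dynkinSum, map_sum, sum_filter]
    refine sum_congr rfl fun p _ => ?_
    by_cases hp : ∀ i, 0 < ((p i).1 : ℕ) + ((p i).2 : ℕ)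
    · have hne : dynkinWord x y p ≠ [] := by
        rw [← List.length_pos_iff, length_dynkinWord]
        exact sum_pos (fun i _ => hp i) univ_nonempty
      have h1 : ∀ i, 0 < (((Fin.consEquiv fun _ => Fin (s + 1) × Fin (s + 1)) (a, p) i).1 : ℕ) +
          (((Fin.consEquiv fun _ => Fin (s + 1) × Fin (s + 1)) (a, p) i).2 : ℕ) := by
        intro i
        refine Fin.cases ?_ (fun i => ?_) i
        · simpa [Fin.consEquiv] using ha
        · simpa [Fin.consEquiv] using hp i
      rw [if_pos h1, if_pos hp]
      have h2 : (Fin.consEquiv fun _ => Fin (s + 1) × Fin (s + 1)) (a, p) =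
        (Fin.cons a p : Fin (n + 2) → Fin (s + 1) × Fin (s + 1)) := rfl
      rw [h2, dynkinWord_cons, nestedBracket_replicate_append _ _ (by simp [hne]),
        nestedBracket_replicate_append _ _ hne, Fin.prod_univ_succ]
      simp [smul_smul, mul_comm, mul_assoc]
    · rw [if_neg hp, if_neg]
      contrapose! hp
      intro i
      simpa [Fin.consEquiv] using hp i.succ
  · refine sum_eq_zero fun p _ => ?_
    rw [if_neg]
    contrapose! ha
    simpa [Fin.consEquiv] using ha 0

theorem dynkinSum_eq_pow (s n : ℕ) (x y : L) :
    dynkinSum s (n + 1) x y = (dynkinOp s x y ^ n) (dynkinSum s 1 x y) := by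
  induction n with
  | zero => simp
  | succ n ih => rw [dynkinSum_succ, ih, pow_succ', Module.End.mul_apply]

/-- A single block ending in two equal letters has zero bracket. The survivors are the word `x`
alone and the words `x^r y`. -/
theorem dynkinSum_one {s : ℕ} (hs : 1 ≤ s) (x y : L) :
    dynkinSum s 1 x y =
      x + ∑ r ∈ range (s + 1), (r.factorial : ℚ)⁻¹ • (LieAlgebra.ad ℚ L x ^ r) y := by
  have h0 : dynkinSum s 1 x y = ∑ t ∈ range (s + 1), ∑ r ∈ range (s + 1),
      ((r.factorial * t.factorial : ℕ) : ℚ)⁻¹ •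
        nestedBracket (List.replicate r x ++ List.replicate t y) := by
    rw [dynkinSum, sum_filter, ← (Equiv.funUnique (Fin 1) (Fin (s + 1) × Fin (s + 1))).symm.sum_comp,
      Fintype.sum_prod_type_right, ← Fin.sum_univ_eq_sum_range]
    refine sum_congr rfl fun t _ => ?_
    rw [← Fin.sum_univ_eq_sum_range (fun r => ((r.factorial * (t : ℕ).factorial : ℕ) : ℚ)⁻¹ •
        nestedBracket (List.replicate r x ++ List.replicate (t : ℕ) y))]
    refine sum_congr rfl fun r _ => ?_
    simp only [Equiv.funUnique_symm_apply, uniqueElim_const, dynkinWord]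
    split_ifs with h
    · simp
    · have h' : (r : ℕ) = 0 ∧ (t : ℕ) = 0 := by
        simp at h
        simpa using h
      rw [h'.1, h'.2]
      simp [nestedBracket]
  have h1 : ∀ t, ∀ r, nestedBracket (List.replicate r x ++ List.replicate (t + 1) y) =
      if t = 0 then (LieAlgebra.ad ℚ L x ^ r) y else 0 := by
    intro t r
    rw [nestedBracket_replicate_append _ _ (by simp), nestedBracket_replicate]
    rcases t with _ | t <;> simp
  rw [h0, sum_range_succ']
  obtain ⟨s, rfl⟩ : ∃ s', s = s' + 1 := ⟨s - 1, by omega⟩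
  rw [sum_range_succ' _ s, add_comm, add_comm (∑ i ∈ range s, _), sum_eq_zero (s := range s)]
  · congr 1
    · simp [nestedBracket_replicate]
    · rw [add_zero]
      refine Finset.sum_congr rfl fun r _ => ?_
      rw [h1, if_pos rfl]
      simp
  · intro t _
    simp [h1]

/-- The Baker-Campbell-Hausdorff series with rational coefficients. -/
def bchRat (s : ℕ) (x y : L) : L :=
  ∑ n ∈ Finset.Icc 1 s,
    ∑ p ∈ (univ : Finset (Fin n → Fin (s + 1) × Fin (s + 1))).filter
        (fun p => ∀ i, 0 < ((p i).1 : ℕ) + ((p i).2 : ℕ)),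
      (logCoeff n * ((∑ i, (((p i).1 : ℕ) + ((p i).2 : ℕ)) : ℕ) : ℚ)⁻¹ *
        ((∏ i, (Nat.factorial ((p i).1 : ℕ) * Nat.factorial ((p i).2 : ℕ)) : ℕ) : ℚ)⁻¹) •
        nestedBracket (dynkinWord x y p)

/-- Once the word lengths cancel, what is left of Dynkin's series is the series `log (1 + T) / T` in
one operator `T`, which can be compared with the logarithmic derivative of `exp x * exp y`. -/
theorem derivation_bchRat (D : L →ₗ[ℚ] L) (hD : ∀ a b, D ⁅a, b⁆ = ⁅D a, b⁆ + ⁅a, D b⁆) {x y : L}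
    (hx : D x = x) (hy : D y = y) (s : ℕ) :
    D (bchRat s x y) =
      ∑ n ∈ range s, logCoeff (n + 1) • (dynkinOp s x y ^ n) (dynkinSum s 1 x y) := by
  rw [bchRat, map_sum, ← Finset.Ico_add_one_right_eq_Icc, sum_Ico_eq_sum_range]
  refine sum_congr (by simp) fun n _ => ?_
  rw [← dynkinSum_eq_pow, add_comm 1 n, dynkinSum, map_sum, smul_sum]
  refine sum_congr rfl fun p hp => ?_
  rw [mem_filter] at hp
  have hpos : 0 < ∑ i, (((p i).1 : ℕ) + ((p i).2 : ℕ)) :=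
    sum_pos (fun i _ => hp.2 i) univ_nonempty
  have hne : ((∑ i, (((p i).1 : ℕ) + ((p i).2 : ℕ)) : ℕ) : ℚ) ≠ 0 := by positivity
  rw [map_smul, derivation_nestedBracket D hD, length_dynkinWord, smul_smul, smul_smul]
  · congr 1
    rw [mul_right_comm, mul_assoc (logCoeff _), inv_mul_cancel₀ hne, mul_one]
  · intro z hz
    rcases mem_dynkinWord hz with rfl | rfl <;> assumption

end Dynkin

/-! ### The Baker-Campbell-Hausdorff formula in nilpotent associative algebras -/

namespace NilpotentEval

open PowerSeries Finset

variable {A : Type*} [Ring A] [Algebra ℚ A]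

/-- A multiplicative filtration of an algebra which vanishes beyond the index `s`. -/
structure IsNilFiltration (F : ℕ → Submodule ℚ A) (s : ℕ) : Prop where
  anti : Antitone F
  one_mem : (1 : A) ∈ F 0
  mul_mem : ∀ {i j a b}, a ∈ F i → b ∈ F j → a * b ∈ F (i + j)
  eq_bot : F (s + 1) = ⊥

namespace IsNilFiltration

variable {F : ℕ → Submodule ℚ A} {s : ℕ} (hF : IsNilFiltration F s)
include hF

theorem pow_mem {a : A} (ha : a ∈ F 1) (n : ℕ) : a ^ n ∈ F n := by
  induction n with
  | zero => simpa using hF.one_mem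
  | succ n ih => rw [pow_succ]; exact hF.mul_mem ih ha

theorem eq_zero {a : A} {n : ℕ} (hn : s < n) (ha : a ∈ F n) : a = 0 := by
  have := hF.anti (show s + 1 ≤ n from hn) ha
  rwa [hF.eq_bot, Submodule.mem_bot] at this

theorem pow_eq_zero {a : A} (ha : a ∈ F 1) : a ^ (s + 1) = 0 :=
  hF.eq_zero s.lt_succ_self (hF.pow_mem ha _)

theorem isNilpotent {a : A} (ha : a ∈ F 1) : IsNilpotent a := ⟨s + 1, hF.pow_eq_zero ha⟩

theorem exp_sub_one_mem {a : A} (ha : a ∈ F 1) : IsNilpotent.exp a - 1 ∈ F 1 := by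
  rw [IsNilpotent.exp_eq_sum (hF.pow_eq_zero ha), sum_range_succ']
  simp only [Nat.factorial_zero, Nat.cast_one, inv_one, pow_zero, one_smul, add_sub_cancel_right]
  exact Submodule.sum_mem _ fun i _ => Submodule.smul_mem _ _
    (hF.anti (by omega) (hF.pow_mem ha (i + 1)))

theorem exp_mul_exp_sub_one_mem {a b : A} (ha : a ∈ F 1) (hb : b ∈ F 1) :
    IsNilpotent.exp a * IsNilpotent.exp b - 1 ∈ F 1 := by
  have h : IsNilpotent.exp a * IsNilpotent.exp b - 1 =
      (IsNilpotent.exp a - 1) * (IsNilpotent.exp b - 1) + (IsNilpotent.exp a - 1)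
        + (IsNilpotent.exp b - 1) := by noncomm_ring
  rw [h]
  exact add_mem (add_mem (hF.anti (by omega) (hF.mul_mem (hF.exp_sub_one_mem ha)
    (hF.exp_sub_one_mem hb))) (hF.exp_sub_one_mem ha)) (hF.exp_sub_one_mem hb)

theorem ad_pow_mem {a b : A} {j : ℕ} (ha : a ∈ F 1) (hb : b ∈ F j) (n : ℕ) :
    (LieAlgebra.ad ℚ A a ^ n) b ∈ F (j + n) := by
  induction n with
  | zero => simpa using hb
  | succ n ih =>
    rw [pow_succ', Module.End.mul_apply, LieAlgebra.ad_apply, LieRing.of_associative_ring_bracket]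
    have h1 := hF.mul_mem ha ih
    have h2 := hF.mul_mem ih ha
    rw [show 1 + (j + n) = j + (n + 1) by ring] at h1
    exact sub_mem h1 h2

theorem exp_ad_eq_sum {a b : A} (ha : a ∈ F 1) {j : ℕ} (hb : b ∈ F j) :
    IsNilpotent.exp (LieAlgebra.ad ℚ A a) b =
      ∑ i ∈ range (s + 1), (i.factorial : ℚ)⁻¹ • (LieAlgebra.ad ℚ A a ^ i) b := by
  have h : (LieAlgebra.ad ℚ A a ^ (s + 1)) • b = 0 :=
    hF.eq_zero (by omega) (hF.ad_pow_mem ha hb (s + 1))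
  exact IsNilpotent.exp_smul_eq_sum h (isNilpotent_ad (hF.isNilpotent ha))

theorem exp_ad_mem {a b : A} (ha : a ∈ F 1) {j : ℕ} (hb : b ∈ F j) :
    IsNilpotent.exp (LieAlgebra.ad ℚ A a) b ∈ F j := by
  rw [hF.exp_ad_eq_sum ha hb]
  exact Submodule.sum_mem _ fun i _ => Submodule.smul_mem _ _
    (hF.anti (by omega) (hF.ad_pow_mem ha hb i))

/-- The cutoff of the exponents at `s` loses nothing, since `s + 1` brackets with elements of `F 1`
leave the filtration. Excluding the empty block accounts for the `- 1`. -/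
theorem dynkinOp_apply {x y v : A} (hx : x ∈ F 1) (hy : y ∈ F 1) {j : ℕ} (hv : v ∈ F j) :
    dynkinOp s x y v =
      (IsNilpotent.exp (LieAlgebra.ad ℚ A x) * IsNilpotent.exp (LieAlgebra.ad ℚ A y) - 1) v := by
  have h1 : (univ : Finset (Fin (s + 1) × Fin (s + 1))).filter
      (fun a => 0 < (a.1 : ℕ) + (a.2 : ℕ)) = univ.erase (0, 0) := by
    ext ⟨a, b⟩
    simp only [Finset.mem_filter, Finset.mem_univ, true_and, Finset.mem_erase, and_true, ne_eq, Prod.mk.injEq,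
      Fin.ext_iff, Fin.val_zero]
    omega
  rw [dynkinOp, h1, LinearMap.sub_apply, Module.End.mul_apply, Module.End.one_apply,
    eq_sub_iff_add_eq, hF.exp_ad_eq_sum hx (hF.exp_ad_mem hy hv), hF.exp_ad_eq_sum hy hv,
    LinearMap.sum_apply]
  have h2 := Finset.sum_erase_add (univ : Finset (Fin (s + 1) × Fin (s + 1)))
    (fun a => (((((a.1 : ℕ).factorial * (a.2 : ℕ).factorial : ℕ) : ℚ)⁻¹) •
      (LieAlgebra.ad ℚ A x ^ (a.1 : ℕ) * LieAlgebra.ad ℚ A y ^ (a.2 : ℕ))) v)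
    (Finset.mem_univ ((0 : Fin (s + 1)), (0 : Fin (s + 1))))
  simp only [Fin.val_zero, Nat.factorial_zero, mul_one, Nat.cast_one, inv_one, pow_zero, one_smul,
    Module.End.one_apply] at h2
  rw [h2, Fintype.sum_prod_type, ← Fin.sum_univ_eq_sum_range (n := s + 1)]
  refine sum_congr rfl fun a _ => ?_
  rw [← Fin.sum_univ_eq_sum_range (n := s + 1), map_sum, smul_sum]
  refine sum_congr rfl fun b _ => ?_
  simp [smul_smul, mul_comm]

end IsNilFiltration

end NilpotentEval

namespace NilpotentEval

open PowerSeries Finset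

variable {A : Type*} [Ring A] [Algebra ℚ A]

theorem nev_apply_eq_sum {M : Type*} [AddCommGroup M] [Module ℚ M] (f : ℚ⟦X⟧)
    {T : Module.End ℚ M} (hT : IsNilpotent T) {v : M} {s : ℕ} (hv : (T ^ s) v = 0) :
    nev f T v = ∑ n ∈ range s, coeff n f • (T ^ n) v := by
  obtain ⟨k, hk⟩ := hT
  have hk' : T ^ (k + s) = 0 := pow_eq_zero_of_le (by omega) hk
  rw [nev_eq_sum f hk', LinearMap.sum_apply]
  symm
  refine sum_subset (range_mono (by omega)) fun i _ hi => ?_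
  rw [Finset.mem_range, not_lt] at hi
  rw [show i = (i - s) + s by omega, pow_add, Module.End.mul_apply, hv,
    map_zero, smul_zero]

namespace IsNilFiltration

variable {F : ℕ → Submodule ℚ A} {s : ℕ} (hF : IsNilFiltration F s)
include hF

/-- With `g = exp x * exp y` the operator is conjugation by `g` minus the identity, that is `v ↦ [g
- 1, v] g⁻¹`, and `g - 1` has filtration degree one. -/
theorem exp_ad_mul_sub_one_mem {x y v : A} (hx : x ∈ F 1) (hy : y ∈ F 1) {j : ℕ} (hv : v ∈ F j) :
    (IsNilpotent.exp (LieAlgebra.ad ℚ A x) * IsNilpotent.exp (LieAlgebra.ad ℚ A y) - 1) v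
      ∈ F (j + 1) := by
  set g := IsNilpotent.exp x * IsNilpotent.exp y with hg
  set g' := IsNilpotent.exp (-y) * IsNilpotent.exp (-x) with hg'
  have hgg' : g * g' = 1 := by
    rw [hg, hg', mul_assoc, ← mul_assoc (IsNilpotent.exp y),
      IsNilpotent.exp_mul_exp_neg_self (hF.isNilpotent hy), one_mul,
      IsNilpotent.exp_mul_exp_neg_self (hF.isNilpotent hx)]
  have h : (IsNilpotent.exp (LieAlgebra.ad ℚ A x) * IsNilpotent.exp (LieAlgebra.ad ℚ A y) - 1) v
      = ((g - 1) * v - v * (g - 1)) * g' := by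
    rw [LinearMap.sub_apply, Module.End.mul_apply, Module.End.one_apply,
      exp_ad (hF.isNilpotent hy), exp_ad (hF.isNilpotent hx)]
    have : ((g - 1) * v - v * (g - 1)) * g' = g * v * g' - v * (g * g') := by noncomm_ring
    rw [this, hgg', hg, hg']
    noncomm_ring
  have hg1 : g - 1 ∈ F 1 := hF.exp_mul_exp_sub_one_mem hx hy
  have hg'0 : g' ∈ F 0 := by
    have := hF.exp_mul_exp_sub_one_mem (neg_mem hy) (neg_mem hx)
    simpa using add_mem (hF.anti zero_le_one this) hF.one_mem
  rw [h]
  have h1 := hF.mul_mem hg1 hv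
  rw [add_comm] at h1
  have h2 := hF.mul_mem (sub_mem h1 (hF.mul_mem hv hg1)) hg'0
  rwa [add_zero] at h2

theorem exp_ad_mul_sub_one_pow_mem {x y v : A} (hx : x ∈ F 1) (hy : y ∈ F 1) {j : ℕ}
    (hv : v ∈ F j) (n : ℕ) :
    ((IsNilpotent.exp (LieAlgebra.ad ℚ A x) * IsNilpotent.exp (LieAlgebra.ad ℚ A y) - 1) ^ n) v
      ∈ F (j + n) := by
  induction n with
  | zero => simpa using hv
  | succ n ih =>
    rw [pow_succ', Module.End.mul_apply]
    exact hF.exp_ad_mul_sub_one_mem hx hy ih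

theorem dynkinOp_pow_apply {x y v : A} (hx : x ∈ F 1) (hy : y ∈ F 1) {j : ℕ}
    (hv : v ∈ F j) (n : ℕ) :
    (dynkinOp s x y ^ n) v =
      ((IsNilpotent.exp (LieAlgebra.ad ℚ A x) * IsNilpotent.exp (LieAlgebra.ad ℚ A y) - 1) ^ n)
        v := by
  induction n with
  | zero => rfl
  | succ n ih =>
    rw [pow_succ', Module.End.mul_apply, ih, pow_succ' _ n, Module.End.mul_apply,
      hF.dynkinOp_apply hx hy (hF.exp_ad_mul_sub_one_pow_mem hx hy hv n)]

/-- Dynkin's formula, up to the kernel of a derivation `D` with `D x = x` and `D y = y`. -/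
theorem derivation_log (hs : 1 ≤ s) (D : A →ₗ[ℚ] A) (hD : ∀ a b, D (a * b) = D a * b + a * D b)
    {x y : A} (hx : x ∈ F 1) (hy : y ∈ F 1) (hDx : D x = x) (hDy : D y = y) :
    D (nev (log ℚ) (IsNilpotent.exp x * IsNilpotent.exp y - 1)) = D (bchRat s x y) := by
  set u := IsNilpotent.exp x * IsNilpotent.exp y - 1 with hu
  set Z := nev (log ℚ) u with hZ
  have hxn := hF.isNilpotent hx
  have hyn := hF.isNilpotent hy
  have hun : IsNilpotent u := hF.isNilpotent (hF.exp_mul_exp_sub_one_mem hx hy)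
  have hZn : IsNilpotent Z := isNilpotent_nev_log hun
  have hexp : IsNilpotent.exp Z = IsNilpotent.exp x * IsNilpotent.exp y := by
    rw [exp_nev_log hun, hu, add_sub_cancel]
  set w := x + IsNilpotent.exp (LieAlgebra.ad ℚ A x) y with hw
  have hwF : w ∈ F 1 := add_mem hx (hF.exp_ad_mem hx hy)
  have hinv : IsNilpotent.exp (-Z) = IsNilpotent.exp (-y) * IsNilpotent.exp (-x) := by
    refine left_inv_eq_right_inv (IsNilpotent.exp_neg_mul_exp_self hZn) ?_
    rw [hexp, mul_assoc, ← mul_assoc (IsNilpotent.exp y), IsNilpotent.exp_mul_exp_neg_self hyn,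
      one_mul, IsNilpotent.exp_mul_exp_neg_self hxn]
  have had : IsNilpotent.exp (LieAlgebra.ad ℚ A Z) =
      IsNilpotent.exp (LieAlgebra.ad ℚ A x) * IsNilpotent.exp (LieAlgebra.ad ℚ A y) := by
    ext b
    rw [Module.End.mul_apply, exp_ad hZn, exp_ad hyn, exp_ad hxn, hexp, hinv]
    noncomm_ring
  have hself : ∀ {z : A}, IsNilpotent z → D z = z →
      D (IsNilpotent.exp z) = z * IsNilpotent.exp z := by
    intro z hz hDz
    obtain ⟨k, hk⟩ := isNilpotent_ad hz
    have hk' : LieAlgebra.ad ℚ A z ^ (k + 1) = 0 := pow_eq_zero_of_le (by omega) hk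
    rw [derivation_exp D hD hz, hDz, nev_eq_sum _ hk', LinearMap.sum_apply, sum_range_succ',
      sum_eq_zero]
    · simp [expDiv]
    · intro i _
      simp [pow_succ]
  -- By the product rule, `w` is the logarithmic derivative of `exp x * exp y`. Comparing it with
  -- the derivative of `exp Z` determines `D Z`.
  have hDexp : D (IsNilpotent.exp Z) = w * IsNilpotent.exp Z := by
    rw [hexp, hD, hself hxn hDx, hself hyn hDy, hw, exp_ad hxn, add_mul]
    congr 1
    · noncomm_ring
    · have : IsNilpotent.exp x * y * IsNilpotent.exp (-x) *
          (IsNilpotent.exp x * IsNilpotent.exp y) = IsNilpotent.exp x * y *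
          (IsNilpotent.exp (-x) * IsNilpotent.exp x) * IsNilpotent.exp y := by noncomm_ring
      rw [this, IsNilpotent.exp_neg_mul_exp_self hxn]
      noncomm_ring
  have hphi : nev expDiv (LieAlgebra.ad ℚ A Z) (D Z) = w := by
    rw [derivation_exp D hD hZn] at hDexp
    exact (IsNilpotent.isUnit_exp hZn).mul_right_cancel hDexp
  have hadn := isNilpotent_ad hZn
  -- Inverting `(e^{ad Z} - 1) / ad Z` gives a series in `e^{ad Z} - 1 = e^{ad x} e^{ad y} - 1`, in
  -- which `Z` no longer occurs.
  have hDZ : D Z = nev logDiv (IsNilpotent.exp (LieAlgebra.ad ℚ A Z) - 1) w := by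
    rw [← hphi, ← Module.End.mul_apply, logDiv_mul_expDiv hadn, Module.End.one_apply]
  have hnil := IsNilpotent.isNilpotent_exp_sub_one hadn
  rw [had] at hnil hDZ
  have hD' : ∀ a b : A, D ⁅a, b⁆ = ⁅D a, b⁆ + ⁅a, D b⁆ := by
    intro a b
    simp only [LieRing.of_associative_ring_bracket, map_sub, hD]
    abel
  rw [hDZ, nev_apply_eq_sum _ hnil (hF.eq_zero (by omega)
    (hF.exp_ad_mul_sub_one_pow_mem hx hy hwF s)), derivation_bchRat D hD' hDx hDy,
    dynkinSum_one hs, ← hF.exp_ad_eq_sum hx hy]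
  refine sum_congr rfl fun n _ => ?_
  rw [hF.dynkinOp_pow_apply hx hy hwF, logDiv, coeff_mk]

end IsNilFiltration

theorem map_bchRat {L L' : Type*} [LieRing L] [LieAlgebra ℚ L] [LieRing L'] [LieAlgebra ℚ L']
    (g : L →ₗ[ℚ] L') (hg : ∀ a b, g ⁅a, b⁆ = ⁅g a, g b⁆) (s : ℕ) (x y : L) :
    g (bchRat s x y) = bchRat s (g x) (g y) := by
  simp only [bchRat, map_sum, map_smul, map_nestedBracket g (map_zero g) hg, map_dynkinWord]

end NilpotentEval

/-! ### The formal parameter `t` and the end of the Baker-Campbell-Hausdorff formula -/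

namespace NilpotentEval

open Finset Polynomial

variable {A : Type*} [Ring A] [Algebra ℚ A]

/-- The filtration of `A[t]` by the coefficients. -/
def polyFiltration (F : ℕ → Submodule ℚ A) (i : ℕ) : Submodule ℚ A[X] where
  carrier := {f | ∀ n, f.coeff n ∈ F i}
  add_mem' hf hg n := by simpa using add_mem (hf n) (hg n)
  zero_mem' n := by simp
  smul_mem' c f hf n := by simpa using Submodule.smul_mem _ c (hf n)

theorem IsNilFiltration.polynomial {F : ℕ → Submodule ℚ A} {s : ℕ} (hF : IsNilFiltration F s) :
    IsNilFiltration (polyFiltration F) s where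
  anti i j hij f hf n := hF.anti hij (hf n)
  one_mem n := by
    rw [coeff_one]
    split_ifs
    · exact hF.one_mem
    · exact zero_mem _
  mul_mem {i j f g} hf hg n := by
    rw [coeff_mul]
    exact Submodule.sum_mem _ fun p _ => hF.mul_mem (hf _) (hg _)
  eq_bot := by
    rw [eq_bot_iff]
    intro f hf
    rw [Submodule.mem_bot]
    ext n
    have := hf n
    rw [hF.eq_bot, Submodule.mem_bot] at this
    simpa using this

/-- The Euler derivation `t d/dt` of `A[t]`. -/
def eulerDerivation (A : Type*) [Ring A] [Algebra ℚ A] : A[X] →ₗ[ℚ] A[X] where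
  toFun f := X * derivative f
  map_add' f g := by simp [mul_add]
  map_smul' c f := by simp

/-- The **Baker-Campbell-Hausdorff-Dynkin formula** in nilpotent associative algebras. -/
theorem IsNilFiltration.exp_bchRat {F : ℕ → Submodule ℚ A} {s : ℕ} (hF : IsNilFiltration F s)
    (hs : 1 ≤ s) {x y : A} (hx : x ∈ F 1) (hy : y ∈ F 1) :
    IsNilpotent.exp (bchRat s x y) = IsNilpotent.exp x * IsNilpotent.exp y := by
  have hmem : ∀ {a : A}, a ∈ F 1 → C a * X ∈ polyFiltration F 1 := by
    intro a ha n
    rw [coeff_C_mul, coeff_X]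
    split_ifs
    · simpa using ha
    · simp
  have hP := hF.polynomial
  -- A general algebra need not have a derivation fixing `x` and `y`. After adjoining `t`, the Euler
  -- derivation fixes `x t` and `y t`.
  set u := IsNilpotent.exp (C x * X) * IsNilpotent.exp (C y * X) - 1 with hu
  set Z := nev (PowerSeries.log ℚ) u with hZ
  have hun : IsNilpotent u := hP.isNilpotent (hP.exp_mul_exp_sub_one_mem (hmem hx) (hmem hy))
  have hE : ∀ a : A, eulerDerivation A (C a * X) = C a * X := by
    intro a
    simp [eulerDerivation, X_mul_C]
  have hlog := hP.derivation_log hs (eulerDerivation A)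
    (fun f g => by
      change X * derivative (f * g) = X * derivative f * g + f * (X * derivative g)
      rw [derivative_mul, mul_add, ← mul_assoc, ← mul_assoc X f, X_mul (p := f), mul_assoc f])
    (hmem hx) (hmem hy) (hE x) (hE y)
  have hcc : ∀ (g : A[X] →+* A), g u = IsNilpotent.exp (g (C x * X)) *
      IsNilpotent.exp (g (C y * X)) - 1 := by
    intro g
    rw [hu, map_sub, map_mul, map_one, IsNilpotent.map_exp (hP.isNilpotent (hmem hx)),
      IsNilpotent.map_exp (hP.isNilpotent (hmem hy))]
  have hbch : ∀ (g : A[X] →+* A),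
      g (bchRat s (C x * X) (C y * X)) = bchRat s (g (C x * X)) (g (C y * X)) := by
    intro g
    exact map_bchRat (g.toAddMonoidHom.toRatLinearMap) (fun a b => by
      simp [LieRing.of_associative_ring_bracket]) s _ _
  -- The Euler derivation multiplies the coefficient of `t^n` by `n`, so it loses only the constant
  -- term, and both constant terms are zero.
  have hZeq : Z = bchRat s (C x * X) (C y * X) := by
    rw [← sub_eq_zero]
    rw [← sub_eq_zero, ← map_sub] at hlog
    ext n
    rcases n with _ | n
    · have h1 : constantCoeff (C x * X) = 0 := by simp
      have h2 : constantCoeff (C y * X) = 0 := by simp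
      have h3 : bchRat s (0 : A) 0 = 0 := by
        have := map_bchRat (0 : A →ₗ[ℚ] A) (by simp) s 0 0
        simpa using this.symm
      have h4 : nev (PowerSeries.log ℚ) (0 : A) = 0 := by
        rw [nev_eq_sum (k := 1) _ (by simp)]
        simp
      rw [← constantCoeff_apply, map_sub, hZ, nev_map _ _ hun, hcc, hbch, h1, h2, h3]
      simp [IsNilpotent.exp_zero, h4]
    · have := congrArg (fun f => coeff f (n + 1)) hlog
      simp only [eulerDerivation, LinearMap.coe_mk, AddHom.coe_mk, coeff_X_mul,
        coeff_derivative, coeff_zero] at this ⊢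
      have hne : ((n : ℚ) + 1) ≠ 0 := by positivity
      have h5 : ((Z - bchRat s (C x * X) (C y * X)).coeff (n + 1)) * ((n : A) + 1) =
          ((n : ℚ) + 1) • (Z - bchRat s (C x * X) (C y * X)).coeff (n + 1) := by
        rw [add_smul, one_smul, mul_add, mul_one, Nat.cast_smul_eq_nsmul, nsmul_eq_mul,
          (Nat.cast_commute n _).eq]
      rw [h5] at this
      exact (smul_eq_zero.1 this).resolve_left hne
  -- Setting `t = 1` returns to `x` and `y`. It is a ring homomorphism because `1` is central.
  set ev : A[X] →+* A := eval₂RingHom' (RingHom.id A) 1 (fun a => Commute.one_right _) with hev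
  have hevx : ∀ a : A, ev (C a * X) = a := by
    intro a
    simp [hev]
  have h6 := congrArg ev hZeq
  rw [hZ, nev_map _ _ hun, hcc, hbch, hevx, hevx] at h6
  have hun' := hF.isNilpotent (hF.exp_mul_exp_sub_one_mem hx hy)
  rw [← h6, exp_nev_log hun', add_sub_cancel]

end NilpotentEval

end

theorem map_bch {𝔤 𝔥 : Type*} [LieRing 𝔤] [LieAlgebra ℝ 𝔤] [LieRing 𝔥] [LieAlgebra ℝ 𝔥]
    (g : 𝔤 →ₗ[ℝ] 𝔥) (hg : ∀ a b, g ⁅a, b⁆ = ⁅g a, g b⁆) (s : ℕ) (x y : 𝔤) :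
    g (bch s x y) = bch s (g x) (g y) := by
  simp only [bch, map_sum, map_smul, map_nestedBracket g (map_zero g) hg, map_dynkinWord]

namespace Stratification

open Finset

variable {𝔤 : Type*} [LieRing 𝔤] [LieAlgebra ℝ 𝔤] {s : ℕ} (S : Stratification 𝔤 s)

/-! ### The grading -/

/-- The stratification only controls brackets with `V₁`. As `V_{i+1}` is spanned by brackets `[V₁,
V_i]`, the Jacobi identity carries the induction on `i`. -/
theorem lie_mem_layer {i j : ℕ} {x y : 𝔤} (hx : x ∈ S.layer i) (hy : y ∈ S.layer j) :
    ⁅x, y⁆ ∈ S.layer (i + j) := by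
  have h1 : ∀ {j : ℕ} {x y : 𝔤}, x ∈ S.layer 1 → y ∈ S.layer j → ⁅x, y⁆ ∈ S.layer (j + 1) := by
    intro j x y hx hy
    rcases Nat.eq_zero_or_pos j with rfl | hj
    · rw [S.layer_zero, Submodule.mem_bot] at hy
      simp [hy]
    · rw [← S.bracket j hj]
      exact Submodule.subset_span ⟨x, hx, y, hy, rfl⟩
  induction i generalizing j x y with
  | zero =>
    rw [S.layer_zero, Submodule.mem_bot] at hx
    simp [hx]
  | succ i ih =>
    rcases Nat.eq_zero_or_pos i with rfl | hi
    · have := h1 hx hy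
      rwa [add_comm] at this
    · rw [← S.bracket i hi] at hx
      induction hx using Submodule.span_induction with
      | mem z hz =>
        obtain ⟨a, ha, b, hb, rfl⟩ := hz
        rw [lie_lie]
        have h2 := h1 ha (ih hb hy)
        have h3 := ih hb (h1 ha hy)
        rw [show i + 1 + j = i + j + 1 by ring]
        exact sub_mem h2 h3
      | zero => simp
      | add a b _ _ ha hb => rw [add_lie]; exact add_mem ha hb
      | smul c a _ ha => rw [smul_lie]; exact Submodule.smul_mem _ _ ha

theorem layer_induction {P : 𝔤 → Prop} (mem : ∀ i, ∀ x ∈ S.layer i, P x)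
    (add : ∀ x y, P x → P y → P (x + y)) (x : 𝔤) : P x := by
  have hx : x ∈ ⨆ i, S.layer i := by
    rw [S.isInternal.submodule_iSup_eq_top]
    trivial
  exact Submodule.iSup_induction S.layer (motive := P) hx mem (mem 0 0 (zero_mem _)) add

theorem proj_mem (j : ℕ) (x : 𝔤) : S.proj j x ∈ S.layer j := by
  simp [proj]

theorem proj_of_mem {i : ℕ} {x : 𝔤} (hx : x ∈ S.layer i) (j : ℕ) :
    S.proj j x = if i = j then x else 0 := by
  have h : (LinearEquiv.ofBijective (DirectSum.coeLinearMap S.layer) S.isInternal).symm x =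
      DirectSum.lof ℝ ℕ (fun i => S.layer i) i ⟨x, hx⟩ := by
    rw [LinearEquiv.symm_apply_eq]
    exact (DirectSum.coeLinearMap_lof S.layer i ⟨x, hx⟩).symm
  simp only [proj, LinearMap.comp_apply, LinearEquiv.coe_coe, h]
  split_ifs with hij
  · subst hij
    simp
  · rw [DirectSum.component.of, dif_neg hij]
    simp

theorem sum_proj (x : 𝔤) : ∑ j ∈ range (s + 1), S.proj j x = x := by
  induction x using S.layer_induction with
  | mem i x hx =>
    rcases lt_or_ge s i with hi | hi
    · rw [S.layer_gt i hi, Submodule.mem_bot] at hx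
      simp [hx]
    · simp only [S.proj_of_mem hx, sum_ite_eq, Finset.mem_range]
      rw [if_pos (by omega)]
  | add x y hx hy => simp only [map_add, sum_add_distrib, hx, hy]

theorem proj_zero_apply (x : 𝔤) : S.proj 0 x = 0 := by
  have := S.proj_mem 0 x
  rwa [S.layer_zero, Submodule.mem_bot] at this

include S in
theorem one_le_step : 1 ≤ s := by
  by_contra! h
  obtain rfl : s = 0 := by omega
  exact S.layer_step S.layer_zero

/-- The ideal `V_i ⊕ V_{i+1} ⊕ ⋯`. -/
def fil (i : ℕ) : Submodule ℝ 𝔤 where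
  carrier := {x | ∀ j < i, S.proj j x = 0}
  add_mem' hx hy j hj := by rw [map_add, hx j hj, hy j hj, add_zero]
  zero_mem' j _ := map_zero _
  smul_mem' c x hx j hj := by rw [map_smul, hx j hj, smul_zero]

theorem fil_anti {i j : ℕ} (h : i ≤ j) : S.fil j ≤ S.fil i :=
  fun _ hx m hm => hx m (hm.trans_le h)

theorem mem_fil_one (x : 𝔤) : x ∈ S.fil 1 := by
  intro j hj
  obtain rfl : j = 0 := by omega
  exact S.proj_zero_apply x

theorem eq_zero_of_mem_fil {i : ℕ} (hi : s < i) {x : 𝔤} (hx : x ∈ S.fil i) : x = 0 := by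
  rw [← S.sum_proj x]
  refine sum_eq_zero fun j hj => hx j ?_
  have := Finset.mem_range.1 hj
  omega

theorem layer_le_fil {i j : ℕ} (h : i ≤ j) : S.layer j ≤ S.fil i := by
  intro x hx m hm
  rw [S.proj_of_mem hx, if_neg (by omega)]

theorem lie_mem_fil {i j : ℕ} {x y : 𝔤} (hx : x ∈ S.fil i) (hy : y ∈ S.fil j) :
    ⁅x, y⁆ ∈ S.fil (i + j) := by
  rw [← S.sum_proj x, ← S.sum_proj y, sum_lie]
  refine Submodule.sum_mem _ fun a _ => ?_
  rw [lie_sum]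
  refine Submodule.sum_mem _ fun b _ => ?_
  rcases lt_or_ge a i with h1 | h1
  · simp [hx _ h1]
  rcases lt_or_ge b j with h2 | h2
  · simp [hy _ h2]
  exact S.layer_le_fil (by omega) (S.lie_mem_layer (S.proj_mem a x) (S.proj_mem b y))

/-- The derivation equal to `j` times the identity on `V_j`. -/
def degDer : 𝔤 →ₗ[ℝ] 𝔤 := ∑ j ∈ range (s + 1), (j : ℝ) • S.proj j

theorem degDer_of_mem {i : ℕ} {x : 𝔤} (hx : x ∈ S.layer i) : S.degDer x = (i : ℝ) • x := by
  rcases lt_or_ge s i with hi | hi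
  · rw [S.layer_gt i hi, Submodule.mem_bot] at hx
    simp [hx]
  · simp only [degDer, LinearMap.sum_apply, LinearMap.smul_apply, S.proj_of_mem hx, smul_ite,
      smul_zero, sum_ite_eq, Finset.mem_range]
    rw [if_pos (by omega)]

theorem degDer_lie (x y : 𝔤) : S.degDer ⁅x, y⁆ = ⁅S.degDer x, y⁆ + ⁅x, S.degDer y⁆ := by
  induction x using S.layer_induction with
  | mem i x hx =>
    induction y using S.layer_induction with
    | mem j y hy =>
      rw [S.degDer_of_mem hx, S.degDer_of_mem hy, S.degDer_of_mem (S.lie_mem_layer hx hy),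
        smul_lie, lie_smul, ← add_smul]
      push_cast
      rfl
    | add y z hy hz => simp only [lie_add, map_add, hy, hz]; abel
  | add x z hx hz => simp only [add_lie, map_add, hx, hz]; abel

/-- There is no layer of degree zero, so all eigenvalues are nonzero. The faithfulness of the
representation rests on this. -/
theorem degDer_injective : Function.Injective S.degDer := by
  rw [← LinearMap.ker_eq_bot, LinearMap.ker_eq_bot']
  intro x hx
  have h : ∀ (i : ℕ) (y : 𝔤), S.proj i (S.degDer y) = (i : ℝ) • S.proj i y := by
    intro i y
    induction y using S.layer_induction with
    | mem j y hy =>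
      rw [S.degDer_of_mem hy, map_smul, S.proj_of_mem hy]
      split_ifs with h
      · rw [h]
      · simp
    | add y z hy hz => simp only [map_add, smul_add, hy, hz]
  rw [← S.sum_proj x]
  refine sum_eq_zero fun j _ => ?_
  rcases Nat.eq_zero_or_pos j with rfl | hj
  · exact S.proj_zero_apply x
  · have h1 := h j x
    rw [hx, map_zero, eq_comm, smul_eq_zero] at h1
    exact h1.resolve_left (by positivity)

/-! ### A faithful nilpotent representation -/

/-- The restriction to `𝔤` of the adjoint representation of `𝔤 ⋊ ℝ D`, where `D` is the degree
derivation. -/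
def rep : 𝔤 →ₗ[ℝ] Module.End ℝ (𝔤 × ℝ) where
  toFun x :=
    { toFun := fun v => (⁅x, v.1⁆ - v.2 • S.degDer x, 0)
      map_add' := fun v w => by
        ext
        · simp only [Prod.fst_add, Prod.snd_add, lie_add, add_smul]; abel
        · simp
      map_smul' := fun c v => by ext <;> simp [smul_sub, mul_smul] }
  map_add' x y := by
    refine LinearMap.ext fun v => ?_
    ext
    · simp only [LinearMap.coe_mk, AddHom.coe_mk, LinearMap.add_apply, Prod.fst_add, add_lie,
        map_add, smul_add]
      abel
    · simp
  map_smul' c x := by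
    refine LinearMap.ext fun v => ?_
    ext
    · simp [smul_sub, smul_comm c]
    · simp

theorem rep_apply (x : 𝔤) (v : 𝔤 × ℝ) : S.rep x v = (⁅x, v.1⁆ - v.2 • S.degDer x, 0) := rfl

/-- The adjoint representation of `𝔤` alone would kill the centre. The added vector `(0, 1)` stands
for the degree derivation and is sent to `(-D x, 0)`. -/
theorem rep_injective : Function.Injective S.rep := by
  intro x y h
  have := LinearMap.congr_fun h (0, 1)
  simpa [rep_apply, S.degDer_injective.eq_iff] using this

theorem rep_lie (x y : 𝔤) : S.rep ⁅x, y⁆ = S.rep x * S.rep y - S.rep y * S.rep x := by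
  refine LinearMap.ext fun v => ?_
  ext
  · simp only [rep_apply, LinearMap.sub_apply, Module.End.mul_apply, Prod.fst_sub, zero_smul,
      sub_zero, lie_sub, lie_smul, S.degDer_lie, lie_lie, smul_add]
    rw [← lie_skew y (S.degDer x)]
    simp only [smul_neg]
    abel
  · simp [rep_apply]

end Stratification

namespace Stratification

open Finset

variable {𝔤 : Type*} [LieRing 𝔤] [LieAlgebra ℝ 𝔤] {s : ℕ} (S : Stratification 𝔤 s)

section Rep

attribute [local instance 100] LieRing.ofAssociativeRing

open NilpotentEval

/-- The filtration of `𝔤 × ℝ` with `ℝ` placed in degree `0`. -/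
def filProd (i : ℕ) (v : 𝔤 × ℝ) : Prop := v.1 ∈ S.fil i ∧ (0 < i → v.2 = 0)

/-- The endomorphisms of `𝔤 × ℝ` that raise the degree by `i`. -/
def filEnd [Algebra ℚ (Module.End ℝ (𝔤 × ℝ))] (i : ℕ) : Submodule ℚ (Module.End ℝ (𝔤 × ℝ)) where
  carrier := {T | ∀ j v, S.filProd j v → S.filProd (j + i) (T v)}
  add_mem' {T T'} hT hT' j v hv := by
    have h1 := hT j v hv
    have h2 := hT' j v hv
    exact ⟨add_mem h1.1 h2.1, fun h => by simp [h1.2 h, h2.2 h]⟩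
  zero_mem' j v _ := ⟨zero_mem _, fun _ => rfl⟩
  smul_mem' c T hT j v hv := by
    have h1 := hT j v hv
    rw [← Rat.cast_smul_eq_qsmul ℝ c T]
    exact ⟨Submodule.smul_mem _ _ h1.1, fun h => by simp [h1.2 h]⟩

/-- The degrees present in `𝔤 × ℝ` are `0, …, s`, so an operator raising the degree by `s + 1`
vanishes. -/
theorem isNilFiltration_filEnd [Algebra ℚ (Module.End ℝ (𝔤 × ℝ))] :
    IsNilFiltration S.filEnd s where
  anti i j hij T hT m v hv := by
    have h1 := hT m v hv
    exact ⟨S.fil_anti (by omega) h1.1, fun h => h1.2 (by omega)⟩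
  one_mem j v hv := hv
  mul_mem {i j T T'} hT hT' m v hv := by
    have h1 := hT (m + j) (T' v) (hT' m v hv)
    rwa [show m + (i + j) = m + j + i by ring]
  eq_bot := by
    rw [eq_bot_iff]
    intro T hT
    rw [Submodule.mem_bot]
    refine LinearMap.ext fun v => ?_
    have h1 := hT 0 v ⟨fun j hj => absurd hj (by omega), fun h => absurd h (by omega)⟩
    ext
    · exact S.eq_zero_of_mem_fil (by omega) h1.1
    · exact h1.2 (by omega)

theorem rep_mem_filEnd [Algebra ℚ (Module.End ℝ (𝔤 × ℝ))] (x : 𝔤) : S.rep x ∈ S.filEnd 1 := by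
  intro j v hv
  refine ⟨?_, fun _ => rfl⟩
  have h1 : ⁅x, v.1⁆ ∈ S.fil (j + 1) := by
    have := S.lie_mem_fil (S.mem_fil_one x) hv.1
    rwa [add_comm] at this
  refine sub_mem h1 ?_
  rcases Nat.eq_zero_or_pos j with rfl | hj
  · exact Submodule.smul_mem _ _ (S.mem_fil_one _)
  · simp [hv.2 hj]

theorem rep_bch [Algebra ℚ (Module.End ℝ (𝔤 × ℝ))] (x y : 𝔤) :
    S.rep (bch s x y) = bchRat s (S.rep x) (S.rep y) := by
  have hl : ∀ a b, S.rep ⁅a, b⁆ = ⁅S.rep a, S.rep b⁆ := S.rep_lie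
  simp only [bch, bchRat, map_sum, map_smul, map_nestedBracket S.rep (map_zero S.rep) hl,
    map_dynkinWord, logCoeff]
  refine sum_congr rfl fun n _ => sum_congr rfl fun p _ => ?_
  rw [← Rat.cast_smul_eq_qsmul ℝ]
  push_cast
  rfl

/-- The Carnot group embeds into the multiplicative monoid of a nilpotent algebra. -/
theorem exists_faithful_exp : ∃ E : 𝔤 → Module.End ℝ (𝔤 × ℝ), Function.Injective E ∧
    (∀ x y, E (S.mul x y) = E x * E y) ∧ ∀ x y, ⁅x, y⁆ = 0 → E (x + y) = E x * E y := by
  let _ : Algebra ℚ (Module.End ℝ (𝔤 × ℝ)) := Algebra.compHom _ (algebraMap ℚ ℝ)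
  have hF := S.isNilFiltration_filEnd
  have hn : ∀ x, IsNilpotent (S.rep x) := fun x => hF.isNilpotent (S.rep_mem_filEnd x)
  refine ⟨fun x => IsNilpotent.exp (S.rep x), fun x y h => ?_, fun x y => ?_, fun x y h => ?_⟩
  · exact S.rep_injective (exp_injective (hn x) (hn y) h)
  · simp only [mul, S.rep_bch]
    exact hF.exp_bchRat S.one_le_step (S.rep_mem_filEnd x) (S.rep_mem_filEnd y)
  · simp only [map_add]
    refine IsNilpotent.exp_add_of_commute ?_ (hn x) (hn y)
    rw [commute_iff_eq, ← sub_eq_zero, ← S.rep_lie, h, map_zero]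

end Rep

/-! ### The group structure -/

protected theorem mul_assoc (x y z : 𝔤) : S.mul (S.mul x y) z = S.mul x (S.mul y z) := by
  obtain ⟨E, hE, hmul, -⟩ := S.exists_faithful_exp
  apply hE
  simp only [hmul, _root_.mul_assoc]

theorem mul_of_lie_eq_zero {x y : 𝔤} (h : ⁅x, y⁆ = 0) : S.mul x y = x + y := by
  obtain ⟨E, hE, hmul, hadd⟩ := S.exists_faithful_exp
  apply hE
  rw [hmul, hadd x y h]

@[simp]
protected theorem mul_zero (x : 𝔤) : S.mul x 0 = x := by
  rw [S.mul_of_lie_eq_zero (by simp), add_zero]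

@[simp]
protected theorem zero_mul (x : 𝔤) : S.mul 0 x = x := by
  rw [S.mul_of_lie_eq_zero (by simp), zero_add]

@[simp]
theorem mul_neg_self (x : 𝔤) : S.mul x (-x) = 0 := by
  rw [S.mul_of_lie_eq_zero (by simp), add_neg_cancel]

@[simp]
theorem neg_mul_self (x : 𝔤) : S.mul (-x) x = 0 := by
  rw [S.mul_of_lie_eq_zero (by simp), neg_add_cancel]

@[simp]
theorem neg_mul_cancel_left (x y : 𝔤) : S.mul (-x) (S.mul x y) = y := by
  rw [← S.mul_assoc, S.neg_mul_self, S.zero_mul]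

@[simp]
theorem mul_neg_cancel_left (x y : 𝔤) : S.mul x (S.mul (-x) y) = y := by
  rw [← S.mul_assoc, S.mul_neg_self, S.zero_mul]

theorem eq_neg_of_mul_eq_zero {x y : 𝔤} (h : S.mul x y = 0) : y = -x := by
  rw [← S.neg_mul_cancel_left x y, h, S.mul_zero]

protected theorem neg_mul (x y : 𝔤) : -(S.mul x y) = S.mul (-y) (-x) := by
  refine (S.eq_neg_of_mul_eq_zero ?_).symm
  rw [S.mul_assoc, S.mul_neg_cancel_left, S.mul_neg_self]

/-- The innermost bracket of such a word is `0` or `±[x, y]`, and the outer brackets can only raise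
the degree. -/
theorem nestedBracket_mem_fil {m : ℕ} {x y : 𝔤} (h : ⁅x, y⁆ ∈ S.fil m) :
    ∀ l : List 𝔤, (∀ z ∈ l, z = x ∨ z = y) → 2 ≤ l.length → nestedBracket l ∈ S.fil m
  | [], _, h2 => by simp at h2
  | [_], _, h2 => by simp at h2
  | [a, b], hl, _ => by
    rcases hl a (by simp) with rfl | rfl <;> rcases hl b (by simp) with rfl | rfl
    · simp [nestedBracket]
    · exact h
    · rw [nestedBracket, nestedBracket, ← lie_skew]
      exact neg_mem h
    · simp [nestedBracket]
  | a :: b :: c :: l, hl, _ => by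
    have h1 := nestedBracket_mem_fil h (b :: c :: l)
      (fun z hz => hl z (List.mem_cons_of_mem _ hz)) (by simp)
    exact S.fil_anti (by omega) (S.lie_mem_fil (S.mem_fil_one a) h1)

/-- The one-letter words of Dynkin's series add up to `x + y`, and every longer word is controlled
by `[x, y]`. This first-order expansion is used for all later computations modulo `fil`. -/
theorem mul_sub_mem_fil {m : ℕ} {x y : 𝔤} (h : ⁅x, y⁆ ∈ S.fil m) :
    S.mul x y - (x + y) ∈ S.fil m := by
  have hs := S.one_le_step
  have hw : ∀ {n : ℕ} (p : Fin n → Fin (s + 1) × Fin (s + 1)),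
      2 ≤ ∑ i, (((p i).1 : ℕ) + ((p i).2 : ℕ)) → nestedBracket (dynkinWord x y p) ∈ S.fil m :=
    fun p hp => S.nestedBracket_mem_fil h _ (fun z hz => mem_dynkinWord hz)
      (by rwa [length_dynkinWord])
  rw [mul, bch, ← add_sum_erase _ _ (Finset.mem_Icc.2 ⟨le_rfl, hs⟩), add_sub_right_comm]
  refine add_mem ?_ (Submodule.sum_mem _ fun n hn => Submodule.sum_mem _ fun p hp =>
    Submodule.smul_mem _ _ (hw p ?_))
  -- In the part with one block, `(e, 0)` and `(0, e)` index the words `x` and `y`. Writing `x` and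
  -- `y` as sums over all blocks lets the difference be estimated term by term.
  · set e : Fin (s + 1) := ⟨1, by omega⟩
    have hx : x = ∑ a : Fin (s + 1) × Fin (s + 1), if a = (e, 0) then x else 0 := by simp
    have hy : y = ∑ a : Fin (s + 1) × Fin (s + 1), if a = (0, e) then y else 0 := by simp
    rw [congrArg₂ (· + ·) hx hy, sum_filter, ← (Equiv.funUnique (Fin 1) (Fin (s + 1) × Fin (s + 1))).symm.sum_comp,
      ← sum_add_distrib, ← sum_sub_distrib]
    refine Submodule.sum_mem _ fun a _ => ?_
    simp only [Equiv.funUnique_symm_apply, uniqueElim_const]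
    obtain ⟨⟨a, ha⟩, ⟨b, hb⟩⟩ := a
    by_cases h1 : 2 ≤ a + b
    · have h2 : ((⟨a, ha⟩, ⟨b, hb⟩) : Fin (s + 1) × Fin (s + 1)) ≠ (e, 0) := by
        simp [e, Fin.ext_iff]
        omega
      have h3 : ((⟨a, ha⟩, ⟨b, hb⟩) : Fin (s + 1) × Fin (s + 1)) ≠ (0, e) := by
        simp [e, Fin.ext_iff]
        omega
      rw [if_pos (fun _ => by simp; omega), if_neg h2, if_neg h3, add_zero, sub_zero]
      exact Submodule.smul_mem _ _ (hw _ (by simpa using h1))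
    · have h2 : (a = 0 ∧ b = 0) ∨ (a = 1 ∧ b = 0) ∨ (a = 0 ∧ b = 1) := by omega
      rcases h2 with ⟨rfl, rfl⟩ | ⟨rfl, rfl⟩ | ⟨rfl, rfl⟩ <;>
        simp [e, Fin.ext_iff, dynkinWord, nestedBracket, List.ofFn_succ]
  · obtain ⟨hn1, hn⟩ := Finset.mem_erase.1 hn
    have hn2 := (Finset.mem_Icc.1 hn).1
    have hp' := (Finset.mem_filter.1 hp).2
    calc 2 ≤ n := by omega
      _ = ∑ _i : Fin n, 1 := by simp
      _ ≤ _ := sum_le_sum fun i _ => hp' i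

/-! ### Dilations -/

/-- The dilations as linear maps. -/
def dilₗ (lam : ℝ) : 𝔤 →ₗ[ℝ] 𝔤 := ∑ j ∈ range (s + 1), lam ^ j • S.proj j

theorem dilₗ_apply (lam : ℝ) (x : 𝔤) : S.dilₗ lam x = S.dil lam x := by
  simp [dilₗ, dil, LinearMap.sum_apply]

theorem dil_of_mem {i : ℕ} (lam : ℝ) {x : 𝔤} (hx : x ∈ S.layer i) :
    S.dil lam x = lam ^ i • x := by
  rcases lt_or_ge s i with hi | hi
  · rw [S.layer_gt i hi, Submodule.mem_bot] at hx
    simp [hx, dil]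
  · simp only [dil, S.proj_of_mem hx, smul_ite, smul_zero, sum_ite_eq, Finset.mem_range]
    rw [if_pos (by omega)]

theorem dil_add (lam : ℝ) (x y : 𝔤) : S.dil lam (x + y) = S.dil lam x + S.dil lam y := by
  simp only [← dilₗ_apply, map_add]

theorem dil_neg (lam : ℝ) (x : 𝔤) : S.dil lam (-x) = -S.dil lam x := by
  simp only [← dilₗ_apply, map_neg]

theorem proj_dil (lam : ℝ) (j : ℕ) (x : 𝔤) : S.proj j (S.dil lam x) = lam ^ j • S.proj j x := by
  induction x using S.layer_induction with
  | mem i x hx =>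
    rw [S.dil_of_mem lam hx, map_smul, S.proj_of_mem hx]
    split_ifs with h
    · rw [h]
    · simp
  | add x y hx hy => simp only [dil_add, map_add, hx, hy, smul_add]

theorem dil_lie (lam : ℝ) (x y : 𝔤) : S.dil lam ⁅x, y⁆ = ⁅S.dil lam x, S.dil lam y⁆ := by
  induction x using S.layer_induction with
  | mem i x hx =>
    induction y using S.layer_induction with
    | mem j y hy =>
      rw [S.dil_of_mem _ hx, S.dil_of_mem _ hy, S.dil_of_mem _ (S.lie_mem_layer hx hy),
        smul_lie, lie_smul, smul_smul, pow_add]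
    | add y z hy hz => simp only [lie_add, dil_add, hy, hz]
  | add x z hx hz => simp only [add_lie, dil_add, hx, hz]

theorem dil_mul (lam : ℝ) (x y : 𝔤) :
    S.dil lam (S.mul x y) = S.mul (S.dil lam x) (S.dil lam y) := by
  simp only [mul, ← dilₗ_apply]
  exact map_bch (S.dilₗ lam) (fun a b => by simp only [dilₗ_apply, dil_lie]) s x y

end Stratification

/-! ### Exponential coordinates -/

section Coordinates

variable {𝔤 : Type*} [LieRing 𝔤] [LieAlgebra ℝ 𝔤] {k l : ℕ}
  (X : Module.Basis (Fin (k + l)) ℝ 𝔤)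

/-- The point of `L` with given exponential coordinates. -/
def expL (v : EuclideanSpace ℝ (Fin k)) : 𝔤 := ∑ i, v i • X (Fin.castAdd l i)

@[simp]
theorem logW_apply (g : 𝔤) (j : Fin l) : logW X g j = X.repr g (Fin.natAdd k j) := rfl

@[simp]
theorem logL_apply (g : 𝔤) (i : Fin k) : logL X g i = X.repr g (Fin.castAdd l i) := rfl

theorem logL_add (g h : 𝔤) : logL X (g + h) = logL X g + logL X h := by ext j; simp

theorem logL_sub (g h : 𝔤) : logL X (g - h) = logL X g - logL X h := by ext j; simp

theorem logL_neg (g : 𝔤) : logL X (-g) = -logL X g := by ext j; simp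

theorem logW_zero : logW X 0 = 0 := by ext j; simp

theorem logL_zero : logL X 0 = 0 := by ext j; simp

theorem logL_smul (c : ℝ) (g : 𝔤) : logL X (c • g) = c • logL X g := by ext j; simp

theorem expL_add (v w : EuclideanSpace ℝ (Fin k)) : expL X (v + w) = expL X v + expL X w := by
  simp [expL, add_smul, Finset.sum_add_distrib]

theorem expL_neg (v : EuclideanSpace ℝ (Fin k)) : expL X (-v) = -expL X v := by
  simp [expL]

theorem expL_smul (c : ℝ) (v : EuclideanSpace ℝ (Fin k)) : expL X (c • v) = c • expL X v := by
  simp [expL, mul_smul, Finset.smul_sum]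

theorem expL_zero : expL X 0 = 0 := by simp [expL]

theorem expW_zero : expW X 0 = 0 := by simp [expW]

theorem expW_add_expL (g : 𝔤) : expW X (logW X g) + expL X (logL X g) = g := by
  conv_rhs => rw [← X.sum_repr g, Fin.sum_univ_add]
  rw [add_comm]
  rfl

theorem expW_logW {g : 𝔤} (h : logL X g = 0) : expW X (logW X g) = g := by
  conv_rhs => rw [← expW_add_expL X g, h, expL_zero, add_zero]

theorem logW_expW (y : EuclideanSpace ℝ (Fin l)) : logW X (expW X y) = y := by
  ext j
  simp [expW, Finsupp.single_apply]

theorem logL_expW (y : EuclideanSpace ℝ (Fin l)) : logL X (expW X y) = 0 := by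
  ext i
  have h : ∀ j, Fin.natAdd k j ≠ Fin.castAdd l i := by
    intro j h
    have := congrArg Fin.val h
    simp at this
    omega
  simp [expW, h]

theorem logL_expL (v : EuclideanSpace ℝ (Fin k)) : logL X (expL X v) = v := by
  ext i
  simp [expL, Finsupp.single_apply]

theorem mem_span_natAdd_iff {g : 𝔤} :
    g ∈ Submodule.span ℝ (Set.range fun j : Fin l => X (Fin.natAdd k j)) ↔ logL X g = 0 := by
  constructor
  · intro h
    induction h using Submodule.span_induction with
    | mem g hg =>
      obtain ⟨j, rfl⟩ := hg
      have := logL_expW X (EuclideanSpace.single j (1 : ℝ))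
      simpa [expW] using this
    | zero => exact logL_zero X
    | add g h _ _ hg hh => rw [logL_add, hg, hh, add_zero]
    | smul c g _ hg => rw [logL_smul, hg, smul_zero]
  · intro h
    rw [← expW_add_expL X g, h, expL_zero, add_zero]
    exact Submodule.sum_mem _ fun j _ => Submodule.smul_mem _ _ (Submodule.subset_span ⟨j, rfl⟩)

theorem expL_mem_span (v : EuclideanSpace ℝ (Fin k)) :
    expL X v ∈ Submodule.span ℝ (Set.range fun i : Fin k => X (Fin.castAdd l i)) :=
  Submodule.sum_mem _ fun j _ => Submodule.smul_mem _ _ (Submodule.subset_span ⟨j, rfl⟩)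

theorem expL_logL_of_mem {g : 𝔤}
    (hg : g ∈ Submodule.span ℝ (Set.range fun i : Fin k => X (Fin.castAdd l i))) :
    expL X (logL X g) = g := by
  induction hg using Submodule.span_induction with
  | mem g hg =>
    obtain ⟨j, rfl⟩ := hg
    have := congrArg (expL X) (logL_expL X (EuclideanSpace.single j (1 : ℝ)))
    simpa [expL] using this
  | zero => rw [logL_zero, expL_zero]
  | add g h _ _ hg hh => rw [logL_add, expL_add, hg, hh]
  | smul c g _ hg => rw [logL_smul, expL_smul, hg]

end Coordinates

/-! ### Degrees of the basis vectors and coordinates of dilations -/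

namespace Stratification

variable {𝔤 : Type*} [LieRing 𝔤] [LieAlgebra ℝ 𝔤] {s : ℕ} (S : Stratification 𝔤 s)

theorem cumDim_zero : S.cumDim 0 = 0 := by simp [cumDim]

theorem cumDim_one : S.cumDim 1 = S.rank := by simp [cumDim, rank]

theorem deg_eq_one_iff (i : ℕ) : S.deg i = 1 ↔ i < S.rank := by
  constructor
  · intro h
    have h1 := Nat.sInf_mem (Nat.nonempty_of_sInf_eq_succ h)
    change i < S.cumDim (S.deg i) at h1
    rwa [h, cumDim_one] at h1
  · intro h
    refine le_antisymm (Nat.sInf_le (by simpa [cumDim_one] using h)) ?_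
    rw [Nat.one_le_iff_ne_zero]
    intro h0
    -- The value `0` could also come from the convention `sInf ∅ = 0`, so the empty set has to be
    -- excluded too.
    rcases Nat.sInf_eq_zero.1 h0 with h1 | h1
    · simp [cumDim_zero] at h1
    · have h2 : 1 ∈ {j : ℕ | i < S.cumDim j} := by simpa [cumDim_one] using h
      rw [h1] at h2
      exact h2

variable {n : ℕ} {X : Module.Basis (Fin n) ℝ 𝔤} (hX : S.IsAdapted X)
include hX

/-- The basis vectors with degree in `1, …, s` already span every layer, so linear independence
leaves no room for another one. This rules out the default value `0` of the degree. -/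
theorem deg_mem_Icc (i : Fin n) : 1 ≤ S.deg i ∧ S.deg i ≤ s := by
  by_contra hi
  have h : ∀ x, x ∈ Submodule.span ℝ (X '' {i | 1 ≤ S.deg i ∧ S.deg i ≤ s}) := by
    intro x
    induction x using S.layer_induction with
    | mem j x hx =>
      rcases Nat.eq_zero_or_pos j with rfl | hj
      · rw [S.layer_zero, Submodule.mem_bot] at hx
        rw [hx]
        exact zero_mem _
      · rcases lt_or_ge s j with hj' | hj'
        · rw [S.layer_gt j hj', Submodule.mem_bot] at hx
          rw [hx]
          exact zero_mem _
        · rw [← hX.span_eq j hj hj'] at hx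
          refine Submodule.span_mono (image_mono ?_) hx
          rintro i rfl
          exact ⟨hj, hj'⟩
    | add x y hx hy => exact add_mem hx hy
  exact X.linearIndependent.notMem_span_image (s := {i | 1 ≤ S.deg i ∧ S.deg i ≤ s}) hi (h (X i))

theorem basis_mem_layer (i : Fin n) : X i ∈ S.layer (S.deg i) := by
  obtain ⟨h1, h2⟩ := S.deg_mem_Icc hX i
  rw [← hX.span_eq _ h1 h2]
  exact Submodule.subset_span ⟨i, rfl, rfl⟩

theorem repr_proj (j : ℕ) (x : 𝔤) (i : Fin n) :
    X.repr (S.proj j x) i = if S.deg i = j then X.repr x i else 0 := by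
  conv_lhs => rw [← X.sum_repr x]
  simp only [map_sum, map_smul, S.proj_of_mem (S.basis_mem_layer hX _), Finsupp.coe_finsetSum,
    Finset.sum_apply, Finsupp.smul_apply]
  rw [Finset.sum_eq_single i]
  · split_ifs <;> simp
  · intro b _ hb
    split_ifs <;> simp [hb]
  · simp

theorem repr_dil (lam : ℝ) (x : 𝔤) (i : Fin n) :
    X.repr (S.dil lam x) i = lam ^ S.deg i * X.repr x i := by
  have h := S.repr_proj hX (S.deg i) (S.dil lam x) i
  rw [S.proj_dil, map_smul, Finsupp.smul_apply, S.repr_proj hX, if_pos rfl, if_pos rfl] at h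
  exact h.symm

theorem mem_fil_iff_repr (m : ℕ) (x : 𝔤) :
    x ∈ S.fil m ↔ ∀ i : Fin n, S.deg i < m → X.repr x i = 0 := by
  constructor
  · intro h i hi
    have := S.repr_proj hX (S.deg i) x i
    rw [h _ hi, if_pos rfl] at this
    simpa using this.symm
  · intro h j hj
    apply X.repr.injective
    ext i
    rw [S.repr_proj hX]
    split_ifs with hi
    · rw [h i (hi ▸ hj)]
      simp
    · simp

end Stratification

/-! ### Conjugation, and the splitting of the group into `W` and `L` -/

namespace Stratification

variable {𝔤 : Type*} [LieRing 𝔤] [LieAlgebra ℝ 𝔤] {s : ℕ} (S : Stratification 𝔤 s)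

/-- Conjugation `v · w · v⁻¹`. -/
def conj (v w : 𝔤) : 𝔤 := S.mul v (S.mul w (-v))

theorem conj_mul (v w : 𝔤) : S.mul (S.conj v w) v = S.mul v w := by
  simp [conj, S.mul_assoc]

theorem conj_neg_conj (v w : 𝔤) : S.conj v (S.conj (-v) w) = w := by
  simp [conj, S.mul_assoc]

theorem conj_sub_mem_fil {j : ℕ} {v w : 𝔤} (hw : w ∈ S.fil j) :
    S.conj v w - w ∈ S.fil (j + 1) := by
  have h0 : ∀ {x y : 𝔤}, y ∈ S.fil j → ⁅x, y⁆ ∈ S.fil (j + 1) := by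
    intro x y hy
    have := S.lie_mem_fil (S.mem_fil_one x) hy
    rwa [add_comm] at this
  have h1 : S.mul w (-v) - (w + -v) ∈ S.fil (j + 1) := by
    refine S.mul_sub_mem_fil ?_
    rw [← lie_skew]
    exact neg_mem (h0 hw)
  have h2 : ⁅v, S.mul w (-v)⁆ ∈ S.fil (j + 1) := by
    have h3 : ⁅v, S.mul w (-v)⁆ = ⁅v, S.mul w (-v) - (w + -v)⁆ + ⁅v, w⁆ := by
      simp only [lie_sub, lie_add, lie_neg, lie_self]
      abel
    rw [h3]
    exact add_mem (h0 (S.fil_anti (by omega) h1)) (h0 hw)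
  have h4 := add_mem (S.mul_sub_mem_fil h2) h1
  have h5 : S.conj v w - w =
      S.mul v (S.mul w (-v)) - (v + S.mul w (-v)) + (S.mul w (-v) - (w + -v)) := by
    rw [conj]
    abel
  rwa [h5]

theorem mul_sub_add_mem_fil {j : ℕ} {x y : 𝔤} (hy : y ∈ S.fil j) :
    S.mul x y - (x + y) ∈ S.fil (j + 1) := by
  refine S.mul_sub_mem_fil ?_
  have := S.lie_mem_fil (S.mem_fil_one x) hy
  rwa [add_comm] at this

theorem dil_sub_mem_fil {j : ℕ} (c : ℝ) {w : 𝔤} (hw : w ∈ S.fil j) :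
    S.dil c w - c ^ j • w ∈ S.fil (j + 1) := by
  intro m hm
  rw [map_sub, S.proj_dil, map_smul]
  rcases lt_or_ge m j with h | h
  · simp [hw m h]
  · obtain rfl : m = j := by omega
    rw [sub_self]

variable {k l : ℕ} {X : Module.Basis (Fin (k + l)) ℝ 𝔤} (hX : S.IsAdapted X) (hk : k ≤ S.rank)
include hX hk

omit hX in
theorem deg_castAdd (i : Fin k) : S.deg (Fin.castAdd l i : Fin (k + l)) = 1 := by
  rw [deg_eq_one_iff]
  have := i.2
  simp only [Fin.val_castAdd]
  omega

theorem logL_of_mem_fil {x : 𝔤} (hx : x ∈ S.fil 2) : logL X x = 0 := by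
  ext i
  refine (S.mem_fil_iff_repr hX 2 x).1 hx _ ?_
  rw [S.deg_castAdd hk]
  norm_num

/-- The coordinates along the horizontal subgroup `L` have degree one, while the corrections to `x +
y` in the product have degree at least two. -/
theorem logL_mul (x y : 𝔤) : logL X (S.mul x y) = logL X x + logL X y := by
  have h := S.logL_of_mem_fil hX hk (S.mul_sub_add_mem_fil (x := x) (S.mem_fil_one y))
  rw [logL_sub, logL_add, sub_eq_zero] at h
  exact h

theorem logL_conj (x y : 𝔤) : logL X (S.conj x y) = logL X y := by
  simp [conj, S.logL_mul hX hk, logL_neg]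

theorem logL_dil (c : ℝ) (x : 𝔤) : logL X (S.dil c x) = c • logL X x := by
  ext i
  rw [logL_apply, S.repr_dil hX, S.deg_castAdd hk, pow_one]
  simp

theorem expL_mem_layer (v : EuclideanSpace ℝ (Fin k)) : expL X v ∈ S.layer 1 := by
  refine Submodule.sum_mem _ fun i _ => Submodule.smul_mem _ _ ?_
  have := S.basis_mem_layer hX (Fin.castAdd l i)
  rwa [S.deg_castAdd hk] at this

theorem dil_expL (c : ℝ) (v : EuclideanSpace ℝ (Fin k)) :
    S.dil c (expL X v) = expL X (c • v) := by
  rw [S.dil_of_mem c (S.expL_mem_layer hX hk v), pow_one, expL_smul]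

variable {W L : Set 𝔤} (hWL : S.IsComplementary W L)
  (hW : W = (Submodule.span ℝ (Set.range fun j : Fin l => X (Fin.natAdd k j)) : Set 𝔤))
  (hL : L = (Submodule.span ℝ (Set.range fun i : Fin k => X (Fin.castAdd l i)) : Set 𝔤))

include hWL hL in
-- The product stays in `L`, where a point is determined by its `L`-coordinates, and these add.
-- Closure of `L` under the product thus forces it to be abelian.
theorem expL_mul_expL (u v : EuclideanSpace ℝ (Fin k)) :
    S.mul (expL X u) (expL X v) = expL X (u + v) := by
  have hmem : ∀ w, expL X w ∈ L := fun w => by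
    rw [hL]
    exact expL_mem_span X w
  have h := hWL.right.mul_mem _ (hmem u) _ (hmem v)
  rw [hL] at h
  rw [← expL_logL_of_mem X h, S.logL_mul hX hk, logL_expL, logL_expL]

include hWL hW hL

omit hX hk hWL hL in
theorem mem_W_iff {g : 𝔤} : g ∈ W ↔ logL X g = 0 := by
  rw [hW]
  exact mem_span_natAdd_iff X

/-- Whatever decomposition `g = w · v` is chosen, the homomorphism `logL` vanishes on `W` and so
reads off `v`. -/
theorem projW_eq (g : 𝔤) : S.projW W L g = S.mul g (-(expL X (logL X g))) := by
  have h := hWL.exists_mul g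
  rw [projW, dif_pos h]
  obtain ⟨hw, v, hv, hg⟩ := h.choose_spec
  set w := h.choose
  have h1 := congrArg (logL X) hg
  rw [S.logL_mul hX hk, (mem_W_iff hW).1 hw, zero_add] at h1
  rw [hL] at hv
  rw [h1, expL_logL_of_mem X hv, hg, S.mul_assoc, S.mul_neg_self, S.mul_zero]

theorem projL_eq (g : 𝔤) : S.projL W L g = expL X (logL X g) := by
  rw [projL, S.projW_eq hX hk hWL hW hL, S.neg_mul, neg_neg, S.mul_assoc, S.neg_mul_self,
    S.mul_zero]

/-! ### Intrinsically linear maps -/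

omit hWL in
theorem intrinsicallyLinear_eq {ℓ : 𝔤 → 𝔤} (hℓ : S.IsIntrinsicallyLinear W L ℓ) {w : 𝔤}
    (hw : logL X w = 0) {u : EuclideanSpace ℝ (Fin k)}
    (h : S.mul w (expL X u) ∈ (fun w => S.mul w (ℓ w)) '' W) : logL X (ℓ w) = u := by
  obtain ⟨w', hw', h⟩ := h
  have h1 := congrArg (logL X) h
  simp only [S.logL_mul hX hk, (mem_W_iff hW).1 hw', hw, zero_add, logL_expL] at h1
  have hmem := hℓ.1 hw'
  rw [hL] at hmem
  have h2 : ℓ w' = expL X u := by rw [← h1, expL_logL_of_mem X hmem]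
  simp only [h2] at h
  have h3 := congrArg (fun g => S.mul g (-(expL X u))) h
  simp only [S.mul_assoc, S.mul_neg_self, S.mul_zero] at h3
  rw [← h3, h1]

/-- The product of two graph points regroups as `w ℓ(w) w' ℓ(w') = (w · ℓ(w) w' ℓ(w)⁻¹) · (ℓ(w)
ℓ(w'))` and lies in the graph again. -/
theorem intrinsicallyLinear_mul {ℓ : 𝔤 → 𝔤} (hℓ : S.IsIntrinsicallyLinear W L ℓ) {w w' : 𝔤}
    (hw : logL X w = 0) (hw' : logL X w' = 0) :
    logL X (ℓ (S.mul w (S.conj (expL X (logL X (ℓ w))) w'))) =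
      logL X (ℓ w) + logL X (ℓ w') := by
  refine S.intrinsicallyLinear_eq hX hk hW hL hℓ ?_ ?_
  · rw [S.logL_mul hX hk, S.logL_conj hX hk, hw, hw', zero_add]
  · have hmem : ∀ {w}, logL X w = 0 →
        S.mul w (expL X (logL X (ℓ w))) ∈ (fun w => S.mul w (ℓ w)) '' W := by
      intro w hw
      have h1 := (mem_W_iff hW).2 hw
      have h2 := hℓ.1 h1
      rw [hL] at h2
      rw [expL_logL_of_mem X h2]
      exact ⟨w, h1, rfl⟩
    have h := hℓ.2.mul_mem _ (hmem hw) _ (hmem hw')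
    rw [← S.expL_mul_expL hX hk hWL hL, S.mul_assoc, ← S.mul_assoc (S.conj _ _), S.conj_mul,
      S.mul_assoc, ← S.mul_assoc]
    exact h

omit hWL in
theorem intrinsicallyLinear_dil {ℓ : 𝔤 → 𝔤} (hℓ : S.IsIntrinsicallyLinear W L ℓ) {w : 𝔤}
    (hw : logL X w = 0) {c : ℝ} (hc : 0 < c) :
    logL X (ℓ (S.dil c w)) = c • logL X (ℓ w) := by
  refine S.intrinsicallyLinear_eq hX hk hW hL hℓ ?_ ?_
  · rw [S.logL_dil hX hk, hw, smul_zero]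
  · have h1 := (mem_W_iff hW).2 hw
    have h2 := hℓ.1 h1
    rw [hL] at h2
    have h := hℓ.2.dil_mem c hc _ ⟨w, h1, rfl⟩
    rwa [S.dil_mul, ← expL_logL_of_mem X h2, S.dil_expL hX hk] at h

omit hWL hW hL in
/-- A map on `W` which is compatible with the group law of its graph and with the dilations is
linear and depends on the first layer only. -/
theorem exists_bound_of_conj_mul {f : 𝔤 → EuclideanSpace ℝ (Fin k)}
    (hmul : ∀ w w', logL X w = 0 → logL X w' = 0 →
      f (S.mul w (S.conj (expL X (f w)) w')) = f w + f w')
    (hdil : ∀ w, logL X w = 0 → ∀ c : ℝ, 0 < c → f (S.dil c w) = c • f w) :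
    ∃ C : ℝ, 0 ≤ C ∧ ∀ y : EuclideanSpace ℝ (Fin l),
      ‖f (expW X y)‖ ≤ C * ∑ j : Fin l, if S.deg (k + (j : ℕ)) = 1 then |y j| else 0 := by
  have hconj0 : ∀ w, S.conj w 0 = 0 := fun w => by simp [conj]
  have hzero : f 0 = 0 := by
    have := hmul 0 0 (logL_zero X) (logL_zero X)
    rw [hconj0, S.mul_zero] at this
    simpa using this
  have hinv : ∀ w, logL X w = 0 → f (S.conj (-(expL X (f w))) (-w)) = -f w := by
    intro w hw
    have := hmul w (S.conj (-(expL X (f w))) (-w)) hw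
      (by rw [S.logL_conj hX hk, logL_neg, hw, neg_zero])
    rw [S.conj_neg_conj, S.mul_neg_self, hzero] at this
    exact (neg_eq_of_add_eq_zero_right this.symm).symm
  have hconj_mem : ∀ {j : ℕ} {v w : 𝔤}, w ∈ S.fil j → S.conj v w ∈ S.fil j := by
    intro j v w hw
    have := add_mem (S.fil_anti (by omega) (S.conj_sub_mem_fil (v := v) hw)) hw
    simpa using this
  have hmul_mem : ∀ {j : ℕ} {v w : 𝔤}, v ∈ S.fil j → w ∈ S.fil j → S.mul v w ∈ S.fil j := by
    intro j v w hv hw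
    have := add_mem (S.fil_anti (by omega) (S.mul_sub_add_mem_fil (x := v) hw)) (add_mem hv hw)
    simpa using this
  -- Descending induction on `j`, with `i` counting the layers left before `fil j` becomes trivial.
  have hvanish : ∀ i j : ℕ, 2 ≤ j → s + 1 ≤ i + j → ∀ w ∈ S.fil j, f w = 0 := by
    intro i
    induction i with
    | zero =>
      intro j _ hj w hw
      rw [S.eq_zero_of_mem_fil (by omega) hw, hzero]
    | succ i ih =>
      intro j hj hij w hw
      have hW0 : ∀ {w}, w ∈ S.fil j → logL X w = 0 := fun hw =>
        S.logL_of_mem_fil hX hk (S.fil_anti hj hw)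
      -- With `c ^ j = 2`, both the twisted square of `w` and its dilation by `c` equal `2 w` modulo
      -- `fil (j + 1)`. Their values under `f` are `2 f(w)` and `c f(w)`, and `c ≠ 2` because `j ≥
      -- 2`.
      set c : ℝ := (2 : ℝ) ^ ((j : ℝ)⁻¹) with hc
      have hc0 : 0 < c := by positivity
      have hcj : c ^ j = 2 := by
        rw [hc, ← Real.rpow_natCast, ← Real.rpow_mul (by norm_num),
          inv_mul_cancel₀ (by positivity), Real.rpow_one]
      have hc2 : c ≠ 2 := by
        intro h
        rw [h] at hcj
        have h1 : (2 : ℝ) ^ 2 ≤ 2 ^ j := pow_le_pow_right₀ (by norm_num) hj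
        norm_num [hcj] at h1
      have hdw : S.dil c w ∈ S.fil j := by
        have := add_mem (S.fil_anti (by omega) (S.dil_sub_mem_fil c hw))
          (Submodule.smul_mem _ (c ^ j) hw)
        simpa using this
      set w₁ := S.mul w (S.conj (expL X (f w)) w) with hw₁
      set w₂ := S.conj (-(expL X (f (S.dil c w)))) (-S.dil c w) with hw₂
      have hw₁m : w₁ ∈ S.fil j := hmul_mem hw (hconj_mem hw)
      have hw₂m : w₂ ∈ S.fil j := hconj_mem (neg_mem hdw)
      have hf₁ : f w₁ = f w + f w := hmul w w (hW0 hw) (hW0 hw)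
      have hf₂ : f w₂ = -(c • f w) := by rw [hw₂, hinv _ (hW0 hdw), hdil w (hW0 hw) c hc0]
      set w₃ := S.mul w₁ (S.conj (expL X (f w₁)) w₂) with hw₃
      have hf₃ : f w₃ = f w₁ + f w₂ := hmul w₁ w₂ (hW0 hw₁m) (hW0 hw₂m)
      -- This twisted quotient is congruent to `2 w - 2 w`. The six errors come from products,
      -- conjugations and the dilation.
      have hmem : w₃ ∈ S.fil (j + 1) := by
        have e1 := S.mul_sub_add_mem_fil (x := w₁) (hconj_mem (v := expL X (f w₁)) hw₂m)
        have e2 := S.conj_sub_mem_fil (v := expL X (f w₁)) hw₂m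
        have e3 := S.conj_sub_mem_fil (v := -(expL X (f (S.dil c w)))) (neg_mem hdw)
        have e4 := S.mul_sub_add_mem_fil (x := w) (hconj_mem (v := expL X (f w)) hw)
        have e5 := S.conj_sub_mem_fil (v := expL X (f w)) hw
        have e6 := S.dil_sub_mem_fil c hw
        rw [hcj] at e6
        have := sub_mem (add_mem (add_mem (add_mem (add_mem e1 e2) e3) e4) e5) e6
        convert this using 1
        rw [two_smul]
        abel
      have h3 := ih (j + 1) (by omega) (by omega) w₃ hmem
      rw [hf₃, hf₁, hf₂, ← two_smul ℝ, ← sub_eq_add_neg, ← sub_smul, smul_eq_zero] at h3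
      exact h3.resolve_left (sub_ne_zero.2 hc2.symm)
  have hvan : ∀ w ∈ S.fil 2, f w = 0 := hvanish (s + 1) 2 le_rfl (by omega)
  -- Write `w' = w · e` with `e ∈ fil 2`. Conjugating `e` back puts this product in the twisted
  -- form, and `f` vanishes on the second factor.
  have hcongr : ∀ w w', logL X w = 0 → logL X w' = 0 → w' - w ∈ S.fil 2 → f w' = f w := by
    intro w w' hw hw' h
    set e := S.mul (-w) w' with he
    have hem : e ∈ S.fil 2 := by
      have := add_mem (S.mul_sub_add_mem_fil (x := -w) (S.mem_fil_one w')) h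
      convert this using 1
      abel
    have h1 := hmul w (S.conj (-(expL X (f w))) e) hw
      (by rw [S.logL_conj hX hk, S.logL_of_mem_fil hX hk hem])
    rw [S.conj_neg_conj, he, S.mul_neg_cancel_left, hvan _ (hconj_mem hem), add_zero] at h1
    exact h1
  have hadd : ∀ w w', logL X w = 0 → logL X w' = 0 → f (w + w') = f w + f w' := by
    intro w w' hw hw'
    rw [← hmul w w' hw hw']
    refine hcongr _ _ ?_ (by rw [logL_add, hw, hw', zero_add]) ?_
    · rw [S.logL_mul hX hk, S.logL_conj hX hk, hw, hw', zero_add]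
    · have e1 := S.mul_sub_add_mem_fil (x := w) (S.mem_fil_one (S.conj (expL X (f w)) w'))
      have e2 := S.conj_sub_mem_fil (v := expL X (f w)) (S.mem_fil_one w')
      have := neg_mem (add_mem e1 e2)
      convert this using 1
      abel
  have hsmul : ∀ (c : ℝ) w, logL X w = 0 → f (c • w) = c • f w := by
    have hpos : ∀ (c : ℝ) w, 0 < c → logL X w = 0 → f (c • w) = c • f w := by
      intro c w hc hw
      rw [← hdil w hw c hc]
      refine hcongr _ _ ?_ (by rw [logL_smul, hw, smul_zero]) ?_
      · rw [S.logL_dil hX hk, hw, smul_zero]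
      · have := neg_mem (S.dil_sub_mem_fil c (S.mem_fil_one w))
        rwa [neg_sub, pow_one] at this
    intro c w hw
    rcases lt_trichotomy c 0 with hc | rfl | hc
    · have h1 := hadd (c • w) ((-c) • w) (by rw [logL_smul, hw, smul_zero])
        (by rw [logL_smul, hw, smul_zero])
      rw [← add_smul, add_neg_cancel, zero_smul, hzero, hpos (-c) w (by linarith) hw, neg_smul,
        ← sub_eq_add_neg] at h1
      exact sub_eq_zero.1 h1.symm
    · rw [zero_smul, zero_smul, hzero]
    · exact hpos c w hc hw
  have hXW : ∀ j : Fin l, logL X (X (Fin.natAdd k j)) = 0 := fun j =>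
    (mem_span_natAdd_iff X).1 (Submodule.subset_span ⟨j, rfl⟩)
  have hsum : ∀ (y : EuclideanSpace ℝ (Fin l)) (T : Finset (Fin l)),
      logL X (∑ j ∈ T, y j • X (Fin.natAdd k j)) = 0 ∧
      f (∑ j ∈ T, y j • X (Fin.natAdd k j)) = ∑ j ∈ T, y j • f (X (Fin.natAdd k j)) := by
    intro y T
    induction T using Finset.induction_on with
    | empty => simp [hzero, logL_zero]
    | insert a T ha ih =>
      have h1 : logL X (y a • X (Fin.natAdd k a)) = 0 := by rw [logL_smul, hXW, smul_zero]
      rw [Finset.sum_insert ha, Finset.sum_insert ha, logL_add, ih.1, h1, hadd _ _ h1 ih.1, ih.2,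
        hsmul _ _ (hXW a), add_zero]
      exact ⟨rfl, rfl⟩
  refine ⟨∑ j, ‖f (X (Fin.natAdd k j))‖, Finset.sum_nonneg fun _ _ => norm_nonneg _, fun y => ?_⟩
  rw [expW, (hsum y Finset.univ).2, Finset.mul_sum]
  refine (norm_sum_le _ _).trans (Finset.sum_le_sum fun j _ => ?_)
  split_ifs with hj
  · rw [norm_smul, Real.norm_eq_abs, mul_comm]
    exact mul_le_mul_of_nonneg_right (Finset.single_le_sum
      (f := fun j => ‖f (X (Fin.natAdd k j))‖) (fun _ _ => norm_nonneg _) (Finset.mem_univ j))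
      (abs_nonneg _)
  · have h1 := S.deg_mem_Icc hX (Fin.natAdd k j)
    have h2 := S.basis_mem_layer hX (Fin.natAdd k j)
    rw [hvan _ (S.layer_le_fil ?_ h2)]
    · simp
    · simp only [Fin.val_natAdd] at h1 ⊢
      omega

theorem intrinsicallyLinear_bound {ℓ : 𝔤 → 𝔤} (hℓ : S.IsIntrinsicallyLinear W L ℓ) :
    ∃ C : ℝ, 0 ≤ C ∧ ∀ y : EuclideanSpace ℝ (Fin l), ‖logL X (ℓ (expW X y))‖ ≤
      C * ∑ j : Fin l, if S.deg (k + (j : ℕ)) = 1 then |y j| else 0 :=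
  S.exists_bound_of_conj_mul hX hk (f := fun w => logL X (ℓ w))
    (fun _ _ hw hw' => S.intrinsicallyLinear_mul hX hk hWL hW hL hℓ hw hw')
    (fun _ hw _ hc => S.intrinsicallyLinear_dil hX hk hW hL hℓ hw hc)

end Stratification

/-! ### Smoothness in exponential coordinates -/

section Smooth

variable {𝔤 : Type*} [LieRing 𝔤] [LieAlgebra ℝ 𝔤] {n : ℕ} (X : Module.Basis (Fin n) ℝ 𝔤)
  {Z : Type*} [NormedAddCommGroup Z] [NormedSpace ℝ Z]

/-- Continuous differentiability of the coordinates of a map into `𝔤`. -/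
def CoordSmooth (f : Z → 𝔤) : Prop := ∀ i, ContDiff ℝ 1 fun z => X.repr (f z) i

namespace CoordSmooth

variable {X} {f g : Z → 𝔤}

theorem const (x : 𝔤) : CoordSmooth X fun _ : Z => x := fun _ => contDiff_const

theorem neg (hf : CoordSmooth X f) : CoordSmooth X fun z => -f z :=
  fun i => by simpa using (hf i).neg

theorem smul {c : Z → ℝ} (hc : ContDiff ℝ 1 c) (hf : CoordSmooth X f) :
    CoordSmooth X fun z => c z • f z :=
  fun i => by simpa using hc.mul (hf i)

theorem sum {ι : Type*} (t : Finset ι) {f : ι → Z → 𝔤} (hf : ∀ i ∈ t, CoordSmooth X (f i)) :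
    CoordSmooth X fun z => ∑ i ∈ t, f i z := by
  intro i
  simp only [map_sum, Finsupp.coe_finsetSum, Finset.sum_apply]
  exact ContDiff.sum fun j hj => hf j hj i

theorem lie (hf : CoordSmooth X f) (hg : CoordSmooth X g) : CoordSmooth X fun z => ⁅f z, g z⁆ := by
  have h : (fun z => ⁅f z, g z⁆) =
      fun z => ∑ a, ∑ b, (X.repr (g z) b * X.repr (f z) a) • ⁅X a, X b⁆ := by
    ext z
    conv_lhs => rw [← X.sum_repr (f z), ← X.sum_repr (g z), sum_lie_sum]
    simp only [smul_lie, lie_smul, smul_smul]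
  rw [h]
  exact sum _ fun a _ => sum _ fun b _ => smul ((hg b).mul (hf a)) (const _)

theorem nestedBracket (l : List (Z → 𝔤)) (hl : ∀ h ∈ l, CoordSmooth X h) :
    CoordSmooth X fun z => _root_.nestedBracket (l.map fun h => h z) := by
  induction l with
  | nil => exact const 0
  | cons a l ih =>
    rcases eq_or_ne l [] with rfl | hne
    · exact hl a (by simp)
    · have h : ∀ z, _root_.nestedBracket ((a :: l).map fun h => h z) =
          ⁅a z, _root_.nestedBracket (l.map fun h => h z)⁆ := fun z => by
        rw [List.map_cons, nestedBracket_cons _ (by simpa)]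
      simp only [h]
      exact (hl a (by simp)).lie (ih fun h hh => hl h (List.mem_cons_of_mem _ hh))

theorem mul {s : ℕ} (S : Stratification 𝔤 s) (hf : CoordSmooth X f) (hg : CoordSmooth X g) :
    CoordSmooth X fun z => S.mul (f z) (g z) := by
  simp only [Stratification.mul, bch]
  refine sum _ fun n _ => sum _ fun p _ => smul contDiff_const ?_
  have h : ∀ z, dynkinWord (f z) (g z) p = (dynkinWord f g p).map fun h => h z := fun z =>
    (map_dynkinWord (fun h : Z → 𝔤 => h z) f g p).symm
  simp only [h]
  refine nestedBracket _ fun h hh => ?_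
  rcases mem_dynkinWord hh with rfl | rfl <;> assumption

end CoordSmooth

variable {k l : ℕ} {X : Module.Basis (Fin (k + l)) ℝ 𝔤}

theorem CoordSmooth.expW {f : Z → EuclideanSpace ℝ (Fin l)} (hf : ContDiff ℝ 1 f) :
    CoordSmooth X fun z => expW X (f z) :=
  CoordSmooth.sum _ fun j _ => CoordSmooth.smul (contDiff_euclidean.1 hf j) (CoordSmooth.const _)

theorem CoordSmooth.expL {f : Z → EuclideanSpace ℝ (Fin k)} (hf : ContDiff ℝ 1 f) :
    CoordSmooth X fun z => expL X (f z) :=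
  CoordSmooth.sum _ fun j _ => CoordSmooth.smul (contDiff_euclidean.1 hf j) (CoordSmooth.const _)

theorem CoordSmooth.contDiff_logW {f : Z → 𝔤} (hf : CoordSmooth X f) :
    ContDiff ℝ 1 fun z => logW X (f z) :=
  contDiff_euclidean.2 fun j => hf (Fin.natAdd k j)

end Smooth

/-! ### Translated coordinates, projected flows and their symmetries -/

namespace Stratification

variable {𝔤 : Type*} [LieRing 𝔤] [LieAlgebra ℝ 𝔤] {s : ℕ} (S : Stratification 𝔤 s)
  {k l : ℕ} (X : Module.Basis (Fin (k + l)) ℝ 𝔤)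

/-- The coordinates of `v⁻¹ · w⁻¹ · x · v`, `v ∈ L` and `w, x ∈ W`. -/
def transCoord (v : EuclideanSpace ℝ (Fin k)) (w x : EuclideanSpace ℝ (Fin l)) :
    EuclideanSpace ℝ (Fin l) :=
  logW X (S.mul (-(expL X v)) (S.mul (-(expW X w)) (S.mul (expW X x) (expL X v))))

/-- The coordinates of `x · v · exp(τ Y) · v⁻¹`, `v ∈ L` and `x ∈ W`. -/
def flowCoord (Y : 𝔤) (x : EuclideanSpace ℝ (Fin l)) (v : EuclideanSpace ℝ (Fin k)) (τ : ℝ) :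
    EuclideanSpace ℝ (Fin l) :=
  logW X (S.mul (expW X x) (S.conj (expL X v) (τ • Y)))

/-- The dilations in exponential coordinates on `W`. -/
def dilCoord (c : ℝ) : EuclideanSpace ℝ (Fin l) →L[ℝ] EuclideanSpace ℝ (Fin l) :=
  LinearMap.toContinuousLinearMap
    { toFun := fun y => WithLp.toLp 2 fun j => c ^ S.deg (k + (j : ℕ)) * y j
      map_add' := fun x y => by ext j; simp [mul_add]
      map_smul' := fun a y => by ext j; simp [mul_left_comm] }

variable {X}

theorem dilCoord_apply (c : ℝ) (y : EuclideanSpace ℝ (Fin l)) (j : Fin l) :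
    S.dilCoord (k := k) c y j = c ^ S.deg (k + (j : ℕ)) * y j := rfl

theorem dilCoord_dilCoord (c c' : ℝ) (y : EuclideanSpace ℝ (Fin l)) :
    S.dilCoord (k := k) c (S.dilCoord (k := k) c' y) = S.dilCoord (k := k) (c * c') y := by
  ext j
  simp only [dilCoord_apply, mul_pow]
  ring

theorem dilCoord_one (y : EuclideanSpace ℝ (Fin l)) : S.dilCoord (k := k) 1 y = y := by
  ext j
  simp [dilCoord_apply]

theorem contDiff_transCoord :
    ContDiff ℝ 1 fun p : EuclideanSpace ℝ (Fin k) × EuclideanSpace ℝ (Fin l) ×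
      EuclideanSpace ℝ (Fin l) => S.transCoord X p.1 p.2.1 p.2.2 := by
  have hv : CoordSmooth X fun p : EuclideanSpace ℝ (Fin k) × EuclideanSpace ℝ (Fin l) ×
    EuclideanSpace ℝ (Fin l) => expL X p.1 := CoordSmooth.expL contDiff_fst
  exact (hv.neg.mul S ((CoordSmooth.expW contDiff_snd.fst).neg.mul S
    ((CoordSmooth.expW contDiff_snd.snd).mul S hv))).contDiff_logW

theorem contDiff_flowCoord (Y : 𝔤) :
    ContDiff ℝ 1 fun p : (EuclideanSpace ℝ (Fin l) × EuclideanSpace ℝ (Fin k)) × ℝ =>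
      S.flowCoord X Y p.1.1 p.1.2 p.2 := by
  have hv : CoordSmooth X fun p : (EuclideanSpace ℝ (Fin l) × EuclideanSpace ℝ (Fin k)) × ℝ =>
    expL X p.1.2 := CoordSmooth.expL contDiff_fst.snd
  exact ((CoordSmooth.expW contDiff_fst.fst).mul S (hv.mul S
    ((CoordSmooth.smul contDiff_snd (CoordSmooth.const Y)).mul S hv.neg))).contDiff_logW

theorem transCoord_self (v : EuclideanSpace ℝ (Fin k)) (w : EuclideanSpace ℝ (Fin l)) :
    S.transCoord X v w w = 0 := by
  simp [transCoord, logW_zero]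

theorem flowCoord_zero (Y : 𝔤) (x : EuclideanSpace ℝ (Fin l)) (v : EuclideanSpace ℝ (Fin k)) :
    S.flowCoord X Y x v 0 = x := by
  simp [flowCoord, conj, logW_expW]

/-- The infinitesimal generator of `flowCoord`. -/
def flowField (X : Module.Basis (Fin (k + l)) ℝ 𝔤) (Y : 𝔤) (x : EuclideanSpace ℝ (Fin l))
    (v : EuclideanSpace ℝ (Fin k)) : EuclideanSpace ℝ (Fin l) :=
  deriv (S.flowCoord X Y x v) 0

theorem hasDerivAt_flowCoord (Y : 𝔤) (x : EuclideanSpace ℝ (Fin l))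
    (v : EuclideanSpace ℝ (Fin k)) (τ : ℝ) :
    HasDerivAt (S.flowCoord X Y x v) (fderiv ℝ (fun p : (EuclideanSpace ℝ (Fin l) ×
      EuclideanSpace ℝ (Fin k)) × ℝ => S.flowCoord X Y p.1.1 p.1.2 p.2) ((x, v), τ) (0, 1)) τ := by
  have h1 := (((S.contDiff_flowCoord (X := X) Y).differentiable one_ne_zero)
    ((x, v), τ)).hasFDerivAt
  have h2 : HasDerivAt (fun τ : ℝ => ((x, v), τ)) ((0 : EuclideanSpace ℝ (Fin l) ×
    EuclideanSpace ℝ (Fin k)), (1 : ℝ)) τ := (hasDerivAt_const τ (x, v)).prodMk (hasDerivAt_id τ)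
  exact h1.comp_hasDerivAt τ h2

theorem continuous_flowField (Y : 𝔤) :
    Continuous fun p : EuclideanSpace ℝ (Fin l) × EuclideanSpace ℝ (Fin k) =>
      S.flowField X Y p.1 p.2 := by
  have h : ∀ p : EuclideanSpace ℝ (Fin l) × EuclideanSpace ℝ (Fin k), S.flowField X Y p.1 p.2 =
      fderiv ℝ (fun p : (EuclideanSpace ℝ (Fin l) × EuclideanSpace ℝ (Fin k)) × ℝ =>
        S.flowCoord X Y p.1.1 p.1.2 p.2) (p, 0) (0, 1) := fun p =>
    (S.hasDerivAt_flowCoord Y p.1 p.2 0).deriv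
  simp only [h]
  exact (((S.contDiff_flowCoord (X := X) Y).continuous_fderiv one_ne_zero).comp
    (by fun_prop)).clm_apply continuous_const

variable (hX : S.IsAdapted X) (hk : k ≤ S.rank)
include hX

theorem expW_dilCoord (c : ℝ) (y : EuclideanSpace ℝ (Fin l)) :
    expW X (S.dilCoord (k := k) c y) = S.dil c (expW X y) := by
  rw [← dilₗ_apply, expW, expW, map_sum]
  refine Finset.sum_congr rfl fun j _ => ?_
  rw [map_smul, dilₗ_apply, S.dil_of_mem c (S.basis_mem_layer hX (Fin.natAdd k j)), smul_smul,
    dilCoord_apply, mul_comm]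
  rfl

theorem logW_dil (c : ℝ) (g : 𝔤) : logW X (S.dil c g) = S.dilCoord (k := k) c (logW X g) := by
  ext j
  exact S.repr_dil hX c g (Fin.natAdd k j)

include hk

theorem expW_transCoord (v : EuclideanSpace ℝ (Fin k)) (w x : EuclideanSpace ℝ (Fin l)) :
    expW X (S.transCoord X v w x) =
      S.mul (-(expL X v)) (S.mul (-(expW X w)) (S.mul (expW X x) (expL X v))) := by
  refine expW_logW X ?_
  simp [S.logL_mul hX hk, logL_neg, logL_expL, logL_expW]

variable {Y : 𝔤}

theorem expW_flowCoord (hY : logL X Y = 0) (x : EuclideanSpace ℝ (Fin l))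
    (v : EuclideanSpace ℝ (Fin k)) (τ : ℝ) :
    expW X (S.flowCoord X Y x v τ) = S.mul (expW X x) (S.conj (expL X v) (τ • Y)) := by
  refine expW_logW X ?_
  rw [S.logL_mul hX hk, S.logL_conj hX hk, logL_expW, logL_smul, hY, smul_zero, zero_add]

/-- The factors `v` regroup as `v⁻¹ w⁻¹ (x u e^{τY} u⁻¹) v = (v⁻¹ w⁻¹ x v) (v⁻¹ u) e^{τY} (v⁻¹
u)⁻¹`. Left translation of the graph thus only shifts the parameter `u` to `u - v`. -/
theorem transCoord_flowCoord
    (hLm : ∀ u v, S.mul (expL X u) (expL X v) = expL X (u + v)) (hY : logL X Y = 0)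
    (v u : EuclideanSpace ℝ (Fin k)) (w x : EuclideanSpace ℝ (Fin l)) (τ : ℝ) :
    S.transCoord X v w (S.flowCoord X Y x u τ) =
      S.flowCoord X Y (S.transCoord X v w x) (u - v) τ := by
  have h1 : expL X (u - v) = S.mul (-(expL X v)) (expL X u) := by
    rw [← expL_neg, hLm, sub_eq_neg_add]
  rw [transCoord, S.expW_flowCoord hX hk hY, flowCoord, S.expW_transCoord hX hk, conj, conj, h1,
    S.neg_mul, neg_neg]
  simp only [S.mul_assoc, S.mul_neg_cancel_left]

theorem dilCoord_flowCoord {j : ℕ} (hY : Y ∈ S.layer j) (c : ℝ) (x : EuclideanSpace ℝ (Fin l))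
    (v : EuclideanSpace ℝ (Fin k)) (τ : ℝ) :
    S.dilCoord (k := k) c (S.flowCoord X Y x v τ) =
      S.flowCoord X Y (S.dilCoord (k := k) c x) (c • v) (c ^ j * τ) := by
  rw [flowCoord, flowCoord, ← S.logW_dil hX, conj, conj, S.dil_mul, S.dil_mul, S.dil_mul,
    S.dil_neg, S.dil_expL hX hk, S.expW_dilCoord hX,
    S.dil_of_mem c (Submodule.smul_mem _ _ hY), smul_smul]

/-- The dilation rescales the time of the flow by `c ^ j`. Differentiating at time zero gives the
homogeneity on which the scaling argument depends. -/
theorem dilCoord_flowField {j : ℕ} (hY : Y ∈ S.layer j) (c : ℝ)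
    (x : EuclideanSpace ℝ (Fin l)) (v : EuclideanSpace ℝ (Fin k)) :
    S.dilCoord (k := k) c (S.flowField X Y x v) =
      c ^ j • S.flowField X Y (S.dilCoord (k := k) c x) (c • v) := by
  have h1 : HasDerivAt (S.flowCoord X Y x v) (S.flowField X Y x v) 0 :=
    (S.hasDerivAt_flowCoord Y x v 0).differentiableAt.hasDerivAt
  have h2 := (S.dilCoord (k := k) c).hasFDerivAt.comp_hasDerivAt (0 : ℝ) h1
  have h3 : HasDerivAt (S.flowCoord X Y (S.dilCoord (k := k) c x) (c • v))
      (S.flowField X Y (S.dilCoord (k := k) c x) (c • v)) (c ^ j * 0) := by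
    rw [mul_zero]
    exact (S.hasDerivAt_flowCoord Y _ _ 0).differentiableAt.hasDerivAt
  have h4 := h3.scomp (0 : ℝ) (((hasDerivAt_id (0 : ℝ)).const_mul (c ^ j)))
  have h5 : (S.flowCoord X Y (S.dilCoord (k := k) c x) (c • v) ∘ HMul.hMul (c ^ j)) =
      (S.dilCoord (k := k) c) ∘ S.flowCoord X Y x v := by
    ext1 τ
    exact (S.dilCoord_flowCoord hX hk hY c x v τ).symm
  rw [h5, mul_one] at h4
  exact h2.unique h4

omit hk in
-- Every conjugate of `τ Y` stays in the ideal `fil 2`, so right multiplication by it leaves the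
-- first-layer coordinates of `x` unchanged.
theorem flowField_eq_zero (hY : Y ∈ S.fil 2) (x : EuclideanSpace ℝ (Fin l))
    (v : EuclideanSpace ℝ (Fin k)) {j : Fin l} (hj : S.deg (k + (j : ℕ)) = 1) :
    S.flowField X Y x v j = 0 := by
  have h : ∀ τ, S.flowCoord X Y x v τ j = x j := by
    intro τ
    have h1 : S.conj (expL X v) (τ • Y) ∈ S.fil 2 := by
      have h2 := Submodule.smul_mem _ τ hY
      have := add_mem (S.fil_anti (by omega) (S.conj_sub_mem_fil (v := expL X v) h2)) h2
      simpa using this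
    have h2 := add_mem (S.fil_anti (by omega) (S.mul_sub_add_mem_fil (x := expW X x) h1)) h1
    have h3 := (S.mem_fil_iff_repr hX 2 _).1 h2 (Fin.natAdd k j) (by simp [hj])
    have h4 := congrArg (fun y : EuclideanSpace ℝ (Fin l) => y j) (logW_expW X x)
    simp only [logW_apply] at h4
    simp only [sub_add_eq_sub_sub, sub_add_cancel, map_sub,
      Finsupp.sub_apply] at h3
    rw [h4, sub_eq_zero] at h3
    exact h3
  have h0 : HasDerivAt (S.flowCoord X Y x v) (S.flowField X Y x v) 0 :=
    (S.hasDerivAt_flowCoord Y x v 0).differentiableAt.hasDerivAt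
  have h1 : HasDerivAt (fun τ => S.flowCoord X Y x v τ j) (S.flowField X Y x v j) 0 :=
    (EuclideanSpace.proj (𝕜 := ℝ) j).hasFDerivAt.comp_hasDerivAt (0 : ℝ) h0
  simp only [h] at h1
  exact h1.unique (hasDerivAt_const _ _)

end Stratification

/-! ### Solutions of homogeneous differential equations -/

section Fencing

open Metric

variable {E F : Type*} [NormedAddCommGroup E] [NormedSpace ℝ E] [ProperSpace E]
  [NormedAddCommGroup F] [NormedSpace ℝ F] [ProperSpace F] {G : E → F → E}

omit [NormedSpace ℝ F] in
-- A fence argument: as long as `C t ≤ 1`, a curve touching the barrier `C t` lies in the unit ball,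
-- where its speed is strictly below `C`. The `+ 1` in the constant makes the inequality strict.
theorem exists_norm_le_of_hasDerivWithinAt (hG : Continuous fun p : E × F => G p.1 p.2) (R : ℝ) :
    ∃ C : ℝ, 0 < C ∧ ∀ T : ℝ, C * T ≤ 1 → ∀ (β : ℝ → E) (ψ : ℝ → F) (σ : ℝ), |σ| ≤ 1 →
      (∀ t ∈ Icc 0 T, HasDerivWithinAt β (σ • G (β t) (ψ t)) (Icc 0 T) t) → β 0 = 0 →
      (∀ t ∈ Icc 0 T, ‖ψ t‖ ≤ R) → ∀ t ∈ Icc 0 T, ‖β t‖ ≤ C * t := by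
  obtain ⟨C₀, hC₀⟩ := ((isCompact_closedBall (0 : E) 1).prod
    (isCompact_closedBall (0 : F) R)).exists_bound_of_continuousOn hG.continuousOn
  have hC : 0 < max C₀ 0 + 1 := by positivity
  refine ⟨max C₀ 0 + 1, hC, fun T hT β ψ σ hσ hβ h0 hψ t ht => ?_⟩
  refine image_norm_le_of_norm_deriv_right_lt_deriv_boundary' (a := 0) (b := T)
    (f' := fun t => σ • G (β t) (ψ t)) (B := fun t => (max C₀ 0 + 1) * t)
    (B' := fun _ => max C₀ 0 + 1)
    (fun t ht => (hβ t ht).continuousWithinAt) (fun t ht => ?_) (by simp [h0]) (by fun_prop)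
    (fun t _ => ?_) (fun t ht hBt => ?_) ht
  · exact (hβ t (Ico_subset_Icc_self ht)).mono_of_mem_nhdsWithin (Icc_mem_nhdsGE_of_mem ht)
  · simpa using ((hasDerivAt_id t).const_mul (max C₀ 0 + 1)).hasDerivWithinAt
  · have h1 : ‖β t‖ ≤ 1 := by
      rw [hBt]
      exact (mul_le_mul_of_nonneg_left ht.2.le hC.le).trans hT
    have h2 := hC₀ (β t, ψ t) ⟨by simpa using h1, by simpa using hψ t (Ico_subset_Icc_self ht)⟩
    calc ‖σ • G (β t) (ψ t)‖ = |σ| * ‖G (β t) (ψ t)‖ := by rw [norm_smul, Real.norm_eq_abs]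
      _ ≤ 1 * ‖G (β t) (ψ t)‖ := mul_le_mul_of_nonneg_right hσ (norm_nonneg _)
      _ ≤ C₀ := by simpa using h2
      _ < max C₀ 0 + 1 := (le_max_left _ _).trans_lt (lt_add_one _)

/-- The scaling argument behind the first claim. The order of quantifiers matters: `ε'` depends on
`ε` alone, because the radius `r` supplied by differentiability is known only after `ε'`. -/
theorem exists_holder_bound (hG : Continuous fun p : E × F => G p.1 p.2)
    {δ : ℝ → E →L[ℝ] E} (hδ : ∀ c c' y, δ c (δ c' y) = δ (c * c') y) (hδ1 : ∀ y, δ 1 y = y)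
    {n : ℕ} (hn : n ≠ 0) (hδG : ∀ c x v, δ c (G x v) = c ^ n • G (δ c x) (c • v))
    {ν : E → ℝ} (hν : Continuous ν) (hνδ : ∀ c, 0 < c → ∀ y, ν (δ c y) = c * ν y)
    {ε : ℝ} (hε : 0 < ε) :
    ∃ ε' : ℝ, 0 < ε' ∧ ∀ r : ℝ, 0 < r → ∀ M₀ : ℝ, ∃ ρ : ℝ, 0 < ρ ∧ ∀ T : ℝ, 0 < T → T ≤ ρ →
      ∀ (β : ℝ → E) (ψ : ℝ → F) (σ : ℝ), |σ| ≤ 1 →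
      (∀ t ∈ Icc 0 T, HasDerivWithinAt β (σ • G (β t) (ψ t)) (Icc 0 T) t) → β 0 = 0 →
      ContinuousOn ψ (Icc 0 T) → (∀ t ∈ Icc 0 T, ‖ψ t‖ ≤ M₀) →
      (∀ t ∈ Icc 0 T, ‖β t‖ < r → ‖ψ t‖ ≤ ε' * ν (β t)) →
      ‖ψ T‖ ≤ ε * T ^ (1 / (n : ℝ)) := by
  obtain ⟨C₁, hC₁, hfence⟩ := exists_norm_le_of_hasDerivWithinAt hG 1
  obtain ⟨C₃, hC₃⟩ := (isCompact_closedBall (0 : E) 1).exists_bound_of_continuousOn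
    hν.continuousOn
  set K := C₁ ^ (1 / (n : ℝ)) with hK
  have hK0 : 0 < K := by positivity
  set D := max C₃ 1 with hD
  have hD0 : 0 < D := by positivity
  -- The first bound allows half of the maximum of `‖ψ‖` to be absorbed; the second turns the
  -- remaining constant into `ε`.
  refine ⟨min (1 / (2 * D)) (ε / (2 * D * K)), by positivity, fun r hr M₀ => ?_⟩
  set ε' := min (1 / (2 * D)) (ε / (2 * D * K)) with hε'
  have hε'0 : 0 < ε' := by positivity
  have hε'1 : ε' * D ≤ 1 / 2 := by
    have : ε' ≤ 1 / (2 * D) := min_le_left _ _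
    calc ε' * D ≤ 1 / (2 * D) * D := mul_le_mul_of_nonneg_right this hD0.le
      _ = 1 / 2 := by field_simp
  have hε'2 : 2 * (ε' * D) * K ≤ ε := by
    have : ε' ≤ ε / (2 * D * K) := min_le_right _ _
    calc 2 * (ε' * D) * K = ε' * (2 * D * K) := by ring
      _ ≤ ε / (2 * D * K) * (2 * D * K) := mul_le_mul_of_nonneg_right this (by positivity)
      _ = ε := by field_simp
  obtain ⟨C₂, hC₂, hsmall⟩ := exists_norm_le_of_hasDerivWithinAt hG M₀
  -- With the crude bound `M₀` on `ψ`, this keeps `β` in the ball of radius `r`, where the estimate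
  -- by `ν` is available.
  refine ⟨min (1 / C₂) (r / (2 * C₂)), by positivity, ?_⟩
  intro T hT0 hTρ β ψ σ hσ hβ hβ0 hψc hψM hψβ
  have hT1 : C₂ * T ≤ 1 := by
    have := hTρ.trans (min_le_left _ _)
    rwa [le_div_iff₀ hC₂, mul_comm] at this
  have hT2 : C₂ * T < r := by
    have := hTρ.trans (min_le_right _ _)
    rw [le_div_iff₀ (by positivity)] at this
    linarith
  have hψβ' : ∀ t ∈ Icc 0 T, ‖ψ t‖ ≤ ε' * ν (β t) := fun t ht =>
    hψβ t ht ((hsmall T hT1 β ψ σ hσ hβ hβ0 hψM t ht).trans_lt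
      ((mul_le_mul_of_nonneg_left ht.2 hC₂.le).trans_lt hT2))
  obtain ⟨t₁, ht₁, hmax⟩ := isCompact_Icc.exists_isMaxOn (nonempty_Icc.2 hT0.le) hψc.norm
  set M := ‖ψ t₁‖ with hM
  have hMle : ∀ t ∈ Icc 0 T, ‖ψ t‖ ≤ M := fun t ht => hmax ht
  have hM0 : 0 ≤ M := norm_nonneg _
  set A := (C₁ * T) ^ (1 / (n : ℝ)) with hA
  have hA0 : 0 < A := by positivity
  have hAn : A ^ n = C₁ * T := by
    rw [hA, ← Real.rpow_natCast, ← Real.rpow_mul (by positivity), one_div,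
      inv_mul_cancel₀ (by positivity), Real.rpow_one]
  -- Dividing by `lam ≥ M` makes the rescaled `ψ` at most one, and `lam ^ n ≥ C₁ T` makes the
  -- rescaled time short enough for the fence. Adding `A > 0` covers the case `M = 0`.
  set lam := A + M with hlam
  have hlam0 : 0 < lam := by positivity
  have hlamn : C₁ * T ≤ lam ^ n := hAn ▸ pow_le_pow_left₀ hA0.le (by linarith) n
  have hlamp : 0 < lam ^ n := by positivity
  have hmaps : MapsTo (fun u => lam ^ n * u) (Icc 0 (T / lam ^ n)) (Icc 0 T) := fun u hu =>
    ⟨mul_nonneg hlamp.le hu.1, by simpa [mul_comm] using (le_div_iff₀ hlamp).1 hu.2⟩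
  have hscaled := hfence (T / lam ^ n) (by rw [← mul_div_assoc]; exact div_le_one_of_le₀ hlamn hlamp.le)
    (fun u => δ lam⁻¹ (β (lam ^ n * u))) (fun u => lam⁻¹ • ψ (lam ^ n * u)) σ hσ
    (fun u hu => by
      have h1 := (hβ _ (hmaps hu)).scomp u
        ((hasDerivAt_id u).const_mul (lam ^ n)).hasDerivWithinAt hmaps
      have h2 := (δ lam⁻¹).hasFDerivAt.comp_hasDerivWithinAt u h1
      convert h2 using 1
      · rfl
      rw [map_smul, map_smul, hδG, smul_smul, smul_smul, mul_one, inv_pow,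
        mul_right_comm, mul_inv_cancel₀ hlamp.ne', one_mul])
    (by simp [hβ0])
    (fun u hu => by
      rw [norm_smul, norm_inv, Real.norm_of_nonneg hlam0.le, inv_mul_le_iff₀ hlam0, mul_one]
      exact (hMle _ (hmaps hu)).trans (by linarith))
  have hνle : ∀ t ∈ Icc 0 T, ν (β t) ≤ lam * D := by
    intro t ht
    have hu : t / lam ^ n ∈ Icc 0 (T / lam ^ n) :=
      ⟨div_nonneg ht.1 hlamp.le, div_le_div_of_nonneg_right ht.2 hlamp.le⟩
    have h1 := hscaled _ hu
    simp only [mul_div_cancel₀ t hlamp.ne'] at h1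
    have h2 : C₁ * (t / lam ^ n) ≤ 1 := by
      rw [← mul_div_assoc]
      exact div_le_one_of_le₀ ((mul_le_mul_of_nonneg_left ht.2 hC₁.le).trans hlamn) hlamp.le
    have h3 := hC₃ (δ lam⁻¹ (β t)) (by simpa using h1.trans h2)
    have h4 : β t = δ lam (δ lam⁻¹ (β t)) := by rw [hδ, mul_inv_cancel₀ hlam0.ne', hδ1]
    rw [h4, hνδ lam hlam0]
    exact mul_le_mul_of_nonneg_left (((le_abs_self _).trans h3).trans (le_max_left _ _)) hlam0.le
  have hMfin : M ≤ ε' * (lam * D) :=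
    (hψβ' t₁ ht₁).trans (mul_le_mul_of_nonneg_left (hνle t₁ ht₁) hε'0.le)
  -- Absorption: the part `ε' D M` of `ε' D (A + M)` is at most `M / 2`.
  have h1 : M ≤ 2 * (ε' * D) * A := by
    have : ε' * D * M ≤ 1 / 2 * M := mul_le_mul_of_nonneg_right hε'1 hM0
    have h2 : ε' * (lam * D) = ε' * D * A + ε' * D * M := by rw [hlam]; ring
    linarith
  have hAK : A = K * T ^ (1 / (n : ℝ)) := Real.mul_rpow hC₁.le hT0.le
  calc ‖ψ T‖ ≤ M := hMle T (right_mem_Icc.2 hT0.le)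
    _ ≤ 2 * (ε' * D) * A := h1
    _ = 2 * (ε' * D) * K * T ^ (1 / (n : ℝ)) := by rw [hAK]; ring
    _ ≤ ε * T ^ (1 / (n : ℝ)) := mul_le_mul_of_nonneg_right hε'2 (by positivity)

end Fencing

open Filter Topology

/-! ### Uniform intrinsic differentiability as an estimate in coordinates -/

namespace Stratification

variable {𝔤 : Type*} [LieRing 𝔤] [LieAlgebra ℝ 𝔤] {s : ℕ} (S : Stratification 𝔤 s)
  {k l : ℕ} {X : Module.Basis (Fin (k + l)) ℝ 𝔤} (hX : S.IsAdapted X) (hk : k ≤ S.rank)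
  {W L : Set 𝔤} (hWL : S.IsComplementary W L)
  (hW : W = (Submodule.span ℝ (Set.range fun j : Fin l => X (Fin.natAdd k j)) : Set 𝔤))
  (hL : L = (Submodule.span ℝ (Set.range fun i : Fin k => X (Fin.castAdd l i)) : Set 𝔤))
  {U : Set 𝔤} {φ : 𝔤 → 𝔤}

/-- The size of the coordinates of degree one of a point of `W`. -/
def horNorm (k : ℕ) (y : EuclideanSpace ℝ (Fin l)) : ℝ :=
  ∑ j : Fin l, if S.deg (k + (j : ℕ)) = 1 then |y j| else 0

theorem horNorm_nonneg (y : EuclideanSpace ℝ (Fin l)) : 0 ≤ S.horNorm k y :=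
  Finset.sum_nonneg fun j _ => by split_ifs <;> positivity

theorem horNorm_le (y : EuclideanSpace ℝ (Fin l)) : S.horNorm k y ≤ l * ‖y‖ := by
  have h : ∀ j ∈ (Finset.univ : Finset (Fin l)),
      (if S.deg (k + (j : ℕ)) = 1 then |y j| else 0) ≤ ‖y‖ := by
    intro j _
    split_ifs
    · exact PiLp.norm_apply_le y j
    · exact norm_nonneg y
  simpa [horNorm] using Finset.sum_le_sum h

theorem continuous_horNorm : Continuous (S.horNorm (l := l) k) := by
  refine continuous_finsetSum _ fun j _ => ?_
  split_ifs <;> fun_prop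

theorem horNorm_eq_zero {y : EuclideanSpace ℝ (Fin l)}
    (h : ∀ j : Fin l, S.deg (k + (j : ℕ)) = 1 → y j = 0) : S.horNorm k y = 0 := by
  refine Finset.sum_eq_zero fun j _ => ?_
  split_ifs with hj
  · rw [h j hj, abs_zero]
  · rfl

theorem continuous_transCoord (v : EuclideanSpace ℝ (Fin k)) (w : EuclideanSpace ℝ (Fin l)) :
    Continuous (S.transCoord X v w) := by
  have h0 : Continuous fun x : EuclideanSpace ℝ (Fin l) => (v, w, x) :=
    continuous_const.prodMk (continuous_const.prodMk continuous_id)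
  have h := (S.contDiff_transCoord (X := X)).continuous.comp h0
  exact h

include hL in
theorem expL_coordFun (hφ : MapsTo φ U L) {x : EuclideanSpace ℝ (Fin l)} (hx : expW X x ∈ U) :
    expL X (coordFun X φ x) = φ (expW X x) := by
  have h := hφ hx
  rw [hL] at h
  exact expL_logL_of_mem X h

include hX hk

include hWL hW hL in
-- The `L`-component of `x · φ(x) · exp(tY)` is still `φ(x)`. Removing it on the right leaves `x`
-- times a conjugate of `exp(tY)`.
theorem projField_eq (hφ : MapsTo φ U L) {x : EuclideanSpace ℝ (Fin l)} (hx : expW X x ∈ U)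
    {Y : 𝔤} (hY : logL X Y = 0) :
    projField X S W L φ Y x = S.flowField X Y x (coordFun X φ x) := by
  rw [projField, flowField]
  congr 1
  ext1 τ
  rw [S.projW_eq hX hk hWL hW hL, flowCoord, conj, expL_coordFun hL hφ hx]
  congr 1
  rw [S.logL_mul hX hk, S.logL_mul hX hk, logL_expW, logL_smul, hY, smul_zero, zero_add, add_zero,
    ← coordFun, expL_coordFun hL hφ hx, S.mul_assoc, S.mul_assoc]

theorem exists_le_homNorm_expL [TopologicalSpace 𝔤] [IsTopologicalAddGroup 𝔤]
    [ContinuousSMul ℝ 𝔤] {N : 𝔤 → ℝ} (hN : S.IsHomNorm N) :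
    ∃ c : ℝ, 0 < c ∧ ∀ v : EuclideanSpace ℝ (Fin k), c * ‖v‖ ≤ N (expL X v) := by
  have hcont : Continuous fun v : EuclideanSpace ℝ (Fin k) => N (expL X v) := by
    refine hN.continuous.comp ?_
    unfold expL
    fun_prop
  have hpos : ∀ v ∈ Metric.sphere (0 : EuclideanSpace ℝ (Fin k)) 1, 0 < N (expL X v) := by
    intro v hv
    refine lt_of_le_of_ne (hN.nonneg _) fun h => ?_
    have h1 := (hN.eq_zero_iff _).1 h.symm
    have h2 := logL_expL X v
    rw [h1, logL_zero] at h2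
    rw [← h2] at hv
    simp at hv
  obtain ⟨c, hc, hcN⟩ : ∃ c : ℝ, 0 < c ∧
      ∀ v ∈ Metric.sphere (0 : EuclideanSpace ℝ (Fin k)) 1, c ≤ N (expL X v) := by
    -- The sphere is empty when `k = 0`.
    rcases (Metric.sphere (0 : EuclideanSpace ℝ (Fin k)) 1).eq_empty_or_nonempty with h | h
    · exact ⟨1, one_pos, fun v hv => by simp [h] at hv⟩
    · obtain ⟨v₀, hv₀, hmin⟩ := (isCompact_sphere _ _).exists_isMinOn h hcont.continuousOn
      exact ⟨_, hpos v₀ hv₀, fun v hv => hmin hv⟩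
  refine ⟨c, hc, fun v => ?_⟩
  rcases eq_or_ne v 0 with rfl | hv
  · simpa using hN.nonneg _
  · have hv0 : 0 < ‖v‖ := norm_pos_iff.2 hv
    have h1 := hcN (‖v‖⁻¹ • v) (by simp [norm_smul, hv0.ne'])
    have h2 : expL X v = S.dil ‖v‖ (expL X (‖v‖⁻¹ • v)) := by
      rw [S.dil_expL hX hk, smul_smul, mul_inv_cancel₀ hv0.ne', one_smul]
    rw [h2, hN.dil _ hv0, mul_comm]
    exact mul_le_mul_of_nonneg_left h1 hv0.le

include hWL hW hL

/-- Uniform intrinsic differentiability in exponential coordinates. -/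
theorem UIDAt.exists_bound [TopologicalSpace 𝔤] [IsTopologicalAddGroup 𝔤]
    [ContinuousSMul ℝ 𝔤] {N : 𝔤 → ℝ} (hN : S.IsHomNorm N) {d : 𝔤 → 𝔤 → ℝ}
    (hφ : MapsTo φ U L) {a₀ : 𝔤} (h : S.UIDAt N d W L U φ a₀) :
    ∃ C : ℝ, 0 ≤ C ∧ ∀ ε : ℝ, 0 < ε → ∃ r : ℝ, 0 < r ∧
      ∀ x x' : EuclideanSpace ℝ (Fin l), expW X x ∈ U → d a₀ (expW X x) < r → expW X x' ∈ U →
        d 0 (expW X (S.transCoord X (coordFun X φ x) x x')) < r →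
        ‖coordFun X φ x' - coordFun X φ x‖ ≤
          C * S.horNorm k (S.transCoord X (coordFun X φ x) x x') +
          ε * N (expW X (S.transCoord X (coordFun X φ x) x x')) := by
  obtain ⟨ℓ, hℓ, hlim⟩ := h
  obtain ⟨C, hC, hbound⟩ := S.intrinsicallyLinear_bound hX hk hWL hW hL hℓ
  obtain ⟨c, hc, hcN⟩ := S.exists_le_homNorm_expL hX hk hN
  refine ⟨C, hC, fun ε hε => ?_⟩
  -- The factor `c` compensates for passing from the homogeneous norm on `L` to the Euclidean norm.
  obtain ⟨r, hr, hlim⟩ := hlim (c * ε) (by positivity)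
  refine ⟨r, hr, fun x x' hx hxr hx' hbr => ?_⟩
  set y := S.transCoord X (coordFun X φ x) x x' with hy
  have hyb : expW X y = S.mul (-(φ (expW X x))) (S.mul (-(expW X x))
      (S.mul (expW X x') (φ (expW X x)))) := by
    rw [hy, S.expW_transCoord hX hk, expL_coordFun hL hφ hx]
  have hmulb : S.mul (S.mul (expW X x) (φ (expW X x))) (expW X y) =
      S.mul (expW X x') (φ (expW X x)) := by
    rw [hyb, S.mul_assoc, S.mul_neg_cancel_left, S.mul_neg_cancel_left]
  have hq : S.mul (-(S.mul (-(φ (expW X x))) (-(expW X x)))) (expW X y) =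
      S.mul (expW X x') (φ (expW X x)) := by
    rw [S.neg_mul, neg_neg, neg_neg, hmulb]
  have hlogL : logL X (S.mul (expW X x') (φ (expW X x))) = coordFun X φ x := by
    rw [S.logL_mul hX hk, logL_expW, zero_add, coordFun]
  have hprojW : S.projW W L (S.mul (expW X x') (φ (expW X x))) = expW X x' := by
    rw [S.projW_eq hX hk hWL hW hL, hlogL, expL_coordFun hL hφ hx, S.mul_assoc,
      S.mul_neg_self, S.mul_zero]
  have hyW : expW X y ∈ W := (mem_W_iff hW).2 (logL_expW X y)
  have hdom : expW X y ∈ S.transDom W L U (S.mul (-(φ (expW X x))) (-(expW X x))) :=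
    ⟨hyW, by rwa [hq, hprojW]⟩
  have hLm := S.expL_mul_expL hX hk hWL hL
  have htrans : S.mul (-(ℓ (expW X y))) (S.trans W L φ (S.mul (-(φ (expW X x))) (-(expW X x)))
      (expW X y)) =
      expL X (coordFun X φ x' - coordFun X φ x - logL X (ℓ (expW X y))) := by
    have h1 := hℓ.1 hyW
    rw [hL] at h1
    rw [trans, hq, hprojW, S.projL_eq hX hk hWL hW hL, hlogL, ← expL_coordFun hL hφ hx',
      ← expL_logL_of_mem X h1, logL_expL, ← expL_neg, ← expL_neg, hLm, hLm]
    congr 1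
    abel
  -- The quotient in the definition excludes `y = 0`. In that case the two points coincide and the
  -- left side is zero.
  rcases eq_or_ne (expW X y) 0 with hy0 | hy0
  · have h1 : expW X x' = expW X x := by
      rw [hy0, S.mul_zero] at hmulb
      have h2 := congrArg (fun g => S.mul g (-(φ (expW X x)))) hmulb
      simpa [S.mul_assoc] using h2.symm
    have h2 : coordFun X φ x' = coordFun X φ x := by rw [coordFun, h1, coordFun]
    rw [h2, sub_self, norm_zero]
    exact add_nonneg (mul_nonneg hC (S.horNorm_nonneg _)) (mul_nonneg hε.le (hN.nonneg _))
  · have hNpos : 0 < N (expW X y) :=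
      lt_of_le_of_ne (hN.nonneg _) fun h => hy0 ((hN.eq_zero_iff _).1 h.symm)
    have h1 := hlim _ hx hxr _ hdom hbr hy0
    rw [div_le_iff₀ hNpos, htrans] at h1
    have h2 := (hcN _).trans h1
    rw [_root_.mul_assoc] at h2
    have h3 := le_of_mul_le_mul_left h2 hc
    have h4 := hbound y
    calc ‖coordFun X φ x' - coordFun X φ x‖
        = ‖logL X (ℓ (expW X y)) +
            (coordFun X φ x' - coordFun X φ x - logL X (ℓ (expW X y)))‖ := by
          congr 1
          abel
      _ ≤ _ := (norm_add_le _ _).trans (add_le_add h4 h3)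

variable [TopologicalSpace 𝔤] [IsTopologicalAddGroup 𝔤] [ContinuousSMul ℝ 𝔤] {N : 𝔤 → ℝ}
  (hN : S.IsHomNorm N) {d : 𝔤 → 𝔤 → ℝ} (hd : S.IsHomDist d) (hφ : MapsTo φ U L)
  (hUID : S.UID N d W L U φ)
include hN hd hφ hUID

/-- Each centre has its own differential, and its constant serves a whole neighbourhood of base
points. Finitely many neighbourhoods cover `K`; the largest constant and the smallest radius are
kept. -/
theorem UID.exists_bound_of_isCompact {K : Set (EuclideanSpace ℝ (Fin l))} (hK : IsCompact K)
    (hKU : ∀ x ∈ K, expW X x ∈ U) {ε : ℝ} (hε : 0 < ε) :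
    ∃ C : ℝ, 0 ≤ C ∧ ∃ r : ℝ, 0 < r ∧
      ∀ x ∈ K, ∀ x' : EuclideanSpace ℝ (Fin l), expW X x' ∈ U →
        ‖S.transCoord X (coordFun X φ x) x x'‖ < r →
        ‖coordFun X φ x' - coordFun X φ x‖ ≤
          C * S.horNorm k (S.transCoord X (coordFun X φ x) x x') +
          ε * N (expW X (S.transCoord X (coordFun X φ x) x x')) := by
  have hcW : Continuous (expW X) := by
    unfold expW
    fun_prop
  refine hK.induction_on (p := fun K => ∃ C : ℝ, 0 ≤ C ∧ ∃ r : ℝ, 0 < r ∧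
      ∀ x ∈ K, ∀ x' : EuclideanSpace ℝ (Fin l), expW X x' ∈ U →
        ‖S.transCoord X (coordFun X φ x) x x'‖ < r →
        ‖coordFun X φ x' - coordFun X φ x‖ ≤
          C * S.horNorm k (S.transCoord X (coordFun X φ x) x x') +
          ε * N (expW X (S.transCoord X (coordFun X φ x) x x'))) ?_ ?_ ?_ ?_
  · exact ⟨0, le_rfl, 1, one_pos, fun x hx => absurd hx (notMem_empty x)⟩
  · rintro A B hAB ⟨C, hC, r, hr, h⟩
    exact ⟨C, hC, r, hr, fun x hx => h x (hAB hx)⟩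
  · rintro A B ⟨C, hC, r, hr, h⟩ ⟨C', hC', r', hr', h'⟩
    refine ⟨max C C', le_max_of_le_left hC, min r r', lt_min hr hr', fun x hx x' hx' hy => ?_⟩
    rcases hx with hx | hx
    · refine (h x hx x' hx' (hy.trans_le (min_le_left _ _))).trans ?_
      gcongr
      · exact S.horNorm_nonneg _
      · exact le_max_left _ _
    · refine (h' x hx x' hx' (hy.trans_le (min_le_right _ _))).trans ?_
      gcongr
      · exact S.horNorm_nonneg _
      · exact le_max_right _ _
  · intro x₀ hx₀
    obtain ⟨C, hC, h⟩ := UIDAt.exists_bound S hX hk hWL hW hL hN hφ (hUID _ (hKU x₀ hx₀))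
    obtain ⟨r, hr, h⟩ := h ε hε
    have hopen : ∀ {a : 𝔤} {x : EuclideanSpace ℝ (Fin l)}, a = expW X x →
        ∀ᶠ y in 𝓝 x, d a (expW X y) < r := by
      rintro a x rfl
      have hc : Continuous fun y => d (expW X x) (expW X y) :=
        hd.continuous.comp (continuous_const.prodMk hcW)
      refine hc.continuousAt.eventually_lt continuousAt_const ?_
      rw [(hd.eq_zero_iff _ _).2 rfl]
      exact hr
    obtain ⟨r', hr', hball⟩ := Metric.eventually_nhds_iff.1 (hopen (expW_zero X).symm)
    refine ⟨K ∩ {x | d (expW X x₀) (expW X x) < r},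
      inter_mem self_mem_nhdsWithin (mem_nhdsWithin_of_mem_nhds (hopen rfl)), C, hC, r', hr',
      fun x hx x' hx' hy => ?_⟩
    exact h x x' (hKU x hx.1) hx.2 hx' (hball (by simpa using hy))

theorem UID.continuousOn_coordFun : ContinuousOn (coordFun X φ) (expW X ⁻¹' U) := by
  intro x hx
  have hcW : Continuous (expW X) := by
    unfold expW
    fun_prop
  obtain ⟨C, hC, r, hr, h⟩ := UID.exists_bound_of_isCompact S hX hk hWL hW hL hN hd hφ hUID
    (isCompact_singleton (x := x)) (by simpa using hx) one_pos
  have hQ : Continuous (S.transCoord X (coordFun X φ x) x) := S.continuous_transCoord _ _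
  have hQ0 : S.transCoord X (coordFun X φ x) x x = 0 := S.transCoord_self _ _
  replace h := h x rfl
  generalize S.transCoord X (coordFun X φ x) x = Q at *
  have hlim : Tendsto (fun x' => C * S.horNorm k (Q x') + 1 * N (expW X (Q x')))
      (𝓝[expW X ⁻¹' U] x) (𝓝 0) := by
    have hc : Continuous fun x' => C * S.horNorm k (Q x') + 1 * N (expW X (Q x')) :=
      ((S.continuous_horNorm.comp hQ).const_mul _).add
        (((hN.continuous.comp hcW).comp hQ).const_mul _)
    have h0 : C * S.horNorm k (Q x) + 1 * N (expW X (Q x)) = 0 := by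
      rw [hQ0, expW_zero, (hN.eq_zero_iff 0).2 rfl, S.horNorm_eq_zero (fun j _ => rfl)]
      ring
    exact (hc.tendsto' x 0 h0).mono_left nhdsWithin_le_nhds
  have hsmall : ∀ᶠ x' in 𝓝[expW X ⁻¹' U] x, ‖Q x'‖ < r := by
    refine mem_nhdsWithin_of_mem_nhds ?_
    refine (hQ.norm.continuousAt (x := x)).eventually_lt continuousAt_const ?_
    rwa [hQ0, norm_zero]
  rw [ContinuousWithinAt, tendsto_iff_norm_sub_tendsto_zero]
  refine squeeze_zero' (Eventually.of_forall fun _ => norm_nonneg _) ?_ hlim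
  filter_upwards [hsmall, self_mem_nhdsWithin] with x' hx'r hx'
  exact h x' hx' hx'r

end Stratification

/-! ### Little Hölder continuity along projected vector fields -/

namespace Stratification

variable {𝔤 : Type*} [LieRing 𝔤] [LieAlgebra ℝ 𝔤] {s : ℕ} (S : Stratification 𝔤 s)
  {k l : ℕ} {X : Module.Basis (Fin (k + l)) ℝ 𝔤} (hX : S.IsAdapted X) (hk : k ≤ S.rank)
  {W L : Set 𝔤} (hWL : S.IsComplementary W L)
  (hW : W = (Submodule.span ℝ (Set.range fun j : Fin l => X (Fin.natAdd k j)) : Set 𝔤))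
  (hL : L = (Submodule.span ℝ (Set.range fun i : Fin k => X (Fin.castAdd l i)) : Set 𝔤))
  {U : Set 𝔤} {φ : 𝔤 → 𝔤}
include hX hk

/-- The equivariance `transCoord_flowCoord`, differentiated at time zero, shows that the
differential of the translation intertwines the two fields. The chain rule along `γ` then applies.
-/
theorem hasDerivWithinAt_transCoord (hLm : ∀ u v, S.mul (expL X u) (expL X v) = expL X (u + v))
    {Y : 𝔤} (hY : logL X Y = 0) (v u : EuclideanSpace ℝ (Fin k)) (w : EuclideanSpace ℝ (Fin l))
    {γ : ℝ → EuclideanSpace ℝ (Fin l)} {I : Set ℝ} {t σ : ℝ}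
    (hγ : HasDerivWithinAt γ (σ • S.flowField X Y (γ t) u) I t) :
    HasDerivWithinAt (fun t => S.transCoord X v w (γ t))
      (σ • S.flowField X Y (S.transCoord X v w (γ t)) (u - v)) I t := by
  have hd : DifferentiableAt ℝ (S.transCoord X v w) (γ t) := by
    have h0 : ContDiff ℝ 1 fun x : EuclideanSpace ℝ (Fin l) => (v, w, x) :=
      contDiff_const.prodMk (contDiff_const.prodMk contDiff_id)
    have h := (S.contDiff_transCoord (X := X)).comp h0
    exact h.differentiable one_ne_zero (γ t)
  have h1 : HasDerivAt (S.flowCoord X Y (γ t) u) (S.flowField X Y (γ t) u) 0 :=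
    (S.hasDerivAt_flowCoord Y (γ t) u 0).differentiableAt.hasDerivAt
  have h2 : HasDerivAt (S.flowCoord X Y (S.transCoord X v w (γ t)) (u - v))
      (S.flowField X Y (S.transCoord X v w (γ t)) (u - v)) 0 :=
    (S.hasDerivAt_flowCoord Y _ (u - v) 0).differentiableAt.hasDerivAt
  have h3 := HasFDerivAt.comp_hasDerivAt_of_eq (0 : ℝ) hd.hasFDerivAt h1
    (S.flowCoord_zero Y (γ t) u).symm
  have h4 : S.transCoord X v w ∘ S.flowCoord X Y (γ t) u =
      S.flowCoord X Y (S.transCoord X v w (γ t)) (u - v) :=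
    funext fun τ => S.transCoord_flowCoord hX hk hLm hY v u w (γ t) τ
  rw [h4] at h3
  rw [h2.unique h3, ← map_smul]
  exact hd.hasFDerivAt.comp_hasDerivWithinAt t hγ

omit hk in
theorem horNorm_eq_zero_of_hasDerivWithinAt {Y : 𝔤} (hY : Y ∈ S.fil 2)
    {β : ℝ → EuclideanSpace ℝ (Fin l)} {ψ : ℝ → EuclideanSpace ℝ (Fin k)} {T σ : ℝ}
    (hβ : ∀ t ∈ Icc 0 T, HasDerivWithinAt β (σ • S.flowField X Y (β t) (ψ t)) (Icc 0 T) t)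
    (hβ0 : β 0 = 0) : ∀ t ∈ Icc 0 T, S.horNorm k (β t) = 0 := by
  intro t ht
  refine S.horNorm_eq_zero fun j hj => ?_
  have hder : ∀ t ∈ Icc 0 T, HasDerivWithinAt (fun t => β t j) 0 (Icc 0 T) t := by
    intro t ht
    have h := (EuclideanSpace.proj (𝕜 := ℝ) j).hasFDerivAt.comp_hasDerivWithinAt t (hβ t ht)
    rw [map_smul] at h
    simpa [S.flowField_eq_zero hX hY _ _ hj, Function.comp_def] using h
  have h := constant_of_has_deriv_right_zero (f := fun t => β t j) (a := 0) (b := T)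
    (fun t ht => (hder t ht).continuousWithinAt)
    (fun t ht => (hder t (Ico_subset_Icc_self ht)).mono_of_mem_nhdsWithin
      (Icc_mem_nhdsGE_of_mem ht)) t ht
  simpa [hβ0] using h

variable [TopologicalSpace 𝔤] [IsTopologicalAddGroup 𝔤] [ContinuousSMul ℝ 𝔤] {N : 𝔤 → ℝ}
  (hN : S.IsHomNorm N) {d : 𝔤 → 𝔤 → ℝ} (hd : S.IsHomDist d) (hφ : MapsTo φ U L)
  (hUID : S.UID N d W L U φ)
include hWL hW hL hN hd hφ hUID

theorem UID.exists_holder_bound_of_isCompact {K : Set (EuclideanSpace ℝ (Fin l))}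
    (hK : IsCompact K) (hKU : ∀ x ∈ K, expW X x ∈ U) (j : Fin l) (hj : S.rank ≤ k + (j : ℕ))
    {ε : ℝ} (hε : 0 < ε) :
    ∃ ρ : ℝ, 0 < ρ ∧ ∀ T : ℝ, 0 < T → T ≤ ρ →
      ∀ (γ : ℝ → EuclideanSpace ℝ (Fin l)) (σ : ℝ), |σ| ≤ 1 → (∀ t ∈ Icc 0 T, γ t ∈ K) →
      (∀ t ∈ Icc 0 T, HasDerivWithinAt γ
        (σ • projField X S W L φ (X (Fin.natAdd k j)) (γ t)) (Icc 0 T) t) →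
      ‖coordFun X φ (γ T) - coordFun X φ (γ 0)‖ ≤ ε * T ^ (1 / (S.deg (k + (j : ℕ)) : ℝ)) := by
  have hcW : Continuous (expW X) := by
    unfold expW
    fun_prop
  have hLm := S.expL_mul_expL hX hk hWL hL
  have hfc : ContinuousOn (coordFun X φ) (expW X ⁻¹' U) :=
    UID.continuousOn_coordFun S hX hk hWL hW hL hN hd hφ hUID
  obtain ⟨M, hM⟩ := hK.exists_bound_of_continuousOn (hfc.mono hKU)
  have hdeg := (S.deg_mem_Icc hX (Fin.natAdd k j)).1
  have hdeg1 : S.deg (k + (j : ℕ)) ≠ 1 := fun h => by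
    have := (S.deg_eq_one_iff _).1 h
    omega
  rw [Fin.val_natAdd] at hdeg
  have hYmem : X (Fin.natAdd k j) ∈ S.layer (S.deg (k + (j : ℕ))) :=
    S.basis_mem_layer hX (Fin.natAdd k j)
  have hYfil : X (Fin.natAdd k j) ∈ S.fil 2 := S.layer_le_fil (by omega) hYmem
  have hYL : logL X (X (Fin.natAdd k j)) = 0 := (mem_W_iff hW).1 <| by
    rw [hW]
    exact Submodule.subset_span ⟨j, rfl⟩
  -- The homogeneous function `ν` is the homogeneous norm read in coordinates.
  obtain ⟨ε', hε', hhol⟩ := exists_holder_bound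
    (S.continuous_flowField (X := X) (X (Fin.natAdd k j))) (δ := S.dilCoord (k := k))
    S.dilCoord_dilCoord S.dilCoord_one (n := S.deg (k + (j : ℕ))) (by omega)
    (S.dilCoord_flowField hX hk hYmem) (hN.continuous.comp hcW)
    (fun c hc y => by
      rw [Function.comp_apply, S.expW_dilCoord hX, hN.dil c hc, Function.comp_apply]) hε
  obtain ⟨C, hC, r, hr, hbound⟩ :=
    UID.exists_bound_of_isCompact S hX hk hWL hW hL hN hd hφ hUID hK hKU hε'
  obtain ⟨ρ, hρ, hhol⟩ := hhol r hr (2 * M)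
  refine ⟨ρ, hρ, fun T hT hTρ γ σ hσ hγK hγ => ?_⟩
  have h0 : (0 : ℝ) ∈ Icc 0 T := ⟨le_rfl, hT.le⟩
  have hβ : ∀ t ∈ Icc 0 T, HasDerivWithinAt
      (fun t => S.transCoord X (coordFun X φ (γ 0)) (γ 0) (γ t))
      (σ • S.flowField X (X (Fin.natAdd k j))
        (S.transCoord X (coordFun X φ (γ 0)) (γ 0) (γ t))
        (coordFun X φ (γ t) - coordFun X φ (γ 0))) (Icc 0 T) t := by
    intro t ht
    refine S.hasDerivWithinAt_transCoord hX hk hLm hYL _ _ _ ?_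
    rw [← S.projField_eq hX hk hWL hW hL hφ (hKU _ (hγK t ht)) hYL]
    exact hγ t ht
  have hβ0 : S.transCoord X (coordFun X φ (γ 0)) (γ 0) (γ 0) = 0 := S.transCoord_self _ _
  refine hhol T hT hTρ (fun t => S.transCoord X (coordFun X φ (γ 0)) (γ 0) (γ t))
    (fun t => coordFun X φ (γ t) - coordFun X φ (γ 0)) σ hσ hβ hβ0 ?_ ?_ ?_
  · exact (hfc.comp (fun t ht => (hγ t ht).continuousWithinAt)
      fun t ht => hKU _ (hγK t ht)).sub continuousOn_const
  · intro t ht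
    have h1 := hM _ (hγK t ht)
    have h2 := hM _ (hγK 0 h0)
    exact (norm_sub_le _ _).trans (by linarith)
  · intro t ht htr
    have h1 := hbound _ (hγK 0 h0) (γ t) (hKU _ (hγK t ht)) htr
    -- The constant `C` of the differential may be large, but it multiplies a horizontal size that
    -- vanishes along the whole curve.
    rw [S.horNorm_eq_zero_of_hasDerivWithinAt hX hYfil hβ hβ0 t ht, MulZeroClass.mul_zero,
      zero_add] at h1
    exact h1

theorem UID.exists_littleHolder_bound_along_projField [T2Space 𝔤] (hUW : U ⊆ W) {V : Set 𝔤}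
    (hV : IsCompact (closure V)) (hVU : closure V ⊆ U) {ε : ℝ} (hε : 0 < ε) :
    ∃ ρ : ℝ, 0 < ρ ∧ ∀ j : Fin l, S.rank ≤ k + (j : ℕ) →
      ∀ (I : Set ℝ) (γ : ℝ → EuclideanSpace ℝ (Fin l)), I.OrdConnected →
        (∀ t ∈ I, expW X (γ t) ∈ V) →
        (∀ t ∈ I, HasDerivWithinAt γ
          (projField X S W L φ (X (Fin.natAdd k j)) (γ t)) I t) →
        ∀ t ∈ I, ∀ t' ∈ I, 0 < |t - t'| → |t - t'| ≤ ρ →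
          ‖coordFun X φ (γ t) - coordFun X φ (γ t')‖ /
            |t - t'| ^ (1 / (S.deg (k + (j : ℕ)) : ℝ)) ≤ ε := by
  have hfin : FiniteDimensional ℝ 𝔤 := X.finiteDimensional_of_finite
  have hclog : Continuous (logW X) := by
    refine (PiLp.continuous_toLp 2 _).comp (continuous_pi fun j => ?_)
    exact LinearMap.continuous_of_finiteDimensional (X.coord (Fin.natAdd k j))
  have hK : IsCompact (logW X '' closure V) := hV.image hclog
  have hKU : ∀ x ∈ logW X '' closure V, expW X x ∈ U := by
    rintro _ ⟨g, hg, rfl⟩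
    rw [expW_logW X ((mem_W_iff hW).1 (hUW (hVU hg)))]
    exact hVU hg
  have hex : ∀ j : Fin l, ∃ ρ : ℝ, 0 < ρ ∧ (S.rank ≤ k + (j : ℕ) → ∀ T : ℝ, 0 < T → T ≤ ρ →
      ∀ (γ : ℝ → EuclideanSpace ℝ (Fin l)) (σ : ℝ), |σ| ≤ 1 →
      (∀ t ∈ Icc 0 T, γ t ∈ logW X '' closure V) →
      (∀ t ∈ Icc 0 T, HasDerivWithinAt γ
        (σ • projField X S W L φ (X (Fin.natAdd k j)) (γ t)) (Icc 0 T) t) →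
      ‖coordFun X φ (γ T) - coordFun X φ (γ 0)‖ ≤
        ε * T ^ (1 / (S.deg (k + (j : ℕ)) : ℝ))) := by
    intro j
    by_cases hj : S.rank ≤ k + (j : ℕ)
    · obtain ⟨ρ, hρ, h⟩ := UID.exists_holder_bound_of_isCompact S hX hk hWL hW hL hN hd hφ hUID
        hK hKU j hj hε
      exact ⟨ρ, hρ, fun _ => h⟩
    · exact ⟨1, one_pos, fun h => absurd h hj⟩
  choose ρ hρ hbound using hex
  obtain ⟨ρ₀, hρ₀, hle⟩ : ∃ ρ₀ : ℝ, 0 < ρ₀ ∧ ∀ j, ρ₀ ≤ ρ j := by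
    rcases isEmpty_or_nonempty (Fin l) with h | h
    · exact ⟨1, one_pos, fun j => h.elim j⟩
    · obtain ⟨j₀, hj₀⟩ := Finite.exists_min ρ
      exact ⟨ρ j₀, hρ j₀, hj₀⟩
  refine ⟨ρ₀, hρ₀, fun j hj I γ hI hγV hγ t ht t' ht' hpos htρ => ?_⟩
  set T := |t - t'| with hT
  -- The sign `σ` lets one estimate on `[0, T]` serve both orders of `t` and `t'`.
  obtain ⟨σ, hσ, hσT⟩ : ∃ σ : ℝ, |σ| ≤ 1 ∧ t' + σ * T = t := by
    rcases abs_cases (t - t') with ⟨h, _⟩ | ⟨h, _⟩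
    · exact ⟨1, by simp, by rw [hT, h]; ring⟩
    · exact ⟨-1, by simp, by rw [hT, h]; ring⟩
  have hmaps : MapsTo (fun τ => t' + σ * τ) (Icc 0 T) I := by
    intro τ hτ
    have hu : τ / T ∈ Icc (0 : ℝ) 1 := ⟨div_nonneg hτ.1 hpos.le, div_le_one_of_le₀ hτ.2 hpos.le⟩
    refine (Set.OrdConnected.convex (𝕜 := ℝ) hI).segment_subset ht' ht ?_
    rw [segment_eq_image']
    refine ⟨τ / T, hu, ?_⟩
    simp only [smul_eq_mul]
    rw [← hσT]
    field_simp
    ring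
  have h := hbound j hj T hpos (htρ.trans (hle j)) (fun τ => γ (t' + σ * τ)) σ hσ
    (fun τ hτ => ⟨_, subset_closure (hγV _ (hmaps hτ)), logW_expW X _⟩) (fun τ hτ => by
      have h1 : HasDerivWithinAt (fun τ => t' + σ * τ) σ (Icc 0 T) τ := by
        simpa using (((hasDerivAt_id τ).const_mul σ).const_add t').hasDerivWithinAt
      exact (hγ _ (hmaps hτ)).scomp τ h1 hmaps)
  simp only [hσT, MulZeroClass.mul_zero, add_zero] at h
  rwa [div_le_iff₀ (by positivity)]

end Stratification

/-! ### Little Hölder continuity for the Euclidean distance -/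

namespace Stratification

variable {𝔤 : Type*} [LieRing 𝔤] [LieAlgebra ℝ 𝔤] {s : ℕ} (S : Stratification 𝔤 s)
  {k l : ℕ} {X : Module.Basis (Fin (k + l)) ℝ 𝔤} (hX : S.IsAdapted X) (hk : k ≤ S.rank)
  {W L : Set 𝔤} (hWL : S.IsComplementary W L)
  (hW : W = (Submodule.span ℝ (Set.range fun j : Fin l => X (Fin.natAdd k j)) : Set 𝔤))
  (hL : L = (Submodule.span ℝ (Set.range fun i : Fin k => X (Fin.castAdd l i)) : Set 𝔤))
  {U : Set 𝔤} {φ : 𝔤 → 𝔤}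

/-- The translated coordinates are jointly `C¹`, hence Lipschitz on compact sets, and vanish on the
diagonal. -/
theorem exists_norm_transCoord_le {K : Set (EuclideanSpace ℝ (Fin l))} (hK : IsCompact K)
    {f : EuclideanSpace ℝ (Fin l) → EuclideanSpace ℝ (Fin k)} (hf : ContinuousOn f K) :
    ∃ C : ℝ, 0 < C ∧ ∀ x ∈ K, ∀ x' ∈ K, ‖S.transCoord X (f x) x x'‖ ≤ C * dist x' x := by
  obtain ⟨C, hC⟩ := (S.contDiff_transCoord (X := X)).locallyLipschitz.locallyLipschitzOn
    |>.exists_lipschitzOnWith_of_compact ((hK.image_of_continuousOn hf).prod (hK.prod hK))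
  refine ⟨C + 1, by positivity, fun x hx x' hx' => ?_⟩
  have h := hC.dist_le_mul (f x, x, x') ⟨⟨x, hx, rfl⟩, hx, hx'⟩ (f x, x, x) ⟨⟨x, hx, rfl⟩, hx, hx⟩
  rw [S.transCoord_self, dist_zero_right, Prod.dist_eq, Prod.dist_eq] at h
  simp only [dist_self, dist_nonneg, sup_of_le_right] at h
  exact h.trans (mul_le_mul_of_nonneg_right (by simp) dist_nonneg)

include hX

theorem exists_homNorm_expW_le [TopologicalSpace 𝔤] [IsTopologicalAddGroup 𝔤]
    [ContinuousSMul ℝ 𝔤] {N : 𝔤 → ℝ} (hN : S.IsHomNorm N) (hs : s ≠ 0) :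
    ∃ C : ℝ, 0 < C ∧ ∀ y : EuclideanSpace ℝ (Fin l), ‖y‖ ≤ 1 →
      N (expW X y) ≤ C * ‖y‖ ^ (1 / (s : ℝ)) := by
  have hcont : Continuous fun y : EuclideanSpace ℝ (Fin l) => N (expW X y) := by
    refine hN.continuous.comp ?_
    unfold expW
    fun_prop
  obtain ⟨C, hC⟩ := (isCompact_closedBall (0 : EuclideanSpace ℝ (Fin l)) 1).exists_bound_of_continuousOn
    hcont.continuousOn
  refine ⟨max C 1, by positivity, fun y hy => ?_⟩
  rcases eq_or_ne y 0 with rfl | hy0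
  · rw [expW_zero, (hN.eq_zero_iff 0).2 rfl]
    positivity
  have hpos : 0 < ‖y‖ := norm_pos_iff.2 hy0
  set c := ‖y‖ ^ (1 / (s : ℝ)) with hc
  have hc0 : 0 < c := by positivity
  have hc1 : c ≤ 1 := Real.rpow_le_one hpos.le hy (by positivity)
  have hcs : c ^ s = ‖y‖ := by
    rw [hc, ← Real.rpow_natCast, ← Real.rpow_mul hpos.le, one_div,
      inv_mul_cancel₀ (by positivity), Real.rpow_one]
  -- Since `c ≤ 1` and no degree exceeds `s`, each coordinate is multiplied by at most `c⁻ˢ = 1 /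
  -- ‖y‖`.
  have hz : ‖S.dilCoord (k := k) c⁻¹ y‖ ≤ 1 := by
    have h1 : ‖‖y‖⁻¹ • y‖ = 1 := by simp [norm_smul, hpos.ne']
    rw [← h1, EuclideanSpace.norm_eq, EuclideanSpace.norm_eq]
    refine Real.sqrt_le_sqrt (Finset.sum_le_sum fun j _ => ?_)
    refine pow_le_pow_left₀ (norm_nonneg _) ?_ 2
    rw [dilCoord_apply, PiLp.smul_apply, norm_mul, norm_smul, ← hcs, norm_pow, norm_inv, norm_inv,
      norm_pow, Real.norm_of_nonneg hc0.le, inv_pow]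
    refine mul_le_mul_of_nonneg_right ?_ (norm_nonneg _)
    exact inv_anti₀ (by positivity)
      (pow_le_pow_of_le_one hc0.le hc1 (S.deg_mem_Icc hX (Fin.natAdd k j)).2)
  have h2 : y = S.dilCoord (k := k) c (S.dilCoord (k := k) c⁻¹ y) := by
    rw [dilCoord_dilCoord, mul_inv_cancel₀ hc0.ne', dilCoord_one]
  have h3 := hC (S.dilCoord (k := k) c⁻¹ y) (by simpa using hz)
  conv_lhs => rw [h2, S.expW_dilCoord hX, hN.dil c hc0, _root_.mul_comm]
  exact mul_le_mul_of_nonneg_right (((le_abs_self _).trans h3).trans (le_max_left _ _)) hc0.le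

variable [TopologicalSpace 𝔤] [IsTopologicalAddGroup 𝔤] [ContinuousSMul ℝ 𝔤] {N : 𝔤 → ℝ}
  (hN : S.IsHomNorm N) {d : 𝔤 → 𝔤 → ℝ} (hd : S.IsHomDist d) (hφ : MapsTo φ U L)
  (hUID : S.UID N d W L U φ)
include hk hWL hW hL hN hd hφ hUID

theorem UID.isLocLittleHolder_coordFun (hs : 2 ≤ s) :
    IsLocLittleHolder (1 / (s : ℝ)) (coordFun X φ) (expW X ⁻¹' U) := by
  have hfc : ContinuousOn (coordFun X φ) (expW X ⁻¹' U) :=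
    UID.continuousOn_coordFun S hX hk hWL hW hL hN hd hφ hUID
  refine ⟨hfc, fun U' _ hK hKU => ⟨hfc.mono (subset_closure.trans hKU), fun ε hε => ?_⟩⟩
  obtain ⟨C₁, hC₁, htrans⟩ := S.exists_norm_transCoord_le (X := X) hK (hfc.mono hKU)
  obtain ⟨C₂, hC₂, hnorm⟩ := S.exists_homNorm_expW_le hX hN (by omega)
  set α := 1 / (s : ℝ) with hα
  have hα0 : 0 < α := by positivity
  have hα1 : 0 < 1 - α := by
    have h2 : (2 : ℝ) ≤ s := by exact_mod_cast hs
    have : α < 1 := by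
      rw [hα, div_lt_one (by linarith)]
      linarith
    linarith
  have hA : 0 < C₂ * C₁ ^ α := by positivity
  obtain ⟨C, hC, r, hr, hbound⟩ := UID.exists_bound_of_isCompact S hX hk hWL hW hL hN hd hφ hUID
    hK hKU (ε := ε / (2 * (C₂ * C₁ ^ α))) (by positivity)
  -- The horizontal term is only `O(t)`, with an uncontrolled constant. It is `o(t ^ α)` because `α
  -- = 1 / s < 1`, and this is where `s ≥ 2` enters.
  have hev : ∀ᶠ t : ℝ in 𝓝 0, C₁ * t < r ∧ C₁ * t < 1 ∧ C * (l * C₁) * t ^ (1 - α) < ε / 2 := by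
    have h1 : Tendsto (fun t : ℝ => C₁ * t) (𝓝 0) (𝓝 0) :=
      Continuous.tendsto' (by fun_prop) _ _ (by simp)
    have h2 : Tendsto (fun t : ℝ => C * (l * C₁) * t ^ (1 - α)) (𝓝 0) (𝓝 0) := by
      refine Continuous.tendsto' ?_ _ _ (by simp [Real.zero_rpow hα1.ne'])
      exact continuous_const.mul (Real.continuous_rpow_const hα1.le)
    filter_upwards [h1.eventually_lt_const hr, h1.eventually_lt_const one_pos,
      h2.eventually_lt_const (half_pos hε)] with t h h' h'' using ⟨h, h', h''⟩
  obtain ⟨r₀, hr₀, hr₀'⟩ := Metric.eventually_nhds_iff.1 hev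
  refine ⟨r₀, hr₀, fun x hx x' hx' hpos hlt => ?_⟩
  replace hx := subset_closure hx
  replace hx' := subset_closure hx'
  set t := dist x' x with ht
  obtain ⟨ht1, ht2, ht3⟩ := hr₀' (y := t) (by simpa [abs_of_pos hpos] using hlt)
  have hy := htrans x hx x' hx'
  rw [div_le_iff₀ (by positivity), dist_eq_norm]
  have h1 := hbound x hx x' (hKU hx') (hy.trans_lt ht1)
  have h2 := S.horNorm_le (k := k) (S.transCoord X (coordFun X φ x) x x')
  have h3 := hnorm _ (hy.trans ht2.le)
  have h4 : ‖S.transCoord X (coordFun X φ x) x x'‖ ^ α ≤ C₁ ^ α * t ^ α := by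
    rw [← Real.mul_rpow hC₁.le hpos.le]
    exact Real.rpow_le_rpow (norm_nonneg _) hy hα0.le
  have h5 : t = t ^ (1 - α) * t ^ α := by
    rw [← Real.rpow_add hpos, sub_add_cancel, Real.rpow_one]
  have htα : 0 < t ^ α := by positivity
  have h6 : C * S.horNorm k (S.transCoord X (coordFun X φ x) x x') ≤ ε / 2 * t ^ α :=
    calc C * S.horNorm k (S.transCoord X (coordFun X φ x) x x')
        ≤ C * (l * (C₁ * t)) := mul_le_mul_of_nonneg_left
          (h2.trans (mul_le_mul_of_nonneg_left hy (Nat.cast_nonneg l))) hC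
      _ = C * (l * C₁) * t ^ (1 - α) * t ^ α := by
          rw [_root_.mul_assoc _ (t ^ (1 - α)), ← h5]
          ring
      _ ≤ ε / 2 * t ^ α := mul_le_mul_of_nonneg_right ht3.le htα.le
  have h7 : ε / (2 * (C₂ * C₁ ^ α)) * N (expW X (S.transCoord X (coordFun X φ x) x x')) ≤
      ε / 2 * t ^ α :=
    calc ε / (2 * (C₂ * C₁ ^ α)) * N (expW X (S.transCoord X (coordFun X φ x) x x'))
        ≤ ε / (2 * (C₂ * C₁ ^ α)) * (C₂ * (C₁ ^ α * t ^ α)) :=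
          mul_le_mul_of_nonneg_left (h3.trans (mul_le_mul_of_nonneg_left h4 hC₂.le))
            (by positivity)
      _ = ε / 2 * t ^ α := by field_simp
  linarith

end Stratification

end

theorem mainTheorem8 {𝔤 : Type*} [LieRing 𝔤] [LieAlgebra ℝ 𝔤]
    [TopologicalSpace 𝔤] [IsTopologicalAddGroup 𝔤] [ContinuousSMul ℝ 𝔤] [T2Space 𝔤]
    {s : ℕ} (S : Stratification 𝔤 s)
    (N : 𝔤 → ℝ) (hN : S.IsHomNorm N) (d : 𝔤 → 𝔤 → ℝ) (hd : S.IsHomDist d)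
    (W L : Set 𝔤) (hWL : S.IsComplementary W L)
    {k l : ℕ} (X : Module.Basis (Fin (k + l)) ℝ 𝔤) (hX : S.IsAdapted X) (hk : k ≤ S.rank)
    (hW : W = (Submodule.span ℝ (Set.range fun j : Fin l => X (Fin.natAdd k j)) : Set 𝔤))
    (hL : L = (Submodule.span ℝ (Set.range fun i : Fin k => X (Fin.castAdd l i)) : Set 𝔤))
    (U : Set 𝔤) (hU : ∃ O : Set 𝔤, IsOpen O ∧ U = W ∩ O)
    (φ : 𝔤 → 𝔤) (hφ : Set.MapsTo φ U L) (hUID : S.UID N d W L U φ) :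
    (∀ V : Set 𝔤, IsCompact (closure V) → closure V ⊆ U →
      ∀ ε : ℝ, 0 < ε → ∃ ρ : ℝ, 0 < ρ ∧
        ∀ j : Fin l, S.rank ≤ k + (j : ℕ) →
        ∀ (I : Set ℝ) (γ : ℝ → EuclideanSpace ℝ (Fin l)), I.OrdConnected →
          (∀ t ∈ I, expW X (γ t) ∈ V) →
          (∀ t ∈ I, HasDerivWithinAt γ
            (projField X S W L φ (X (Fin.natAdd k j)) (γ t)) I t) →
          ∀ t ∈ I, ∀ t' ∈ I, 0 < |t - t'| → |t - t'| ≤ ρ →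
            ‖coordFun X φ (γ t) - coordFun X φ (γ t')‖ /
              |t - t'| ^ (1 / (S.deg (k + (j : ℕ)) : ℝ)) ≤ ε) ∧
    (2 ≤ s → IsLocLittleHolder (1 / (s : ℝ)) (coordFun X φ) (expW X ⁻¹' U)) := by
  obtain ⟨O, -, hUO⟩ := hU
  refine ⟨fun V hV hVU ε hε => ?_, fun hs => ?_⟩
  · exact Stratification.UID.exists_littleHolder_bound_along_projField S hX hk hWL hW hL hN hd hφ
      hUID (hUO ▸ inter_subset_left) hV hVU hε
  · exact Stratification.UID.isLocLittleHolder_coordFun S hX hk hWL hW hL hN hd hφ hUID hs
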